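/- Let $\mathbb K$ be a field of characteristic $0$. All vector spaces are super vector spaces over $\mathbb K$ ($V=V_0\oplus V_1$), and supersigns are extended multilinearly from homogeneous elements. For $h\in\mathbb K^2$ write $h=(h,\bar h)$, $-1=(-1,-1)$, and let $\check{\mathbb K}=\{h\in\mathbb K^2 : h-\bar h\in\mathbb Z\}$. Put $\check z^{\,h}=z^{h}\bar z^{\bar h}$. **Distributions and fields.** A distribution is a formal sum $a(\check z)=\sum_{n\in\mathbb K^2}a_n\check z^{-n-1}$ with $a_n\in\mathrm{End}(V)$; similarly in several variables $\check z_1,\dots,\check z_r$. It is a field if for each $x\in V$ the series $a(\check z_1,\dots,\check z_r)x$ is a finite sum of terms $\check z_1^{-h_1}\cdots\check z_r^{-h_r}p$ with $h_i\in\mathbb K^2$ and $p$ a $V$-valued power series. For $h\in\mathbb K^2$ let $$(\check z-\check w)^{h}=\sum_{k\in\mathbb N^2}(-1)^{k+\bar k}\tbinom{h}{k}\tbinom{\bar h}{\bar k}\,\check z^{\,h-k}\check w^{\,k},$$ and for $h\in\check{\mathbb K}$ let $(\check z-\check w)^h_{w>z}=(-1)^{h-\bar h}(\check w-\check z)^h$.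 **OPEs and products.** Distributions $a(\check z),b(\check z)$ are OPE-finite if $a(\check z)b(\check w)=\sum_{i=1}^r c^i(\check z,\check w)/(\check z-\check w)^{h_i}$ for some fields $c^i$ and $h_i\in\mathbb K^2$. Then, for $n\in\mathbb K^2$, $$a(\check w)_{(n)}b(\check w)=\sum_{i}\partial_{\check z}^{(h_i-1-n)}c^i(\check z,\check w)\big|_{\check z=\check w},$$ where $\partial_{\check z}^{(s)}=\frac{\partial_z^{s}}{s!}\frac{\partial_{\bar z}^{\bar s}}{\bar s!}$ if $s\in\mathbb N^2$ and $\partial_{\check z}^{(s)}=0$ otherwise; this does not depend on the chosen OPE. These products make the space $\mathcal F(V)$ of fields in one variable $\check z$ a partial $\mathbb K^2$-fold algebra. **Locality.** $a(\check z)$ and $b(\check z)$ are mutually local if there are such $c^i$, with all $h_i\in\check{\mathbb K}$, for which moreover $\pm b(\check w)a(\check z)=\sum_i c^i(\check z,\check w)/(\check z-\check w)^{h_i}_{w>z}$, where $\pm$ is the supersign. A finite family $a^1,\dots,a^r$ is multiply local if there are finite families $(h_{ij}^k)_k$ in $\check{\mathbb K}$ for $i<j$ and fields $c^\alpha(\check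 z_1,\dots,\check z_r)$, indexed by all choices $\alpha$ of one index $k=\alpha(i,j)$ for every pair $i<j$, such that for every permutation $\sigma$ $$\pm\, a^{\sigma1}(\check z_{\sigma1})\cdots a^{\sigma r}(\check z_{\sigma r})=\sum_\alpha \frac{c^\alpha(\check z_1,\dots,\check z_r)}{\prod_{i<j}(\check z_i-\check z_j)_\sigma^{h_{ij}^{\alpha(i,j)}}},$$ where $\pm$ is the sign of $\sigma$ restricted to the odd indices, and $(\check z_i-\check z_j)_\sigma^h$ is $(\check z_i-\check z_j)^h$ if $\sigma^{-1}(i)<\sigma^{-1}(j)$ and $(\check z_i-\check z_j)^h_{z_j>z_i}$ otherwise. **OPE-algebras.** A $\mathbb K^2$-fold algebra is a vector space $V$ with an even linear map $Y:a\mapsto a(\check z)=Y(a,\check z)=\sum_{n\in\mathbb K^2} a_{(n)}\check z^{-n-1}$ from $V$ to the $\mathrm{End}(V)$-valued distributions; its space of fields $\mathcal F_Y$ is the image of $Y$. It is local if any two elements of $\mathcal F_Y$ are mutually local, and multiply local if any finite family in $\mathcal F_Y$ is. It is an OPE-algebra if it is local and there are even operators $T,\bar T$ of $V$ and an even vector $1\in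 V$ such that, for every $a\in V$, $[T,a(\check z)]=\partial_z a(\check z)$ and $[\bar T,a(\check z)]=\partial_{\bar z}a(\check z)$; $T1=\bar T1=0$; and $1$ is a right identity, i.e. $a_{(-1)}1=a$ and $a_{(n)}1=0$ unless both components of $n$ are negative integers. A right identity is an identity if also $1_{(n)}a=\delta_{n,-1}a$ for all $a\in V$ and $n\in\mathbb K^2$. An isomorphism of OPE-algebras is an even linear isomorphism compatible with all $n$-th products and mapping the identity to the identity. **Proposition.** Let $V$ be an OPE-algebra. 1. If $a,b\in V$ and $n\in\mathbb K^2$ are such that $a(\check z)_{(n)}b(\check z)$ is mutually local with every element of $\mathcal F_Y$, then $a(\check z)_{(n)}b(\check z)=Y(a_{(n)}b,\check z)$. 2. If $V$ is multiply local, then $\mathcal F_Y$ is a unital $\mathbb K^2$-fold subalgebra of the partial $\mathbb K^2$-fold algebra $\mathcal F(V)$: its elements are fields, any two of them are OPE-finite, it is closed under all $n$-th products, and it contains the identity field $\mathrm{id}_V$, which is its identity. With these products $\mathcal F_Y$ is an OPE-algebra, and $Y:V\to\mathcal F_Y$ is an isomorphism of OPE-algebras. -/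

import Mathlib

universe u v w

/-! ### Super vector spaces -/

/-- A super vector space: a vector space with a decomposition into an even and an odd part. -/
class SuperSpace (K : Type u) (V : Type v) [Field K] [AddCommGroup V] [Module K V] where
  even : Submodule K V
  odd : Submodule K V
  isCompl : IsCompl even odd

namespace SuperSpace

variable (K : Type u) {V : Type v} [Field K] [AddCommGroup V] [Module K V] [SuperSpace K V]

/-- The subspace of vectors of parity `p`. -/
def part (p : ZMod 2) : Submodule K V := if p = 0 then even else odd

/-- The projection of `V` onto its part of parity `p`. -/
noncomputable def proj (p : ZMod 2) : V →ₗ[K] V :=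
  if p = 0 then Submodule.projection even odd isCompl
  else Submodule.projection odd even isCompl.symm

/-- An operator has parity `p` if it shifts the parity of vectors by `p`. -/
def HasParity (p : ZMod 2) (f : Module.End K V) : Prop :=
  ∀ q : ZMod 2, ∀ x ∈ part K (V := V) q, f x ∈ part K (V := V) (p + q)

/-- The component of parity `p` of an operator. -/
noncomputable def opPart (p : ZMod 2) (f : Module.End K V) : Module.End K V :=
  ∑ q : ZMod 2, proj K (p + q) ∘ₗ f ∘ₗ proj K q

end SuperSpace

/-! ### Index conventions

An element `h = (h.1, h.2)` of `K × K` is a pair of exponents of a variable `z` and of its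
formal conjugate. -/

namespace OPEAlg

section Powers

variable {K : Type u} [Field K]

/-- A pair of natural numbers as an element of `K × K`. -/
def natPair (k : ℕ × ℕ) : K × K := ((k.1 : K), (k.2 : K))

/-- `n ≤ h`, that is, `h - n` lies in `ℕ × ℕ`. -/
def NatLE (n h : K × K) : Prop := ∃ k : ℕ × ℕ, h = n + natPair k

/-- The pairs `h` such that `h.1 - h.2` is an integer. -/
def IsStatistical (h : K × K) : Prop := ∃ d : ℤ, h.1 - h.2 = (d : K)

open Classical in
/-- The sign `(-1) ^ (h.1 - h.2)` of a pair `h` whose difference `h.1 - h.2` is an integer. -/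
noncomputable def statSign (h : K × K) : K :=
  if ∃ d : ℤ, h.1 - h.2 = ((2 * d : ℤ) : K) then 1 else -1

/-- The binomial coefficient `h (h - 1) ⋯ (h - k + 1) / k!`. -/
noncomputable def binom (h : K) (k : ℕ) : K :=
  (∏ i ∈ Finset.range k, (h - (i : K))) / (k.factorial : K)

/-- `(-1) ^ (k.1 + k.2)` times the product of the binomial coefficients of `h.1, k.1` and of
`h.2, k.2`: the coefficient of `z ^ (h - k) w ^ k` in the expansion of `(z - w) ^ h` for `z > w`. -/
noncomputable def powCoeff (h : K × K) (k : ℕ × ℕ) : K :=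
  (-1) ^ (k.1 + k.2) * (binom h.1 k.1 * binom h.2 k.2)

end Powers

/-! ### Distributions and fields -/

/-- `End(V)`-valued distributions `a(z) = ∑ aₙ z ^ (-n-1)` in one pair of variables, given by
their modes `n ↦ aₙ` for `n` in `K × K`. -/
abbrev Distr (K : Type u) (V : Type v) [Field K] [AddCommGroup V] [Module K V] :=
  K × K → Module.End K V

/-- `End(V)`-valued distributions `∑ aₙₘ z ^ (-n-1) w ^ (-m-1)` in two pairs of variables. -/
abbrev Distr₂ (K : Type u) (V : Type v) [Field K] [AddCommGroup V] [Module K V] :=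
  K × K → K × K → Module.End K V

/-- `End(V)`-valued distributions in `r` pairs of variables, given by their modes. -/
abbrev DistrN (K : Type u) (V : Type v) [Field K] [AddCommGroup V] [Module K V] (r : ℕ) :=
  (Fin r → K × K) → Module.End K V

section Fields

variable {K : Type u} {V : Type v} [Field K] [AddCommGroup V] [Module K V]

/-- Fields in one pair of variables: for every vector `x`, the series `a(z) x` is a finite sum of
series of the form `z ^ (-h)` times a power series. -/
def IsField (a : Distr K V) : Prop :=
  ∀ x : V, ∃ S : Finset (K × K), ∀ n, a n x ≠ 0 → ∃ h ∈ S, NatLE n h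

/-- Fields in two pairs of variables: for every vector `x`, the series `c(z, w) x` is a finite sum
of series of the form `z ^ (-h) w ^ (-h')` times a power series in `z` and `w`. -/
def IsField₂ (c : Distr₂ K V) : Prop :=
  ∀ x : V, ∃ S : Finset ((K × K) × (K × K)),
    ∀ n m, c n m x ≠ 0 → ∃ h ∈ S, NatLE n h.1 ∧ NatLE m h.2

/-- Fields in `r` pairs of variables. -/
def IsFieldN {r : ℕ} (c : DistrN K V r) : Prop :=
  ∀ x : V, ∃ S : Finset (Fin r → K × K), ∀ n, c n x ≠ 0 → ∃ h ∈ S, ∀ i, NatLE (n i) (h i)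

/-- The juxtaposition `a(z) b(w)`. -/
def juxt (a b : Distr K V) : Distr₂ K V := fun n m => a n * b m

/-- The identity field `1(z) = id`. -/
noncomputable def identityField : Distr K V :=
  open Classical in fun n => if n = (-1, -1) then 1 else 0

/-- The modes of `(z - w) ^ e` times the `V`-valued series `f(z, w)`, with `(z - w) ^ e` expanded
in non-negative integral powers of `w`. -/
noncomputable def mulPow (e : K × K) (f : K × K → K × K → V) (n m : K × K) : V :=
  ∑ᶠ k : ℕ × ℕ, powCoeff e k • f (n + e - natPair k) (m + natPair k)

/-- The modes of `(z - w) ^ e` times the `V`-valued series `f(z, w)`, with `(z - w) ^ e` expanded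
in non-negative integral powers of `z`, that is, as `(-1) ^ (e.1 - e.2) (w - z) ^ e`. -/
noncomputable def mulPowOpp (e : K × K) (f : K × K → K × K → V) (n m : K × K) : V :=
  ∑ᶠ k : ℕ × ℕ, (statSign e * powCoeff e k) • f (n + natPair k) (m + e - natPair k)

/-- An OPE `a(z, w) = ∑ᵢ cⁱ(z, w) / (z - w) ^ hᵢ` with fields `cⁱ(z, w)` as numerators. -/
structure OPE (a : Distr₂ K V) where
  length : ℕ
  num : Fin length → Distr₂ K V
  isField : ∀ i, IsField₂ (num i)
  order : Fin length → K × K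
  eq : ∀ n m x, a n m x = ∑ i, mulPow (-(order i)) (fun n' m' => num i n' m' x) n m

/-- Two distributions are OPE-finite if their juxtaposition has an OPE. -/
def OPEFinite (a b : Distr K V) : Prop := Nonempty (OPE (juxt a b))

theorem finite_support_diag [CharZero K] {c : Distr₂ K V} (hc : IsField₂ c) (k : ℕ × ℕ)
    (p : K × K) (x : V) :
    (Function.support fun m : K × K =>
      powCoeff m k • c (m - natPair k) (p - m - (1, 1)) x).Finite := by
  obtain ⟨S, hS⟩ := hc x
  have key : ∀ s : K × K, {i : ℕ × ℕ | ∃ j : ℕ × ℕ, natPair (K := K) (i + j) = s}.Finite := by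
    intro s
    by_cases h : ∃ N : ℕ × ℕ, natPair (K := K) N = s
    · obtain ⟨N, rfl⟩ := h
      refine (Set.finite_Iic N).subset ?_
      rintro i ⟨j, hj⟩
      simp only [natPair, Prod.mk.injEq, Nat.cast_inj] at hj
      refine ⟨?_, ?_⟩
      · rw [← hj.1]; simp
      · rw [← hj.2]; simp
    · refine Set.finite_empty.subset ?_
      rintro i ⟨j, hj⟩
      exact h ⟨_, hj⟩
  refine (S.finite_toSet.biUnion fun h _ =>
    (key (h.1 + h.2 - (p - natPair k - (1, 1)))).image
      fun i => h.1 + natPair k - natPair i).subset ?_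
  intro m hm
  have hm' : c (m - natPair k) (p - m - (1, 1)) x ≠ 0 := by
    intro h0
    simp [h0] at hm
  obtain ⟨h, hh, ⟨i, hi⟩, ⟨j, hj⟩⟩ := hS _ _ hm'
  simp only [Set.mem_iUnion, Set.mem_image]
  refine ⟨h, hh, i, ⟨j, ?_⟩, ?_⟩
  · have : natPair (K := K) (i + j) = natPair i + natPair j := by
      simp [natPair]
    rw [this, hi, hj]
    abel
  · rw [hi]
    abel

/-- The modes of the field `∂_z^(k) c(z, w) |_{z = w}` in `w`, where `∂_z^(k)` denotes the divided
power of the derivative with respect to `z` of order `k` in `ℕ × ℕ`. -/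
noncomputable def diagDeriv [CharZero K] (c : Distr₂ K V) (hc : IsField₂ c) (k : ℕ × ℕ) :
    Distr K V := fun p =>
  { toFun := fun x => ∑ᶠ m : K × K, powCoeff m k • c (m - natPair k) (p - m - (1, 1)) x
    map_add' := by
      intro x y
      rw [← finsum_add_distrib (finite_support_diag hc k p x) (finite_support_diag hc k p y)]
      simp only [map_add, smul_add]
    map_smul' := by
      intro t x
      rw [RingHom.id_apply, smul_finsum' t (finite_support_diag hc k p x)]
      simp only [map_smul, smul_comm t] }

open Classical in
/-- The field `∂_z^(s) c(z, w) |_{z = w}` for `s` in `K × K`, where `∂_z^(s)` is zero unless `s`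
lies in `ℕ × ℕ`. -/
noncomputable def taylorDiag [CharZero K] (c : Distr₂ K V) (hc : IsField₂ c) (s : K × K) :
    Distr K V :=
  if h : ∃ k : ℕ × ℕ, s = natPair k then diagDeriv c hc h.choose else 0

/-- The `n`-th OPE-coefficient `∑ᵢ ∂_z^(hᵢ - n) cⁱ(z, w) |_{z = w}`. -/
noncomputable def OPE.coeff [CharZero K] {a : Distr₂ K V} (o : OPE a) (n : K × K) : Distr K V :=
  ∑ i, taylorDiag (o.num i) (o.isField i) (o.order i - n)

open Classical in
/-- The `n`-th product `a(z)_(n) b(z)` of OPE-finite distributions: the `(n+1)`-st OPE-coefficient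
of `a(z) b(w)`, which does not depend on the choice of an OPE. (The value for distributions that
are not OPE-finite is irrelevant; the product is partial.) -/
noncomputable def nthProd [CharZero K] (a b : Distr K V) (n : K × K) : Distr K V :=
  if h : OPEFinite a b then (Classical.choice h).coeff (n + (1, 1)) else 0

end Fields

/-! ### Locality and multiple locality -/

section Locality

variable {K : Type u} {V : Type v} [Field K] [AddCommGroup V] [Module K V] [SuperSpace K V]

/-- `(-1) ^ (p q)` for parities `p` and `q`. -/
def superSign (p q : ZMod 2) : ℤ := if p = 1 ∧ q = 1 then -1 else 1

/-- The product `b(w) a(z)` in the opposite order including the supersign, with modes indexed as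
for `a(z) b(w)`; the supersign is extended bilinearly to distributions that are not homogeneous. -/
noncomputable def superSwap (a b : Distr K V) : Distr₂ K V := fun n m =>
  ∑ p : ZMod 2, ∑ q : ZMod 2,
    superSign p q • (SuperSpace.opPart K q (b m) * SuperSpace.opPart K p (a n))

/-- Mutual locality: there is an OPE of `a(z) b(w)` with pole orders whose components differ by
integers such that the product in the opposite order is given by the same numerators and
the opposite expansions of the powers of `z - w`. -/
def MutuallyLocal (a b : Distr K V) : Prop :=
  ∃ o : OPE (juxt a b), (∀ i, IsStatistical (o.order i)) ∧
    ∀ n m x, superSwap a b n m x =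
      ∑ i, mulPowOpp (-(o.order i)) (fun n' m' => o.num i n' m' x) n m

/-- Pairs `i < j` of indices. -/
abbrev IdxPair (r : ℕ) := {p : Fin r × Fin r // p.1 < p.2}

/-- The coefficient of the `k`-th term in the expansion of `(z_i - z_j) ^ e` in the
order of variables `z_{σ 1} > ⋯ > z_{σ r}`. -/
noncomputable def expCoeff {r : ℕ} (σ : Equiv.Perm (Fin r)) (p : IdxPair r) (e : K × K)
    (k : ℕ × ℕ) : K :=
  if σ.symm p.1.1 < σ.symm p.1.2 then powCoeff e k else statSign e * powCoeff e k

/-- The exponents of the `k`-th term in the expansion of `(z_i - z_j) ^ e` in the order of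
variables `z_{σ 1} > ⋯ > z_{σ r}`: this term is a multiple of `z_i ^ (e - k) z_j ^ k` if `z_i`
precedes `z_j` and of `z_j ^ (e - k) z_i ^ k` otherwise. -/
noncomputable def expShift {r : ℕ} (σ : Equiv.Perm (Fin r)) (p : IdxPair r) (e : K × K)
    (k : ℕ × ℕ) : Fin r → K × K :=
  if σ.symm p.1.1 < σ.symm p.1.2 then
    Pi.single p.1.1 (e - natPair k) + Pi.single p.1.2 (natPair k)
  else
    Pi.single p.1.2 (e - natPair k) + Pi.single p.1.1 (natPair k)

/-- The modes of `∏_{i < j} (z_i - z_j) ^ (e i j)` times the `V`-valued series `f(z_1, …, z_r)`,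
with all powers expanded in the order of variables `z_{σ 1} > ⋯ > z_{σ r}`. -/
noncomputable def mulPows {r : ℕ} (σ : Equiv.Perm (Fin r)) (e : IdxPair r → K × K)
    (f : (Fin r → K × K) → V) (n : Fin r → K × K) : V :=
  ∑ᶠ k : IdxPair r → ℕ × ℕ,
    (∏ p, expCoeff σ p (e p) (k p)) • f (n + ∑ p, expShift σ p (e p) (k p))

/-- The sign of the permutation `σ` restricted to the set of odd indices `i`, that is, with
`p i = 1`. -/
def koszulSign {r : ℕ} (σ : Equiv.Perm (Fin r)) (p : Fin r → ZMod 2) : ℤ :=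
  ∏ q : IdxPair r, if σ q.1.2 < σ q.1.1 then superSign (p (σ q.1.1)) (p (σ q.1.2)) else 1

/-- The product `a^{σ 1}(z_{σ 1}) ⋯ a^{σ r}(z_{σ r})` including the supersign of the permutation
`σ`, extended multilinearly to distributions that are not homogeneous. -/
noncomputable def superProd {r : ℕ} (σ : Equiv.Perm (Fin r)) (a : Fin r → Distr K V) :
    DistrN K V r := fun n =>
  ∑ p : Fin r → ZMod 2, koszulSign σ p •
    (List.ofFn fun i => SuperSpace.opPart K (p (σ i)) (a (σ i) (n (σ i)))).prod

/-- Multiple locality of a finite family of distributions: for suitable pole orders `h i j k`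
(whose components differ by integers) and fields `c^α(z_1, …, z_r)`, where `α` chooses one of the
pole orders for every pair `i < j`, the product in the order given by any permutation `σ` is
`∑_α c^α(z_1, …, z_r) / ∏_{i < j} (z_i - z_j) ^ (h i j (α i j))`, with the powers expanded in
the order of the variables given by `σ`. -/
def MultiplyLocal {r : ℕ} (a : Fin r → Distr K V) : Prop :=
  ∃ (s : IdxPair r → ℕ) (h : ∀ p, Fin (s p) → K × K) (c : (∀ p, Fin (s p)) → DistrN K V r),
    (∀ p k, IsStatistical (h p k)) ∧ (∀ α, IsFieldN (c α)) ∧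
    ∀ (σ : Equiv.Perm (Fin r)) (n : Fin r → K × K) (x : V),
      superProd σ a n x =
        ∑ α, mulPows σ (fun p => -(h p (α p))) (fun n' => c α n' x) n

end Locality

/-! ### Algebras with products indexed by `K × K` and OPE-algebras -/

/-- A `K²`-fold algebra: an even state-field correspondence `a ↦ Y(a, z) = ∑ a_(n) z ^ (-n-1)`.
The `n`-th product `a_(n) b` is `Y a n b`. -/
structure FoldAlgebra (K : Type u) (V : Type v) [Field K] [AddCommGroup V] [Module K V]
    [SuperSpace K V] where
  Y : V →ₗ[K] Distr K V
  parity : ∀ p : ZMod 2, ∀ a ∈ SuperSpace.part K (V := V) p, ∀ n,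
    SuperSpace.HasParity K p (Y a n)

namespace FoldAlgebra

variable {K : Type u} {V : Type v} [Field K] [AddCommGroup V] [Module K V] [SuperSpace K V]

/-- The space of fields, that is, the image of the state-field correspondence. -/
def fieldSpace (A : FoldAlgebra K V) : Submodule K (Distr K V) := LinearMap.range A.Y

/-- A pair of even operators is a translation generator if `[T, a(z)] = ∂_z a(z)` for every state
`a`, and similarly for the second operator and the conjugate variable. -/
structure IsTranslationGenerator (A : FoldAlgebra K V) (T T' : Module.End K V) : Prop where
  even : SuperSpace.HasParity K 0 T
  even' : SuperSpace.HasParity K 0 T'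
  comm : ∀ a b n, T (A.Y a n b) = -(n.1 • A.Y a (n - (1, 0)) b) + A.Y a n (T b)
  comm' : ∀ a b n, T' (A.Y a n b) = -(n.2 • A.Y a (n - (0, 1)) b) + A.Y a n (T' b)

/-- A right identity: an even state `e` such that `a_(-1) e = a` and `a_(n) e = 0` unless both
components of `n` are negative integers. -/
structure IsRightIdentity (A : FoldAlgebra K V) (e : V) : Prop where
  even : e ∈ SuperSpace.part K (V := V) 0
  apply_neg_one : ∀ a, A.Y a (-1, -1) e = a
  apply_eq_zero : ∀ a n, ¬ NatLE n ((-1, -1) : K × K) → A.Y a n e = 0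

/-- An identity: a right identity `e` such that `e_(-1) a = a` and `e_(n) a = 0` for `n ≠ -1`. -/
structure IsIdentity (A : FoldAlgebra K V) (e : V) : Prop extends A.IsRightIdentity e where
  left_neg_one : ∀ a, A.Y e (-1, -1) a = a
  left_eq_zero : ∀ a n, n ≠ (-1, -1) → A.Y e n a = 0

/-- An algebra is local if any two states are mutually local. -/
def IsLocal (A : FoldAlgebra K V) : Prop := ∀ a b, MutuallyLocal (A.Y a) (A.Y b)

/-- An algebra is multiply local if any finite family of states is multiply local. -/
def IsMultiplyLocal (A : FoldAlgebra K V) : Prop :=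
  ∀ (r : ℕ) (a : Fin r → V), MultiplyLocal fun i => A.Y (a i)

/-- `A` is a local algebra with translation generator `(T, T')` and invariant right identity
`e`. -/
structure IsOPEAlgebraWith (A : FoldAlgebra K V) (T T' : Module.End K V) (e : V) : Prop where
  isLocal : A.IsLocal
  isTranslationGenerator : A.IsTranslationGenerator T T'
  isRightIdentity : A.IsRightIdentity e
  invariant : T e = 0
  invariant' : T' e = 0

/-- An OPE-algebra: a local algebra that has a translation generator and a right identity which is
invariant for it. -/
def IsOPEAlgebra (A : FoldAlgebra K V) : Prop := ∃ T T' e, A.IsOPEAlgebraWith T T' e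

/-- The super vector space structure of the space of fields: a distribution has parity `p` if all
its modes have parity `p`. -/
instance (A : FoldAlgebra K V) : SuperSpace K A.fieldSpace where
  even :=
    { carrier := {a | ∀ n, SuperSpace.HasParity K 0 (a.1 n)}
      add_mem' := fun ha hb n q x hx => add_mem (ha n q x hx) (hb n q x hx)
      zero_mem' := fun _ _ _ _ => zero_mem _
      smul_mem' := fun t _ ha n q x hx => Submodule.smul_mem _ t (ha n q x hx) }
  odd :=
    { carrier := {a | ∀ n, SuperSpace.HasParity K 1 (a.1 n)}
      add_mem' := fun ha hb n q x hx => add_mem (ha n q x hx) (hb n q x hx)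
      zero_mem' := fun _ _ _ _ => zero_mem _
      smul_mem' := fun t _ ha n q x hx => Submodule.smul_mem _ t (ha n q x hx) }
  isCompl := by
    have hdis : ∀ y : V, y ∈ SuperSpace.part K (V := V) 0 →
        y ∈ SuperSpace.part K (V := V) 1 → y = 0 := by
      intro y h0 h1
      exact (Submodule.disjoint_def.mp (SuperSpace.isCompl (K := K) (V := V)).disjoint) y h0 h1
    have hdec : ∀ y : V, ∃ y0 ∈ SuperSpace.part K (V := V) 0,
        ∃ y1 ∈ SuperSpace.part K (V := V) 1, y0 + y1 = y := by
      intro y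
      exact Submodule.mem_sup.mp
        ((SuperSpace.isCompl (K := K) (V := V)).sup_eq_top ▸ Submodule.mem_top)
    refine ⟨Submodule.disjoint_def.mpr ?_, codisjoint_iff.mpr (eq_top_iff.mpr ?_)⟩
    · rintro ⟨a, ha⟩ h0 h1
      apply Subtype.ext
      funext n
      ext y
      obtain ⟨y0, hy0, y1, hy1, rfl⟩ := hdec y
      have e0 : a n y0 = 0 := hdis _ (h0 n 0 y0 hy0) (h1 n 0 y0 hy0)
      have e1 : a n y1 = 0 := hdis _ (h1 n 1 y1 hy1) (h0 n 1 y1 hy1)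
      simp [e0, e1]
    · rintro ⟨a, x, rfl⟩ -
      obtain ⟨x0, hx0, x1, hx1, rfl⟩ := hdec x
      refine Submodule.mem_sup.mpr ⟨⟨A.Y x0, x0, rfl⟩, A.parity 0 x0 hx0,
        ⟨A.Y x1, x1, rfl⟩, A.parity 1 x1 hx1, ?_⟩
      apply Subtype.ext
      simp

/-- An isomorphism of unital algebras: an even linear isomorphism that is compatible with all
products and maps identities to identities. -/
structure IsUnitalIso {W : Type w} [AddCommGroup W] [Module K W] [SuperSpace K W]
    (A : FoldAlgebra K V) (B : FoldAlgebra K W) (f : V ≃ₗ[K] W) : Prop where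
  even : ∀ p : ZMod 2, ∀ a ∈ SuperSpace.part K (V := V) p, f a ∈ SuperSpace.part K (V := W) p
  map_prod : ∀ a n b, f (A.Y a n b) = B.Y (f a) n (f b)
  map_identity : ∃ e, A.IsIdentity e ∧ B.IsIdentity (f e)

end FoldAlgebra

/-- A vector space `F` of distributions is a unital `K²`-fold subalgebra of the partial algebra of
fields, with induced algebra structure `B` (which is uniquely determined): it consists of fields,
any two elements of `F` are OPE-finite, `F` is closed under all `n`-th products,
which define the algebra structure `B`, and the identity field lies in `F` and is the
identity of `B`. -/
structure IsUnitalSubalgebra {K : Type u} {V : Type v} [Field K] [CharZero K] [AddCommGroup V]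
    [Module K V] (F : Submodule K (Distr K V)) [SuperSpace K F] (B : FoldAlgebra K F) : Prop where
  isField : ∀ a ∈ F, IsField a
  opeFinite : ∀ a ∈ F, ∀ b ∈ F, OPEFinite a b
  prod_mem : ∀ a ∈ F, ∀ b ∈ F, ∀ n, nthProd a b n ∈ F
  prod_eq : ∀ (a b : F) (n : K × K), (B.Y a n b : Distr K V) = nthProd (a : Distr K V) b n
  identity_mem : identityField ∈ F
  isIdentity : B.IsIdentity ⟨identityField, identity_mem⟩

end OPEAlg

namespace OPEAlg

open Finset.HasAntidiagonal

/-! ### Binomial coefficients -/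

section Binomials

variable {K : Type u} [Field K]

theorem binom_zero (x : K) : binom x 0 = 1 := by simp [binom]

theorem binom_succ_mul [CharZero K] (x : K) (k : ℕ) :
    ((k : K) + 1) * binom x (k + 1) = (x - k) * binom x k := by
  have h1 : ((k : K) + 1) ≠ 0 := by exact_mod_cast k.succ_ne_zero
  have h2 : (k.factorial : K) ≠ 0 := by exact_mod_cast k.factorial_ne_zero
  simp only [binom, Finset.prod_range_succ, Nat.factorial_succ]
  push_cast
  field_simp

theorem binom_add_one_succ [CharZero K] (x : K) (k : ℕ) :
    binom (x + 1) (k + 1) = binom x (k + 1) + binom x k := by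
  induction k with
  | zero => simp [binom]
  | succ k ih =>
    have h1 : ((k : K) + 1 + 1) ≠ 0 := by exact_mod_cast (k + 1).succ_ne_zero
    apply mul_left_cancel₀ h1
    have e1 := binom_succ_mul (x + 1) (k + 1)
    have e2 := binom_succ_mul x (k + 1)
    have e3 := binom_succ_mul x k
    push_cast at e1 e2 e3
    rw [e1, ih]
    linear_combination -e2 - e3

theorem binom_natCast_eq_zero (x k : ℕ) (h : x < k) : binom (x : K) k = 0 := by
  rw [binom, Finset.prod_eq_zero (Finset.mem_range.2 h) (sub_self _), zero_div]

/-- The Chu-Vandermonde identity. -/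
theorem binom_add [CharZero K] (x y : K) (k : ℕ) :
    binom (x + y) k = ∑ p ∈ antidiagonal k, binom x p.1 * binom y p.2 := by
  induction k with
  | zero => simp [binom]
  | succ k ih =>
    have h1 : ((k : K) + 1) ≠ 0 := by exact_mod_cast k.succ_ne_zero
    apply mul_left_cancel₀ h1
    have key : ((k : K) + 1) * ∑ p ∈ antidiagonal (k + 1), binom x p.1 * binom y p.2 =
        ∑ p ∈ antidiagonal (k + 1), ((p.1 : K) * binom x p.1) * binom y p.2 +
        ∑ p ∈ antidiagonal (k + 1), binom x p.1 * ((p.2 : K) * binom y p.2) := by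
      rw [Finset.mul_sum, ← Finset.sum_add_distrib]
      refine Finset.sum_congr rfl fun p hp => ?_
      have : ((p.1 : K) + p.2) = k + 1 := by exact_mod_cast mem_antidiagonal.1 hp
      rw [← this]
      ring
    rw [key, Finset.Nat.sum_antidiagonal_succ, Finset.Nat.sum_antidiagonal_succ',
      binom_succ_mul, ih]
    simp only [Nat.cast_zero, zero_mul, mul_zero, zero_add, Nat.cast_add, Nat.cast_one,
      binom_succ_mul]
    rw [Finset.mul_sum, ← Finset.sum_add_distrib]
    refine Finset.sum_congr rfl fun p hp => ?_
    have : ((p.1 : K) + p.2) = k := by exact_mod_cast mem_antidiagonal.1 hp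
    rw [← this]
    ring

theorem binom_mul_binom_sub [CharZero K] (x : K) (j l : ℕ) :
    binom x j * binom (x - j) l = binom x (j + l) * ((j + l).choose j : K) := by
  induction l with
  | zero => simp [binom_zero]
  | succ l ih =>
    have h1 : ((l : K) + 1) ≠ 0 := by exact_mod_cast l.succ_ne_zero
    apply mul_left_cancel₀ h1
    have e1 := binom_succ_mul (x - j) l
    have e2 := binom_succ_mul x (j + l)
    have e3 : ((j + (l + 1)).choose j : K) * (l + 1) = (j + l).choose j * (j + l + 1) := by
      have := Nat.choose_mul_succ_eq (j + l) j
      have h4 : j + l + 1 - j = l + 1 := by omega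
      rw [h4] at this
      exact_mod_cast this.symm
    push_cast at e2
    rw [← add_assoc]
    rw [← add_assoc] at e3
    calc _ = binom x j * ((l + 1) * binom (x - j) (l + 1)) := by ring
      _ = (binom x j * binom (x - j) l) * (x - (j + l)) := by rw [e1]; ring
      _ = binom x (j + l) * (x - (j + l)) * (j + l).choose j := by rw [ih]; ring
      _ = ((j : K) + l + 1) * binom x (j + l + 1) * (j + l).choose j := by rw [e2]; ring
      _ = binom x (j + l + 1) * ((j + l).choose j * (j + l + 1)) := by ring
      _ = _ := by rw [← e3]; ring

theorem binom_natCast [CharZero K] (n k : ℕ) : binom (n : K) k = (n.choose k : K) := by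
  rcases lt_or_ge n k with h | h
  · rw [binom_natCast_eq_zero _ _ h, Nat.choose_eq_zero_of_lt h, Nat.cast_zero]
  · obtain ⟨l, rfl⟩ := Nat.exists_eq_add_of_le h
    clear h
    induction k generalizing l with
    | zero => simp [binom_zero]
    | succ k ih =>
      have h1 : ((k : K) + 1) ≠ 0 := by exact_mod_cast k.succ_ne_zero
      apply mul_left_cancel₀ h1
      rw [binom_succ_mul]
      have h2 := ih (l + 1)
      have h3 : k + (l + 1) = k + 1 + l := by omega
      rw [h3] at h2
      rw [h2]
      have := Nat.choose_succ_right_eq (k + 1 + l) k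
      have h4 : k + 1 + l - k = l + 1 := by omega
      rw [h4] at this
      have h5 : ((k + 1 + l).choose (k + 1) : K) * (k + 1) = (k + 1 + l).choose k * (l + 1) := by
        exact_mod_cast this
      rw [mul_comm _ (((k + 1 + l).choose (k + 1) : ℕ) : K), h5]
      push_cast
      ring

open Classical in
/-- The coefficient `(-1) ^ s * binom x s` of `w ^ s` in `(1 - w) ^ x`, which is zero unless `s`
is a natural number. -/
noncomputable def altBinom (x s : K) : K :=
  if h : ∃ k : ℕ, s = k then (-1) ^ h.choose * binom x h.choose else 0

theorem altBinom_natCast [CharZero K] (x : K) (k : ℕ) :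
    altBinom x (k : K) = (-1) ^ k * binom x k := by
  have h : ∃ l : ℕ, (k : K) = l := ⟨k, rfl⟩
  have e : h.choose = k := by exact_mod_cast h.choose_spec.symm
  rw [altBinom, dif_pos h, e]

theorem altBinom_eq_zero {x s : K} (h : ¬ ∃ k : ℕ, s = k) : altBinom x s = 0 := dif_neg h

theorem exists_of_altBinom_ne_zero {x s : K} (h : altBinom x s ≠ 0) : ∃ k : ℕ, s = k := by
  by_contra hc
  exact h (altBinom_eq_zero hc)

theorem not_exists_neg_one [CharZero K] : ¬ ∃ k : ℕ, (-1 : K) = k := by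
  rintro ⟨k, hk⟩
  have : ((k + 1 : ℕ) : K) = 0 := by push_cast; rw [← hk]; ring
  exact k.succ_ne_zero (by exact_mod_cast this)

theorem altBinom_zero [CharZero K] (x : K) : altBinom x 0 = 1 := by
  have := altBinom_natCast x 0
  simpa [binom_zero] using this

theorem altBinom_add_one [CharZero K] (x s : K) :
    altBinom (x + 1) s = altBinom x s - altBinom x (s - 1) := by
  by_cases h : ∃ k : ℕ, s = k
  · obtain ⟨k, rfl⟩ := h
    rcases k with _ | k
    · have : altBinom x (-1) = 0 := altBinom_eq_zero not_exists_neg_one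
      simp [altBinom_zero, this]
    · have : (((k + 1 : ℕ) : K) - 1) = k := by push_cast; ring
      rw [this, altBinom_natCast, altBinom_natCast, altBinom_natCast, binom_add_one_succ]
      ring
  · have h' : ¬ ∃ k : ℕ, s - 1 = k := by
      rintro ⟨k, hk⟩
      exact h ⟨k + 1, by push_cast; rw [← hk]; ring⟩
    rw [altBinom_eq_zero h, altBinom_eq_zero h, altBinom_eq_zero h', sub_zero]

theorem altBinom_succ_mul [CharZero K] (x s : K) :
    (s + 1) * altBinom x (s + 1) = - ((x - s) * altBinom x s) := by
  by_cases h : ∃ k : ℕ, s = k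
  · obtain ⟨k, rfl⟩ := h
    have : ((k : K) + 1) = ((k + 1 : ℕ) : K) := by push_cast; ring
    rw [this, altBinom_natCast, altBinom_natCast, ← this]
    have := binom_succ_mul x k
    linear_combination (-1) ^ (k + 1) * this
  · rw [altBinom_eq_zero h, mul_zero, neg_zero]
    by_cases h' : ∃ k : ℕ, s + 1 = k
    · obtain ⟨k, hk⟩ := h'
      rcases k with _ | k
      · rw [hk]; simp
      · exact absurd ⟨k, by push_cast at hk; linear_combination hk⟩ h
    · rw [altBinom_eq_zero h', mul_zero]

/-- `(n + 1) binom (n + 1 + s, s) = (n + 1 + s) binom (n + s, s)`. -/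
theorem altBinom_add_self [CharZero K] (n s : K) :
    (n + 1) * altBinom (n + 1 + s) s = (n + 1 + s) * altBinom (n + s) s := by
  have e1 := altBinom_add_one (n + s) s
  have e2 := altBinom_succ_mul (n + s) (s - 1)
  have h : n + s + 1 = n + 1 + s := by ring
  rw [h] at e1
  rw [sub_add_cancel] at e2
  rw [e1]
  linear_combination -e2

theorem altBinom_add_natCast [CharZero K] (n : K) (k : ℕ) :
    altBinom (n + k) (k : K) = binom (-1 - n) k := by
  induction k with
  | zero => simp [altBinom_zero, binom_zero]
  | succ k ih =>
    have h1 : ((k : K) + 1) ≠ 0 := by exact_mod_cast k.succ_ne_zero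
    apply mul_left_cancel₀ h1
    rw [binom_succ_mul, ← ih]
    have e1 := altBinom_succ_mul (n + k + 1) (k : K)
    have e2 := altBinom_add_self n (k : K)
    have h : n + 1 + (k : K) = n + k + 1 := by ring
    rw [h] at e2
    push_cast
    rw [← add_assoc, e1]
    linear_combination -e2

end Binomials

end OPEAlg

namespace OPEAlg

/-! ### Invariant functionals on monomials

A triple `(n, m, e)` in `K × K` stands for the monomial `z ^ (-n-1) w ^ (-m-1) (z - w) ^ e`. -/

section Invariants

variable {K : Type u} {V : Type v} [Field K] [AddCommGroup V] [Module K V]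

/-- The coefficient of `w ^ s` in `(1 - w) ^ h`. -/
noncomputable def altBinom₂ (h s : K × K) : K := altBinom h.1 s.1 * altBinom h.2 s.2

theorem natPair_add (k l : ℕ × ℕ) : natPair (K := K) (k + l) = natPair k + natPair l := by
  simp [natPair]

theorem natPair_zero : natPair (K := K) 0 = 0 := by simp [natPair]

theorem natPair_injective [CharZero K] : Function.Injective (natPair (K := K)) := by
  rintro ⟨a, b⟩ ⟨c, d⟩ h
  simpa [natPair] using h

theorem powCoeff_eq_altBinom₂ [CharZero K] (e : K × K) (k : ℕ × ℕ) :
    powCoeff e k = altBinom₂ e (natPair k) := by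
  rw [powCoeff, altBinom₂, natPair, altBinom_natCast, altBinom_natCast, pow_add]
  ring

theorem exists_of_altBinom₂_ne_zero {h s : K × K} (hne : altBinom₂ h s ≠ 0) :
    ∃ k : ℕ × ℕ, s = natPair k := by
  obtain ⟨a, ha⟩ := exists_of_altBinom_ne_zero (left_ne_zero_of_mul hne)
  obtain ⟨b, hb⟩ := exists_of_altBinom_ne_zero (right_ne_zero_of_mul hne)
  exact ⟨(a, b), Prod.ext ha hb⟩

theorem altBinom₂_zero [CharZero K] (h : K × K) : altBinom₂ h 0 = 1 := by
  simp [altBinom₂, altBinom_zero]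

theorem altBinom₂_add_left [CharZero K] (h s : K × K) :
    altBinom₂ (h + (1, 0)) s = altBinom₂ h s - altBinom₂ h (s - (1, 0)) := by
  simp only [altBinom₂, Prod.fst_add, Prod.snd_add, Prod.fst_sub, Prod.snd_sub, altBinom_add_one,
    add_zero, sub_zero]
  ring

theorem altBinom₂_add_right [CharZero K] (h s : K × K) :
    altBinom₂ (h + (0, 1)) s = altBinom₂ h s - altBinom₂ h (s - (0, 1)) := by
  simp only [altBinom₂, Prod.fst_add, Prod.snd_add, Prod.fst_sub, Prod.snd_sub, altBinom_add_one,
    add_zero, sub_zero]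
  ring

theorem NatLE.refl (n : K × K) : NatLE n n := ⟨0, by rw [natPair_zero, add_zero]⟩

theorem NatLE.trans {a b c : K × K} (h : NatLE a b) (h' : NatLE b c) : NatLE a c := by
  obtain ⟨k, rfl⟩ := h
  obtain ⟨l, rfl⟩ := h'
  exact ⟨k + l, by rw [natPair_add, add_assoc]⟩

theorem NatLE.antisymm [CharZero K] {a b : K × K} (h : NatLE a b) (h' : NatLE b a) : a = b := by
  obtain ⟨k, rfl⟩ := h
  obtain ⟨l, hl⟩ := h'
  have : natPair (K := K) (k + l) = natPair 0 := by
    rw [natPair_add, natPair_zero]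
    rw [add_assoc] at hl
    exact (left_eq_add.1 hl)
  have hk : k = 0 := by
    have := natPair_injective this
    have h1 := congrArg Prod.fst this
    have h2 := congrArg Prod.snd this
    simp only [Prod.fst_add, Prod.snd_add, Prod.fst_zero, Prod.snd_zero] at h1 h2
    exact Prod.ext (by simp; omega) (by simp; omega)
  rw [hk, natPair_zero, add_zero]

/-- Pairs of integers, as elements of `K × K`. -/
def IsIntPair (x : K × K) : Prop := ∃ d : ℤ × ℤ, x = ((d.1 : K), (d.2 : K))

theorem IsIntPair.add {x y : K × K} (hx : IsIntPair x) (hy : IsIntPair y) : IsIntPair (x + y) := by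
  obtain ⟨d, rfl⟩ := hx
  obtain ⟨d', rfl⟩ := hy
  exact ⟨d + d', by simp⟩

theorem IsIntPair.neg {x : K × K} (hx : IsIntPair x) : IsIntPair (-x) := by
  obtain ⟨d, rfl⟩ := hx
  exact ⟨-d, by simp⟩

theorem IsIntPair.sub {x y : K × K} (hx : IsIntPair x) (hy : IsIntPair y) : IsIntPair (x - y) := by
  rw [sub_eq_add_neg]
  exact hx.add hy.neg

theorem isIntPair_natPair (k : ℕ × ℕ) : IsIntPair (natPair (K := K) k) :=
  ⟨((k.1 : ℤ), (k.2 : ℤ)), by simp [natPair]⟩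

theorem NatLE.isIntPair {x y : K × K} (h : NatLE x y) (hy : IsIntPair y) : IsIntPair x := by
  obtain ⟨k, rfl⟩ := h
  simpa using hy.sub (isIntPair_natPair k)

theorem isIntPair_neg_one : IsIntPair ((-1, -1) : K × K) := ⟨(-1, -1), by simp⟩

theorem exists_natLE {ι : Type*} (s : Finset ι) (m : ι → K × K) (x : K × K)
    (h : ∀ i ∈ s, IsIntPair (m i - x)) : ∃ N : ℕ × ℕ, ∀ i ∈ s, NatLE (m i) (x + natPair N) := by
  choose! d hd using h
  refine ⟨(∑ i ∈ s, (d i).1.natAbs, ∑ i ∈ s, (d i).2.natAbs), fun i hi => ?_⟩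
  have h1 : (d i).1.natAbs ≤ ∑ i ∈ s, (d i).1.natAbs :=
    Finset.single_le_sum (f := fun i => (d i).1.natAbs) (fun _ _ => Nat.zero_le _) hi
  have h2 : (d i).2.natAbs ≤ ∑ i ∈ s, (d i).2.natAbs :=
    Finset.single_le_sum (f := fun i => (d i).2.natAbs) (fun _ _ => Nat.zero_le _) hi
  generalize ∑ i ∈ s, (d i).1.natAbs = a at h1
  generalize ∑ i ∈ s, (d i).2.natAbs = b at h2
  obtain ⟨k, hk⟩ : ∃ k : ℕ, (a : ℤ) = (d i).1 + k := ⟨((a : ℤ) - (d i).1).toNat, by omega⟩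
  obtain ⟨l, hl⟩ : ∃ l : ℕ, (b : ℤ) = (d i).2 + l := ⟨((b : ℤ) - (d i).2).toNat, by omega⟩
  refine ⟨(k, l), ?_⟩
  have hk' : (a : K) = (d i).1 + k := by exact_mod_cast congrArg (Int.cast (R := K)) hk
  have hl' : (b : K) = (d i).2 + l := by exact_mod_cast congrArg (Int.cast (R := K)) hl
  have e : m i = x + (((d i).1 : K), ((d i).2 : K)) := by rw [← hd i hi]; abel
  rw [e]
  ext
  · simp [natPair, hk', add_assoc]
  · simp [natPair, hl', add_assoc]

/-- Functionals on the monomials `z ^ (-n-1) w ^ (-m-1) (z - w) ^ e` that are compatible with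
`z - w = (z - w)` in both components. -/
structure Invariant (ψ : K × K → K × K → K × K → K) : Prop where
  left : ∀ n m e, ψ (n - (1, 0)) m e = ψ n (m - (1, 0)) e + ψ n m (e + (1, 0))
  right : ∀ n m e, ψ (n - (0, 1)) m e = ψ n (m - (0, 1)) e + ψ n m (e + (0, 1))

/-- The coefficients of the expansion of a monomial for `z > w`. -/
noncomputable def expandZ (m₀ : K × K) (_ m e : K × K) : K := altBinom₂ e (m - m₀)

theorem invariant_expandZ [CharZero K] (m₀ : K × K) : Invariant (expandZ m₀) := by
  constructor <;> intro n m e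
  · rw [expandZ, expandZ, expandZ, altBinom₂_add_left, sub_right_comm]
    ring
  · rw [expandZ, expandZ, expandZ, altBinom₂_add_right, sub_right_comm]
    ring

open Classical in
theorem Invariant.ite {ψ : K × K → K × K → K × K → K} (hψ : Invariant ψ)
    (P : K × K → K × K → Prop)
    (hn : ∀ n m x, IsIntPair x → (P (n - x) m ↔ P n m))
    (hm : ∀ n m x, IsIntPair x → (P n (m - x) ↔ P n m)) :
    Invariant fun n m e => if P n m then ψ n m e else 0 := by
  have h1 : IsIntPair ((1, 0) : K × K) := ⟨(1, 0), by simp⟩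
  have h2 : IsIntPair ((0, 1) : K × K) := ⟨(0, 1), by simp⟩
  constructor <;> intro n m e
  · rw [hn _ _ _ h1, hm _ _ _ h1, hψ.left]
    split_ifs <;> simp
  · rw [hn _ _ _ h2, hm _ _ _ h2, hψ.right]
    split_ifs <;> simp

/-- The functions `g ↦ altBinom₂ g l` for `l` in `ℕ × ℕ` separate points. -/
theorem eq_zero_of_sum_altBinom₂ [CharZero K] (v : K × K →₀ V)
    (h : ∀ l : ℕ × ℕ, (v.sum fun g x => altBinom₂ g (natPair l) • x) = 0) : v = 0 := by
  classical
  have hl : ∀ (f : K × K → K) (r : K),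
      (∀ l : ℕ × ℕ, (v.sum fun g x => (f g * altBinom₂ g (natPair l)) • x) = 0) →
      ∀ l : ℕ × ℕ, (v.sum fun g x => ((g.1 - r) * f g * altBinom₂ g (natPair l)) • x) = 0 := by
    intro f r hf l
    have e : ∀ g : K × K, (g.1 - r) * f g * altBinom₂ g (natPair l) =
        (l.1 - r) * (f g * altBinom₂ g (natPair l)) -
          (l.1 + 1) * (f g * altBinom₂ g (natPair (l + (1, 0)))) := by
      intro g
      have := altBinom_succ_mul g.1 (l.1 : K)
      simp only [altBinom₂, natPair, Prod.fst_add, Prod.snd_add, Nat.cast_add, Nat.cast_one,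
        add_zero]
      linear_combination (f g * altBinom g.2 (l.2 : K)) * this
    have key : (v.sum fun g x => ((g.1 - r) * f g * altBinom₂ g (natPair l)) • x) =
        ((l.1 : K) - r) • (v.sum fun g x => (f g * altBinom₂ g (natPair l)) • x) -
        ((l.1 : K) + 1) • (v.sum fun g x => (f g * altBinom₂ g (natPair (l + (1, 0)))) • x) := by
      simp only [Finsupp.sum, Finset.smul_sum, ← Finset.sum_sub_distrib, smul_smul, ← sub_smul, e]
    rw [key, hf, hf, smul_zero, smul_zero, sub_zero]
  have hr : ∀ (f : K × K → K) (r : K),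
      (∀ l : ℕ × ℕ, (v.sum fun g x => (f g * altBinom₂ g (natPair l)) • x) = 0) →
      ∀ l : ℕ × ℕ, (v.sum fun g x => ((g.2 - r) * f g * altBinom₂ g (natPair l)) • x) = 0 := by
    intro f r hf l
    have e : ∀ g : K × K, (g.2 - r) * f g * altBinom₂ g (natPair l) =
        (l.2 - r) * (f g * altBinom₂ g (natPair l)) -
          (l.2 + 1) * (f g * altBinom₂ g (natPair (l + (0, 1)))) := by
      intro g
      have := altBinom_succ_mul g.2 (l.2 : K)
      simp only [altBinom₂, natPair, Prod.fst_add, Prod.snd_add, Nat.cast_add, Nat.cast_one,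
        add_zero]
      linear_combination (f g * altBinom g.1 (l.1 : K)) * this
    have key : (v.sum fun g x => ((g.2 - r) * f g * altBinom₂ g (natPair l)) • x) =
        ((l.2 : K) - r) • (v.sum fun g x => (f g * altBinom₂ g (natPair l)) • x) -
        ((l.2 : K) + 1) • (v.sum fun g x => (f g * altBinom₂ g (natPair (l + (0, 1)))) • x) := by
      simp only [Finsupp.sum, Finset.smul_sum, ← Finset.sum_sub_distrib, smul_smul, ← sub_smul, e]
    rw [key, hf, hf, smul_zero, smul_zero, sub_zero]
  have hprod : ∀ S S' : Finset K, ∀ l : ℕ × ℕ, (v.sum fun g x =>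
      (((∏ r ∈ S, (g.1 - r)) * ∏ r ∈ S', (g.2 - r)) * altBinom₂ g (natPair l)) • x) = 0 := by
    intro S S'
    induction S using Finset.induction_on with
    | empty =>
      induction S' using Finset.induction_on with
      | empty => simpa using h
      | insert r S' hrS ih =>
        have := hr _ r ih
        simpa [Finset.prod_insert hrS] using this
    | insert r S hrS ih =>
      have := hl _ r ih
      simpa [Finset.prod_insert hrS, mul_assoc] using this
  ext g₀
  by_contra hne
  have hg₀ : g₀ ∈ v.support := by simpa using hne
  have key := hprod ((v.support.image Prod.fst).erase g₀.1)
    ((v.support.image Prod.snd).erase g₀.2) 0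
  rw [Finsupp.sum, Finset.sum_eq_single_of_mem g₀ hg₀, natPair_zero, altBinom₂_zero, mul_one,
    smul_eq_zero] at key
  · rcases key with key | key
    · rcases mul_eq_zero.1 key with key | key
      · obtain ⟨r, hr, h0⟩ := Finset.prod_eq_zero_iff.1 key
        exact (Finset.mem_erase.1 hr).1 (sub_eq_zero.1 h0).symm
      · obtain ⟨r, hr, h0⟩ := Finset.prod_eq_zero_iff.1 key
        exact (Finset.mem_erase.1 hr).1 (sub_eq_zero.1 h0).symm
    · exact hne key
  · intro g hg hgne
    have : (∏ r ∈ (v.support.image Prod.fst).erase g₀.1, (g.1 - r)) *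
        ∏ r ∈ (v.support.image Prod.snd).erase g₀.2, (g.2 - r) = 0 := by
      by_cases h1 : g.1 = g₀.1
      · have h2 : g.2 ≠ g₀.2 := fun h2 => hgne (Prod.ext h1 h2)
        rw [Finset.prod_eq_zero (Finset.mem_erase.2 ⟨h2, Finset.mem_image_of_mem _ hg⟩)
          (sub_self _), mul_zero]
      · rw [Finset.prod_eq_zero (Finset.mem_erase.2 ⟨h1, Finset.mem_image_of_mem _ hg⟩)
          (sub_self _), zero_mul]
    rw [this, zero_mul, zero_smul]

/-- A linear functional on invariants which is a linear combination of evaluations at the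
monomials of the family `t`. -/
def HasForm (t : K × K → (K × K) × (K × K) × (K × K))
    (Φ : (K × K → K × K → K × K → K) → V) : Prop :=
  ∃ v : K × K →₀ V, ∀ ψ, Invariant ψ →
    Φ ψ = v.sum fun g x => ψ (t g).1 (t g).2.1 (t g).2.2 • x

theorem HasForm.add {t : K × K → (K × K) × (K × K) × (K × K)}
    {Φ Φ' : (K × K → K × K → K × K → K) → V}
    (h : HasForm t Φ)
    (h' : HasForm t Φ') : HasForm t fun ψ => Φ ψ + Φ' ψ := by
  classical
  obtain ⟨v, hv⟩ := h
  obtain ⟨v', hv'⟩ := h'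
  refine ⟨v + v', fun ψ hψ => ?_⟩
  simp only
  rw [hv ψ hψ, hv' ψ hψ, Finsupp.sum_add_index'] <;> simp

theorem HasForm.neg {t : K × K → (K × K) × (K × K) × (K × K)}
    {Φ : (K × K → K × K → K × K → K) → V}
    (h : HasForm t Φ) :
    HasForm t fun ψ => - Φ ψ := by
  classical
  obtain ⟨v, hv⟩ := h
  refine ⟨-v, fun ψ hψ => ?_⟩
  simp only
  rw [hv ψ hψ, Finsupp.sum_neg_index (by simp), Finsupp.sum, Finsupp.sum, ← Finset.sum_neg_distrib]
  simp

theorem HasForm.congr {t : K × K → (K × K) × (K × K) × (K × K)}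
    {Φ Φ' : (K × K → K × K → K × K → K) → V}
    (h : HasForm t Φ)
    (e : ∀ ψ, Invariant ψ → Φ' ψ = Φ ψ) : HasForm t Φ' := by
  obtain ⟨v, hv⟩ := h
  exact ⟨v, fun ψ hψ => (e ψ hψ).trans (hv ψ hψ)⟩

theorem HasForm.sum {ι : Type*} {t : K × K → (K × K) × (K × K) × (K × K)} (s : Finset ι)
    (Φ : ι → (K × K → K × K → K × K → K) → V) (h : ∀ i ∈ s, HasForm t (Φ i)) :
    HasForm t fun ψ => ∑ i ∈ s, Φ i ψ := by
  classical
  induction s using Finset.induction_on with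
  | empty => exact ⟨0, by simp⟩
  | insert i s hi ih =>
    simp only [Finset.sum_insert hi]
    exact (h i (Finset.mem_insert_self _ _)).add
      (ih fun j hj => h j (Finset.mem_insert_of_mem hj))

theorem hasForm_monomial_z {D M : K × K} (k : ℕ × ℕ) (n m e : K × K) (hk : M = m + natPair k)
    (hD : n + m = D + e) (x : V) : HasForm (fun g => (D + g - M, M, g)) fun ψ => ψ n m e • x := by
  obtain ⟨k, l⟩ := k
  have hz : ∀ {n m e : K × K}, M = m + natPair (0, 0) → n + m = D + e →
      HasForm (fun g => (D + g - M, M, g)) fun ψ => ψ n m e • x := by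
    intro n m e hM hD
    have hM' : M = m := by
      have : natPair (K := K) (0, 0) = 0 := natPair_zero
      rw [hM, this, add_zero]
    refine ⟨Finsupp.single e x, fun ψ _ => ?_⟩
    dsimp only
    rw [Finsupp.sum_single_index (by exact smul_zero _), ← hD, hM', add_sub_cancel_right]
  induction k generalizing n m e with
  | zero =>
    induction l generalizing n m e with
    | zero => exact hz hk hD
    | succ l ih =>
      have hm : M = m + (0, 1) + natPair (0, l) := by
        rw [hk]; ext <;> simp [natPair]; ring
      have h1 := ih (n - (0, 1)) (m + (0, 1)) e (by rw [← hD]; abel) hm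
      have h2 := ih n (m + (0, 1)) (e + (0, 1)) (by rw [← add_assoc, hD, add_assoc]) hm
      refine (h1.add h2.neg).congr fun ψ hψ => ?_
      rw [hψ.right, add_sub_cancel_right, add_smul]
      abel
  | succ k ih =>
    have hm : M = m + (1, 0) + natPair (k, l) := by
      rw [hk]; ext <;> simp [natPair]; ring
    have h1 := ih (n - (1, 0)) (m + (1, 0)) e (by rw [← hD]; abel) hm
    have h2 := ih n (m + (1, 0)) (e + (1, 0)) (by rw [← add_assoc, hD, add_assoc]) hm
    refine (h1.add h2.neg).congr fun ψ hψ => ?_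
    rw [hψ.left, add_sub_cancel_right, add_smul]
    abel

/-- If the expansion for `z > w` of a linear combination of monomials vanishes then so does every
invariant functional. -/
theorem sum_eq_zero_of_expandZ [CharZero K] {ι : Type*} (s : Finset ι) (n m e : ι → K × K)
    (v : ι → V) (D : K × K) (hD : ∀ i ∈ s, n i + m i = D + e i)
    (h : ∀ m₀, ∑ i ∈ s, expandZ m₀ (n i) (m i) (e i) • v i = 0)
    {ψ : K × K → K × K → K × K → K} (hψ : Invariant ψ) :
    ∑ i ∈ s, ψ (n i) (m i) (e i) • v i = 0 := by
  classical
  let c : ι → Set (K × K) := fun i => {x | IsIntPair (m i - x)}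
  rw [← Finset.sum_fiberwise_of_maps_to (t := s.image c) (g := c)
    (fun i hi => Finset.mem_image_of_mem _ hi)]
  refine Finset.sum_eq_zero fun C hC => ?_
  obtain ⟨i₀, hi₀, rfl⟩ := Finset.mem_image.1 hC
  have hself : ∀ i, m i ∈ c i := fun i => ⟨0, by simp; rfl⟩
  have hmem : ∀ i ∈ s.filter (fun i => c i = c i₀), IsIntPair (m i - m i₀) := by
    intro i hi
    have := hself i₀
    rw [← (Finset.mem_filter.1 hi).2] at this
    exact this
  obtain ⟨N, hN⟩ := exists_natLE _ m (m i₀) hmem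
  set M := m i₀ + natPair N with hM
  obtain ⟨w, hw⟩ := HasForm.sum (t := fun g => (D + g - M, M, g)) (s.filter fun i => c i = c i₀)
    (fun i ψ => ψ (n i) (m i) (e i) • v i) (fun i hi => by
      obtain ⟨k, hk⟩ := hN i hi
      exact hasForm_monomial_z k _ _ _ hk (hD i (Finset.mem_filter.1 hi).1) _)
  suffices w = 0 from (hw ψ hψ).trans (by rw [this, Finsupp.sum_zero_index])
  refine eq_zero_of_sum_altBinom₂ w fun l => ?_
  have h1 := hw _ (invariant_expandZ (M - natPair l))
  simp only [expandZ, sub_sub_cancel] at h1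
  rw [← h1, ← h (M - natPair l)]
  refine Finset.sum_subset (Finset.filter_subset _ _) fun i hi hni => ?_
  have : altBinom₂ (e i) (m i - (M - natPair l)) = 0 := by
    by_contra hne
    obtain ⟨k, hk⟩ := exists_of_altBinom₂_ne_zero hne
    apply hni
    refine Finset.mem_filter.2 ⟨hi, ?_⟩
    have hint : IsIntPair (m i - m i₀) := by
      have : m i - m i₀ = natPair k + natPair N - natPair l := by
        rw [← hk, hM]; abel
      rw [this]
      exact ((isIntPair_natPair k).add (isIntPair_natPair N)).sub (isIntPair_natPair l)
    ext x
    constructor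
    · intro hx
      have h3 : m i - x - (m i - m i₀) = m i₀ - x := by abel
      have h4 := IsIntPair.sub (show IsIntPair (m i - x) from hx) hint
      rw [h3] at h4
      exact h4
    · intro hx
      have h3 : m i₀ - x + (m i - m i₀) = m i - x := by abel
      have h4 := IsIntPair.add (show IsIntPair (m i₀ - x) from hx) hint
      rw [h3] at h4
      exact h4
  rw [this, zero_smul]

end Invariants

end OPEAlg

namespace OPEAlg

section Expansions

variable {K : Type u} {V : Type v} [Field K] [AddCommGroup V] [Module K V]

open Classical in
/-- The sign `(-1) ^ (e.1 - e.2)`, extended by zero to pairs whose difference is not an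
integer. -/
noncomputable def intSign (e : K × K) : K := if IsStatistical e then statSign e else 0

theorem intSign_of_isStatistical {e : K × K} (h : IsStatistical e) : intSign e = statSign e :=
  if_pos h

theorem intSign_eq [CharZero K] {e : K × K} {d : ℤ} (h : e.1 - e.2 = d) :
    intSign e = (-1) ^ d := by
  rw [intSign_of_isStatistical ⟨d, h⟩, statSign]
  rcases Int.even_or_odd d with hd | hd
  · rw [hd.neg_one_zpow, if_pos]
    obtain ⟨c, rfl⟩ := hd
    exact ⟨c, by rw [h]; push_cast; ring⟩
  · rw [hd.neg_one_zpow, if_neg]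
    rintro ⟨c, hc⟩
    rw [h] at hc
    have : d = 2 * c := by exact_mod_cast hc
    exact (Int.not_even_iff_odd.2 hd) ⟨c, by rw [this]; ring⟩

theorem IsStatistical.neg {e : K × K} (h : IsStatistical e) : IsStatistical (-e) := by
  obtain ⟨d, hd⟩ := h
  exact ⟨-d, by simp only [Prod.fst_neg, Prod.snd_neg]; push_cast; rw [← hd]; ring⟩

theorem IsStatistical.add {e e' : K × K} (h : IsStatistical e) (h' : IsStatistical e') :
    IsStatistical (e + e') := by
  obtain ⟨d, hd⟩ := h
  obtain ⟨d', hd'⟩ := h'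
  exact ⟨d + d', by simp only [Prod.fst_add, Prod.snd_add]; push_cast; rw [← hd, ← hd']; ring⟩

theorem isStatistical_natPair (k : ℕ × ℕ) : IsStatistical (natPair (K := K) k) :=
  ⟨k.1 - k.2, by simp [natPair]⟩

theorem intSign_add [CharZero K] {e e' : K × K} (h : IsStatistical e) (h' : IsStatistical e') :
    intSign (e + e') = intSign e * intSign e' := by
  obtain ⟨d, hd⟩ := h
  obtain ⟨d', hd'⟩ := h'
  rw [intSign_eq hd, intSign_eq hd', intSign_eq (d := d + d'), zpow_add₀ (by simp)]
  simp only [Prod.fst_add, Prod.snd_add]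
  push_cast
  rw [← hd, ← hd']
  ring

theorem intSign_natPair [CharZero K] (k : ℕ × ℕ) :
    intSign (natPair (K := K) k) = (-1) ^ (k.1 + k.2) := by
  rw [intSign_eq (d := (k.1 - k.2 : ℤ)) (by simp [natPair]), zpow_sub₀ (by simp), pow_add,
    zpow_natCast, zpow_natCast]
  rcases Nat.even_or_odd k.2 with h | h <;> simp [h.neg_one_pow, div_neg]

theorem intSign_mul_self [CharZero K] {e : K × K} (h : IsStatistical e) :
    intSign e * intSign e = 1 := by
  obtain ⟨d, hd⟩ := h
  rw [intSign_eq hd]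
  rcases Int.even_or_odd d with h | h <;> simp [h.neg_one_zpow]

theorem intSign_add_natPair [CharZero K] (e : K × K) (k : ℕ × ℕ) :
    intSign (e + natPair k) = intSign e * (-1) ^ (k.1 + k.2) := by
  by_cases h : IsStatistical e
  · rw [intSign_add h (isStatistical_natPair k), intSign_natPair]
  · have h' : ¬ IsStatistical (e + natPair k) := fun h' => h (by
      have := h'.add (isStatistical_natPair k).neg
      rwa [add_neg_cancel_right] at this)
    rw [intSign, intSign, if_neg h, if_neg h', zero_mul]

theorem intSign_add_left [CharZero K] (e : K × K) : intSign (e + (1, 0)) = -intSign e := by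
  simpa [natPair] using intSign_add_natPair e (1, 0)

theorem intSign_add_right [CharZero K] (e : K × K) : intSign (e + (0, 1)) = -intSign e := by
  simpa [natPair] using intSign_add_natPair e (0, 1)

/-- The coefficients of the expansion of a monomial for `w > z`. -/
noncomputable def expandW (n₀ : K × K) (n _ e : K × K) : K := intSign e * altBinom₂ e (n - n₀)

theorem Invariant.swap [CharZero K] {ψ : K × K → K × K → K × K → K} (hψ : Invariant ψ) :
    Invariant fun n m e => intSign e * ψ m n e := by
  constructor <;> intro n m e
  · rw [hψ.left, intSign_add_left]
    ring
  · rw [hψ.right, intSign_add_right]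
    ring

theorem invariant_expandW [CharZero K] (n₀ : K × K) : Invariant (expandW n₀) :=
  (invariant_expandZ n₀).swap

/-- The coefficients of the Taylor expansion of a monomial in powers of `z - w`, at
`(z - w) ^ (-N)`. -/
noncomputable def taylorFun (N : K × K) (n _ e : K × K) : K := altBinom₂ (n - e - N) (-e - N)

theorem invariant_taylorFun [CharZero K] (N : K × K) : Invariant (taylorFun N) := by
  constructor <;> intro n m e
  · have h := altBinom₂_add_left (n - (1, 0) - e - N) (-e - N)
    have e1 : n - (1, 0) - e - N + (1, 0) = n - e - N := by abel
    have e2 : n - (e + (1, 0)) - N = n - (1, 0) - e - N := by abel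
    have e3 : -(e + (1, 0)) - N = -e - N - (1, 0) := by abel
    rw [e1] at h
    rw [taylorFun, taylorFun, taylorFun, e2, e3, h]
    ring
  · have h := altBinom₂_add_right (n - (0, 1) - e - N) (-e - N)
    have e1 : n - (0, 1) - e - N + (0, 1) = n - e - N := by abel
    have e2 : n - (e + (0, 1)) - N = n - (0, 1) - e - N := by abel
    have e3 : -(e + (0, 1)) - N = -e - N - (0, 1) := by abel
    rw [e1] at h
    rw [taylorFun, taylorFun, taylorFun, e2, e3, h]
    ring

/-- If the expansion for `w > z` of a linear combination of monomials vanishes then so does every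
invariant functional. -/
theorem sum_eq_zero_of_expandW [CharZero K] {ι : Type*} (s : Finset ι) (n m e : ι → K × K)
    (v : ι → V) (D : K × K) (hD : ∀ i ∈ s, n i + m i = D + e i)
    (he : ∀ i ∈ s, IsStatistical (e i))
    (h : ∀ n₀, ∑ i ∈ s, expandW n₀ (n i) (m i) (e i) • v i = 0)
    {ψ : K × K → K × K → K × K → K} (hψ : Invariant ψ) :
    ∑ i ∈ s, ψ (n i) (m i) (e i) • v i = 0 := by
  have key := sum_eq_zero_of_expandZ s m n e (fun i => intSign (e i) • v i) D
    (fun i hi => by rw [add_comm, hD i hi]) (fun m₀ => by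
      rw [← h m₀]
      refine Finset.sum_congr rfl fun i _ => ?_
      rw [smul_smul, expandZ, expandW, mul_comm]) hψ.swap
  rw [← key]
  refine Finset.sum_congr rfl fun i hi => ?_
  rw [smul_smul, mul_right_comm, intSign_mul_self (he i hi), one_mul]

theorem hasForm_monomial_exp {D e₀ : K × K} (k : ℕ × ℕ) (n m e : K × K) (hk : e = e₀ + natPair k)
    (hD : n + m = D + e) (x : V) :
    HasForm (fun g => (g, D + e₀ - g, e₀)) fun ψ => ψ n m e • x := by
  obtain ⟨k, l⟩ := k
  have hz : ∀ {n m e : K × K}, e = e₀ + natPair (0, 0) → n + m = D + e →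
      HasForm (fun g => (g, D + e₀ - g, e₀)) fun ψ => ψ n m e • x := by
    intro n m e he hD
    have he' : e = e₀ := by
      have : natPair (K := K) (0, 0) = 0 := natPair_zero
      rw [he, this, add_zero]
    refine ⟨Finsupp.single n x, fun ψ _ => ?_⟩
    dsimp only
    rw [Finsupp.sum_single_index (by exact smul_zero _), ← he', ← hD, add_sub_cancel_left]
  induction k generalizing n m e with
  | zero =>
    induction l generalizing n m e with
    | zero => exact hz hk hD
    | succ l ih =>
      have hm : e - (0, 1) = e₀ + natPair (0, l) := by
        rw [hk]; ext <;> simp [natPair]; ring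
      have h1 := ih (n - (0, 1)) m (e - (0, 1)) (by rw [sub_add_eq_add_sub, hD, add_sub_assoc]) hm
      have h2 := ih n (m - (0, 1)) (e - (0, 1)) (by rw [← add_sub_assoc, hD, add_sub_assoc]) hm
      refine (h1.add h2.neg).congr fun ψ hψ => ?_
      rw [hψ.right, sub_add_cancel, add_smul]
      abel
  | succ k ih =>
    have hm : e - (1, 0) = e₀ + natPair (k, l) := by
      rw [hk]; ext <;> simp [natPair]; ring
    have h1 := ih (n - (1, 0)) m (e - (1, 0)) (by rw [sub_add_eq_add_sub, hD, add_sub_assoc]) hm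
    have h2 := ih n (m - (1, 0)) (e - (1, 0)) (by rw [← add_sub_assoc, hD, add_sub_assoc]) hm
    refine (h1.add h2.neg).congr fun ψ hψ => ?_
    rw [hψ.left, sub_add_cancel, add_smul]
    abel

/-- A triangular system: if the sums of the coefficients `altBinom₂ e (g - g₀)` against `v` vanish
for all `g₀` which are not `≤ -1` then `v` is supported on indices `≤ -1`. -/
theorem natLE_neg_one_of_sum_altBinom₂ [CharZero K] {ι : Type*} (v : ι →₀ V) (e : K × K)
    (f : ι → K × K) (hf : Function.Injective f)
    (h : ∀ g₀, ¬ NatLE g₀ (-1, -1) → (v.sum fun i x => altBinom₂ e (f i - g₀) • x) = 0) :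
    ∀ i ∈ v.support, NatLE (f i) (-1, -1) := by
  classical
  by_contra hcon
  push Not at hcon
  obtain ⟨i₁, hi₁, hbad⟩ := hcon
  let _ : Preorder (K × K) :=
    { le := NatLE
      le_refl := NatLE.refl
      le_trans := fun _ _ _ => NatLE.trans }
  obtain ⟨i, hi, hmax⟩ := Finset.exists_maximalFor f
    (v.support.filter fun i => ¬ NatLE (f i) (-1, -1)) ⟨i₁, Finset.mem_filter.2 ⟨hi₁, hbad⟩⟩
  obtain ⟨hi, hibad⟩ := Finset.mem_filter.1 hi
  have key := h (f i) hibad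
  rw [Finsupp.sum, Finset.sum_eq_single_of_mem i hi, sub_self, altBinom₂_zero, one_smul] at key
  · exact (Finsupp.mem_support_iff.1 hi) key
  · intro j hj hji
    have h0 : altBinom₂ e (f j - f i) = 0 := by
      by_contra hne
      obtain ⟨k, hk⟩ := exists_of_altBinom₂_ne_zero hne
      have hle : NatLE (f i) (f j) := ⟨k, by rw [← hk]; abel⟩
      have hjbad : ¬ NatLE (f j) (-1, -1) := fun hc => hibad (hle.trans hc)
      exact hji (hf (NatLE.antisymm (hmax (Finset.mem_filter.2 ⟨hj, hjbad⟩) hle) hle))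
    rw [h0, zero_smul]

theorem exists_normalForm [CharZero K] {ι : Type*} (s : Finset ι) (n m e : ι → K × K)
    (v : ι → V) (D : K × K) (hD : ∀ i ∈ s, n i + m i = D + e i)
    (he : ∀ i ∈ s, IsStatistical (e i))
    (hz : ∀ m₀, ¬ NatLE m₀ (-1, -1) → ∑ i ∈ s, expandZ m₀ (n i) (m i) (e i) • v i = 0)
    (hw : ∀ n₀, ¬ NatLE n₀ (-1, -1) → ∑ i ∈ s, expandW n₀ (n i) (m i) (e i) • v i = 0) :
    ∃ (e₀ : K × K) (w : K × K →₀ V),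
      (∀ g ∈ w.support, NatLE g (-1, -1) ∧ NatLE (D + e₀ - g) (-1, -1)) ∧
      ∀ ψ, Invariant ψ →
        ∑ i ∈ s, ψ (n i) (m i) (e i) • v i = w.sum fun g x => ψ g (D + e₀ - g) e₀ • x := by
  classical
  have shift : ∀ y x : K × K, IsIntPair x → (IsIntPair (y - x) ↔ IsIntPair y) := fun y x hx =>
    ⟨fun h => by simpa using h.add hx, fun h => h.sub hx⟩
  have hm : ∀ ψ, Invariant ψ →
      ∑ i ∈ s, ψ (n i) (m i) (e i) • (if IsIntPair (m i) then 0 else v i) = 0 := by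
    intro ψ hψ
    refine sum_eq_zero_of_expandZ s n m e _ D hD (fun m₀ => ?_) hψ
    by_cases h : IsIntPair m₀
    · refine Finset.sum_eq_zero fun i _ => ?_
      split_ifs with hi
      · rw [smul_zero]
      · rw [expandZ, not_not.1 (mt exists_of_altBinom₂_ne_zero fun ⟨k, hk⟩ => hi (by
          rw [← sub_add_cancel (m i) m₀, hk]
          exact (isIntPair_natPair k).add h)), zero_smul]
    · rw [← hz m₀ fun h' => h (h'.isIntPair isIntPair_neg_one)]
      refine Finset.sum_congr rfl fun i _ => ?_
      split_ifs with hi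
      · rw [expandZ, not_not.1 (mt exists_of_altBinom₂_ne_zero fun ⟨k, hk⟩ => h (by
          rw [← sub_sub_cancel (m i) m₀, hk]
          exact hi.sub (isIntPair_natPair k))), zero_smul,
          zero_smul]
      · rfl
  have hn : ∀ ψ, Invariant ψ →
      ∑ i ∈ s, ψ (n i) (m i) (e i) • (if IsIntPair (n i) then 0 else v i) = 0 := by
    intro ψ hψ
    refine sum_eq_zero_of_expandW s n m e _ D hD he (fun n₀ => ?_) hψ
    by_cases h : IsIntPair n₀
    · refine Finset.sum_eq_zero fun i _ => ?_
      split_ifs with hi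
      · rw [smul_zero]
      · rw [expandW, not_not.1 (mt exists_of_altBinom₂_ne_zero fun ⟨k, hk⟩ => hi (by
          rw [← sub_add_cancel (n i) n₀, hk]
          exact (isIntPair_natPair k).add h)), mul_zero,
          zero_smul]
    · rw [← hw n₀ fun h' => h (h'.isIntPair isIntPair_neg_one)]
      refine Finset.sum_congr rfl fun i _ => ?_
      split_ifs with hi
      · rw [expandW, not_not.1 (mt exists_of_altBinom₂_ne_zero fun ⟨k, hk⟩ => h (by
          rw [← sub_sub_cancel (n i) n₀, hk]
          exact hi.sub (isIntPair_natPair k))), mul_zero,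
          zero_smul, zero_smul]
      · rfl
  set s' := s.filter fun i => IsIntPair (n i) ∧ IsIntPair (m i) with hs'
  have hsum : ∀ ψ, Invariant ψ →
      ∑ i ∈ s, ψ (n i) (m i) (e i) • v i = ∑ i ∈ s', ψ (n i) (m i) (e i) • v i := by
    intro ψ hψ
    have h1 := hm ψ hψ
    have h2 := hn _ (hψ.ite (fun _ y => IsIntPair y) (fun _ _ _ _ => Iff.rfl)
      fun _ y x hx => shift y x hx)
    have h3 := congrArg₂ (· + ·) h1 h2
    simp only [← Finset.sum_add_distrib, add_zero] at h3
    refine sub_eq_zero.1 (Eq.trans ?_ h3)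
    rw [hs', Finset.sum_filter, ← Finset.sum_sub_distrib]
    refine Finset.sum_congr rfl fun i _ => ?_
    by_cases ha : IsIntPair (n i) <;> by_cases hb : IsIntPair (m i) <;> simp [ha, hb]
  have hs'm : ∀ i ∈ s', i ∈ s ∧ IsIntPair (n i) ∧ IsIntPair (m i) := fun i hi =>
    Finset.mem_filter.1 hi
  obtain ⟨e₀, he₀, hk⟩ : ∃ e₀ : K × K, (∀ i ∈ s', IsStatistical e₀) ∧
      ∀ i ∈ s', ∃ k : ℕ × ℕ, e i = e₀ + natPair k := by
    obtain ⟨N, hN⟩ := exists_natLE s' (fun i => -(e i)) D fun i hi => by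
      obtain ⟨h1, h2, h3⟩ := hs'm i hi
      have : -(e i) - D = -(n i + m i) := by rw [hD i h1]; abel
      rw [this]
      exact (h2.add h3).neg
    have hk : ∀ i ∈ s', ∃ k : ℕ × ℕ, e i = -(D + natPair N) + natPair k := fun i hi => by
      obtain ⟨k, hk⟩ := hN i hi
      exact ⟨k, by rw [hk]; abel⟩
    refine ⟨-(D + natPair N), fun i hi => ?_, hk⟩
    obtain ⟨k, hk⟩ := hk i hi
    have := (he i (hs'm i hi).1).add (isStatistical_natPair k).neg
    rwa [hk, add_neg_cancel_right] at this
  rcases s'.eq_empty_or_nonempty with hemp | ⟨i₀, hi₀⟩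
  · exact ⟨0, 0, by simp, fun ψ hψ => by rw [hsum ψ hψ, hemp]; simp⟩
  have hstat := he₀ i₀ hi₀
  obtain ⟨w, hw'⟩ := HasForm.sum (t := fun g => (g, D + e₀ - g, e₀)) s'
    (fun i ψ => ψ (n i) (m i) (e i) • v i) (fun i hi => by
      obtain ⟨k, hk⟩ := hk i hi
      exact hasForm_monomial_exp k _ _ _ hk (hD i (hs'm i hi).1) _)
  have hform : ∀ ψ, Invariant ψ →
      ∑ i ∈ s, ψ (n i) (m i) (e i) • v i = w.sum fun g x => ψ g (D + e₀ - g) e₀ • x :=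
    fun ψ hψ => (hsum ψ hψ).trans (hw' ψ hψ)
  have hleft := natLE_neg_one_of_sum_altBinom₂ w e₀ id Function.injective_id fun g₀ hg₀ => by
    have h1 := hform _ (invariant_expandW g₀)
    rw [hw g₀ hg₀] at h1
    simp only [expandW, mul_smul] at h1
    rw [← Finsupp.smul_sum] at h1
    have h2 := congrArg (intSign e₀ • ·) h1.symm
    rwa [smul_zero, smul_smul, intSign_mul_self hstat, one_smul] at h2
  have hright := natLE_neg_one_of_sum_altBinom₂ w e₀ (fun g => D + e₀ - g)
    (fun a b hab => sub_right_injective hab) fun g₀ hg₀ => by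
    have h1 := hform _ (invariant_expandZ g₀)
    rw [hz g₀ hg₀] at h1
    exact h1.symm
  exact ⟨e₀, w, fun g hg => ⟨hleft g hg, hright g hg⟩, hform⟩

end Expansions

end OPEAlg

namespace OPEAlg

section Evaluation

variable {K : Type u} {V : Type v} {W : Type w} [Field K] [AddCommGroup V] [Module K V]
  [AddCommGroup W] [Module K W]

theorem finsum_comp_injective {α β : Type*} {φ : α → β} (hφ : Function.Injective φ) (f : β → V)
    (h : Function.support f ⊆ Set.range φ) : ∑ᶠ a, f (φ a) = ∑ᶠ b, f b := by
  rw [← finsum_mem_range hφ, ← finsum_mem_support f, ← finsum_mem_inter_support,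
    Set.inter_eq_right.2 h]

/-- A series in two variables is degreewise finite if it has finitely many coefficients in each
total degree. -/
def DegFinite (f : K × K → K × K → V) : Prop :=
  ∀ d, {t : (K × K) × (K × K) | t.1 + t.2 = d ∧ f t.1 t.2 ≠ 0}.Finite

theorem finite_setOf_natLE [CharZero K] (x y : K × K) : {n | NatLE x n ∧ NatLE n y}.Finite := by
  by_cases h : ∃ N : ℕ × ℕ, y = x + natPair N
  · obtain ⟨N, rfl⟩ := h
    refine ((Set.finite_Iic N).image fun k => x + natPair k).subset ?_
    rintro n ⟨⟨k, rfl⟩, ⟨l, hl⟩⟩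
    refine ⟨k, ?_, rfl⟩
    rw [add_assoc, ← natPair_add] at hl
    have := natPair_injective (add_left_cancel hl)
    rw [this]
    exact ⟨by simp, by simp⟩
  · refine Set.finite_empty.subset ?_
    rintro n ⟨⟨k, rfl⟩, ⟨l, hl⟩⟩
    exact h ⟨k + l, by rw [hl, natPair_add, add_assoc]⟩

theorem IsField₂.degFinite [CharZero K] {c : Distr₂ K V} (hc : IsField₂ c) (x : V) :
    DegFinite fun n m => c n m x := by
  intro d
  obtain ⟨S, hS⟩ := hc x
  refine (S.finite_toSet.biUnion fun h _ =>
    (finite_setOf_natLE (d - h.2) h.1).image fun n => (n, d - n)).subset ?_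
  rintro ⟨n, m⟩ ⟨rfl, hne⟩
  obtain ⟨h, hh, h1, ⟨k, hk⟩⟩ := hS n m hne
  simp only [Set.mem_iUnion, Set.mem_image]
  refine ⟨h, hh, n, ⟨⟨k, ?_⟩, h1⟩, ?_⟩
  · rw [hk]; abel
  · simp

theorem DegFinite.map {f : K × K → K × K → V} (hf : DegFinite f) (G : V →ₗ[K] W) :
    DegFinite fun n m => G (f n m) := fun d => (hf d).subset fun t ht =>
  ⟨ht.1, fun h => ht.2 (by simp only [h, map_zero])⟩

omit [Module K V] in
theorem DegFinite.add {f g : K × K → K × K → V} (hf : DegFinite f) (hg : DegFinite g) :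
    DegFinite fun n m => f n m + g n m := fun d => ((hf d).union (hg d)).subset fun t ht => by
  by_contra hc
  simp only [Set.mem_union, Set.mem_ofPred_eq, not_or, not_and, not_not] at hc
  exact ht.2 (by simp only [hc.1 ht.1, hc.2 ht.1, add_zero])

omit [Module K V] in
theorem DegFinite.sum {ι : Type*} (s : Finset ι) {f : ι → K × K → K × K → V}
    (hf : ∀ i ∈ s, DegFinite (f i)) : DegFinite fun n m => ∑ i ∈ s, f i n m := by
  classical
  induction s using Finset.induction_on with
  | empty => intro d; simp
  | insert i s hi ih =>
    simp only [Finset.sum_insert hi]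
    exact (hf i (Finset.mem_insert_self _ _)).add
      (ih fun j hj => hf j (Finset.mem_insert_of_mem hj))

theorem DegFinite.shift {f : K × K → K × K → V} (hf : DegFinite f) (a b : K × K)
    (r : K × K → K × K → K) : DegFinite fun n m => r n m • f (n - a) (m - b) := fun d =>
  ((hf (d - a - b)).image fun t => (t.1 + a, t.2 + b)).subset fun t ht =>
    ⟨(t.1 - a, t.2 - b), ⟨by rw [← ht.1]; dsimp only; abel,
      fun h => ht.2 (by simp only at h ⊢; rw [h, smul_zero])⟩, by simp⟩

open Classical in
/-- The value of an invariant functional on the part of total degree `D` of the product of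
`(z - w) ^ e` and a series in two variables. -/
noncomputable def ev (D : K × K) (ψ : K × K → K × K → K × K → K) (e : K × K)
    (f : K × K → K × K → V) : V :=
  ∑ᶠ t : (K × K) × (K × K), (if t.1 + t.2 = D + e then ψ t.1 t.2 e else 0) • f t.1 t.2

theorem ev_eq_sum {D e : K × K} (ψ : K × K → K × K → K × K → K) {f : K × K → K × K → V}
    (hf : DegFinite f) :
    ev D ψ e f = ∑ t ∈ (hf (D + e)).toFinset, ψ t.1 t.2 e • f t.1 t.2 := by
  rw [ev, finsum_eq_sum_of_support_subset (s := (hf (D + e)).toFinset)]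
  · refine Finset.sum_congr rfl fun t ht => ?_
    rw [if_pos ((hf (D + e)).mem_toFinset.1 ht).1]
  · intro t ht
    rw [Function.mem_support] at ht
    simp only [Set.Finite.coe_toFinset, Set.mem_ofPred_eq]
    refine ⟨?_, fun h => ht (by rw [h, smul_zero])⟩
    by_contra hc
    exact ht (by rw [if_neg hc, zero_smul])

theorem ev_eq_sum_of_subset {D e : K × K} (ψ : K × K → K × K → K × K → K)
    {f : K × K → K × K → V} (hf : DegFinite f) (S : Finset ((K × K) × (K × K)))
    (hS : ∀ t ∈ S, t.1 + t.2 = D + e) (hS' : (hf (D + e)).toFinset ⊆ S) :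
    ev D ψ e f = ∑ t ∈ S, ψ t.1 t.2 e • f t.1 t.2 := by
  rw [ev_eq_sum ψ hf]
  refine Finset.sum_subset hS' fun t ht hnt => ?_
  simp only [Set.Finite.mem_toFinset, Set.mem_ofPred_eq, not_and, not_not] at hnt
  rw [hnt (hS t ht), smul_zero]

theorem map_ev {D e : K × K} (ψ : K × K → K × K → K × K → K) {f : K × K → K × K → V}
    (hf : DegFinite f) (G : V →ₗ[K] W) : G (ev D ψ e f) = ev D ψ e fun n m => G (f n m) := by
  rw [ev_eq_sum_of_subset ψ (hf.map G) (hf (D + e)).toFinset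
    (fun t ht => ((hf (D + e)).mem_toFinset.1 ht).1) (fun t ht => ?_), ev_eq_sum ψ hf, map_sum]
  · simp only [map_smul]
  · rw [Set.Finite.mem_toFinset] at ht ⊢
    exact ⟨ht.1, fun h => ht.2 (by rw [h, map_zero])⟩

theorem finite_support_ev {D e : K × K} (ψ : K × K → K × K → K × K → K)
    {f : K × K → K × K → V} (hf : DegFinite f) : (Function.support
      fun t : (K × K) × (K × K) =>
        (open Classical in if t.1 + t.2 = D + e then ψ t.1 t.2 e else 0) • f t.1 t.2).Finite := by
  refine (hf (D + e)).subset fun t ht => ?_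
  rw [Function.mem_support] at ht
  refine ⟨?_, fun h => ht (by rw [h, smul_zero])⟩
  by_contra hc
  exact ht (by rw [if_neg hc, zero_smul])

theorem ev_add {D e : K × K} (ψ : K × K → K × K → K × K → K) {f g : K × K → K × K → V}
    (hf : DegFinite f) (hg : DegFinite g) :
    ev D ψ e (fun n m => f n m + g n m) = ev D ψ e f + ev D ψ e g := by
  simp only [ev, smul_add]
  exact finsum_add_distrib (finite_support_ev ψ hf) (finite_support_ev ψ hg)

theorem ev_sum {ι : Type*} (s : Finset ι) {D e : K × K} (ψ : K × K → K × K → K × K → K)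
    {f : ι → K × K → K × K → V} (hf : ∀ i ∈ s, DegFinite (f i)) :
    ev D ψ e (fun n m => ∑ i ∈ s, f i n m) = ∑ i ∈ s, ev D ψ e (f i) := by
  classical
  induction s using Finset.induction_on with
  | empty => simp [ev]
  | insert i s hi ih =>
    simp only [Finset.sum_insert hi]
    rw [ev_add ψ (hf i (Finset.mem_insert_self _ _))
      (DegFinite.sum s fun j hj => hf j (Finset.mem_insert_of_mem hj)),
      ih fun j hj => hf j (Finset.mem_insert_of_mem hj)]

theorem ev_congr {D e : K × K} {ψ ψ' : K × K → K × K → K × K → K} {f : K × K → K × K → V}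
    (h : ∀ n m, n + m = D + e → ψ n m e = ψ' n m e) : ev D ψ e f = ev D ψ' e f := by
  refine finsum_congr fun t => ?_
  split_ifs with ht
  · rw [h _ _ ht]
  · rfl

theorem ev_smul {D e : K × K} (r : K) (ψ : K × K → K × K → K × K → K) {f : K × K → K × K → V}
    (hf : DegFinite f) : ev D (fun n m e => r * ψ n m e) e f = r • ev D ψ e f := by
  rw [ev_eq_sum _ hf, ev_eq_sum _ hf, Finset.smul_sum]
  simp only [smul_smul]

theorem ev_fun_add {D e : K × K} (ψ ψ' : K × K → K × K → K × K → K) {f : K × K → K × K → V}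
    (hf : DegFinite f) : ev D (fun n m e => ψ n m e + ψ' n m e) e f = ev D ψ e f + ev D ψ' e f := by
  rw [ev_eq_sum _ hf, ev_eq_sum _ hf, ev_eq_sum _ hf, ← Finset.sum_add_distrib]
  simp only [add_smul]

open Classical in
theorem ev_shift {D e a b : K × K} (ψ : K × K → K × K → K × K → K) (r : K × K → K × K → K)
    {f : K × K → K × K → V} : ev D ψ e (fun n m => r n m • f (n - a) (m - b)) =
      ev (D - a - b) (fun n m e => ψ (n + a) (m + b) e * r (n + a) (m + b)) e f := by
  rw [ev, ev, ← finsum_comp_equiv (Equiv.addRight ((a, b) : (K × K) × (K × K)))]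
  refine finsum_congr fun t => ?_
  change (if t.1 + a + (t.2 + b) = D + e then ψ (t.1 + a) (t.2 + b) e else 0) •
    r (t.1 + a) (t.2 + b) • f (t.1 + a - a) (t.2 + b - b) = _
  have : (t.1 + a + (t.2 + b) = D + e) = (t.1 + t.2 = D - a - b + e) := by
    rw [add_add_add_comm, sub_sub, sub_add_eq_add_sub, eq_sub_iff_add_eq]
  simp only [this, add_sub_cancel_right, smul_smul, ite_mul, zero_mul]

section Family

variable {ι : Type*} [Fintype ι] {e : ι → K × K} {f : ι → K × K → K × K → V}

theorem sum_ev_eq (D : K × K) (hf : ∀ i, DegFinite (f i)) (ψ : K × K → K × K → K × K → K) :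
    ∑ i, ev D ψ (e i) (f i) = ∑ j ∈ Finset.univ.sigma fun i => (hf i (D + e i)).toFinset,
      ψ j.2.1 j.2.2 (e j.1) • f j.1 j.2.1 j.2.2 := by
  rw [Finset.sum_sigma]
  exact Finset.sum_congr rfl fun i _ => ev_eq_sum ψ (hf i)

omit [Module K V] in
theorem degree_of_mem_sigma {D : K × K} (hf : ∀ i, DegFinite (f i))
    {j : Σ _ : ι, (K × K) × (K × K)}
    (hj : j ∈ Finset.univ.sigma fun i => (hf i (D + e i)).toFinset) :
    j.2.1 + j.2.2 = D + e j.1 :=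
  ((hf j.1 (D + e j.1)).mem_toFinset.1 (Finset.mem_sigma.1 hj).2).1

variable [CharZero K]

theorem sum_ev_eq_zero_of_expandZ (hf : ∀ i, DegFinite (f i)) (D : K × K)
    (h : ∀ m₀, ∑ i, ev D (expandZ m₀) (e i) (f i) = 0) {ψ : K × K → K × K → K × K → K}
    (hψ : Invariant ψ) : ∑ i, ev D ψ (e i) (f i) = 0 := by
  simp only [sum_ev_eq D hf] at h ⊢
  exact sum_eq_zero_of_expandZ _ (fun j => j.2.1) (fun j => j.2.2) (fun j => e j.1)
    (fun j => f j.1 j.2.1 j.2.2) D (fun j hj => degree_of_mem_sigma hf hj) h hψ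

theorem sum_ev_eq_zero_of_expandW (hf : ∀ i, DegFinite (f i)) (he : ∀ i, IsStatistical (e i))
    (D : K × K) (h : ∀ n₀, ∑ i, ev D (expandW n₀) (e i) (f i) = 0)
    {ψ : K × K → K × K → K × K → K} (hψ : Invariant ψ) : ∑ i, ev D ψ (e i) (f i) = 0 := by
  simp only [sum_ev_eq D hf] at h ⊢
  exact sum_eq_zero_of_expandW _ (fun j => j.2.1) (fun j => j.2.2) (fun j => e j.1)
    (fun j => f j.1 j.2.1 j.2.2) D (fun j hj => degree_of_mem_sigma hf hj) (fun j _ => he j.1) h hψ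

theorem exists_normalForm_ev (hf : ∀ i, DegFinite (f i)) (he : ∀ i, IsStatistical (e i))
    (D : K × K)
    (hz : ∀ m₀, ¬ NatLE m₀ (-1, -1) → ∑ i, ev D (expandZ m₀) (e i) (f i) = 0)
    (hw : ∀ n₀, ¬ NatLE n₀ (-1, -1) → ∑ i, ev D (expandW n₀) (e i) (f i) = 0) :
    ∃ (e₀ : K × K) (w : K × K →₀ V),
      (∀ g ∈ w.support, NatLE g (-1, -1) ∧ NatLE (D + e₀ - g) (-1, -1)) ∧
      ∀ ψ, Invariant ψ →
        ∑ i, ev D ψ (e i) (f i) = w.sum fun g x => ψ g (D + e₀ - g) e₀ • x := by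
  simp only [sum_ev_eq D hf] at hz hw ⊢
  exact exists_normalForm _ (fun j => j.2.1) (fun j => j.2.2) (fun j => e j.1)
    (fun j => f j.1 j.2.1 j.2.2) D (fun j hj => degree_of_mem_sigma hf hj) (fun j _ => he j.1)
    hz hw

/-- Two families with the same expansion for `z > w` have the same invariants. -/
theorem sum_ev_eq_of_expandZ {κ : Type*} [Fintype κ] {e' : κ → K × K}
    {f' : κ → K × K → K × K → V} (hf : ∀ i, DegFinite (f i)) (hf' : ∀ i, DegFinite (f' i))
    (D : K × K)
    (h : ∀ m₀, ∑ i, ev D (expandZ m₀) (e i) (f i) = ∑ i, ev D (expandZ m₀) (e' i) (f' i))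
    {ψ : K × K → K × K → K × K → K} (hψ : Invariant ψ) :
    ∑ i, ev D ψ (e i) (f i) = ∑ i, ev D ψ (e' i) (f' i) := by
  have hneg : ∀ i, DegFinite fun n m => -(f' i n m) := fun i =>
    (hf' i).map (-(LinearMap.id : V →ₗ[K] V))
  have hev : ∀ (ψ : K × K → K × K → K × K → K) (i), ev D ψ (e' i) (fun n m => -(f' i n m)) =
      - ev D ψ (e' i) (f' i) := fun ψ i =>
    (map_ev ψ (hf' i) (-(LinearMap.id : V →ₗ[K] V))).symm
  have key := sum_ev_eq_zero_of_expandZ (ι := ι ⊕ κ) (e := Sum.elim e e')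
    (f := Sum.elim f fun i n m => -(f' i n m)) (by rintro (i | i); exacts [hf i, hneg i]) D
    (fun m₀ => by
      simp only [Fintype.sum_sum_type, Sum.elim_inl, Sum.elim_inr, hev, Finset.sum_neg_distrib, h,
        add_neg_cancel]) hψ
  simp only [Fintype.sum_sum_type, Sum.elim_inl, Sum.elim_inr, hev, Finset.sum_neg_distrib] at key
  exact add_neg_eq_zero.1 key

end Family

theorem mulPow_eq_ev [CharZero K] (e : K × K) (f : K × K → K × K → V) (n m : K × K) :
    mulPow e f n m = ev (n + m) (expandZ m) e f := by
  classical
  rw [mulPow, ev, ← finsum_comp_injective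
    (φ := fun k : ℕ × ℕ => ((n + e - natPair k, m + natPair k) : (K × K) × (K × K)))]
  · refine finsum_congr fun k => ?_
    rw [if_pos (by dsimp only; abel), expandZ, powCoeff_eq_altBinom₂, add_sub_cancel_left]
  · intro k l hkl
    exact natPair_injective (add_left_cancel (Prod.ext_iff.1 hkl).2)
  · intro t ht
    rw [Function.mem_support] at ht
    have hd : t.1 + t.2 = n + m + e := by
      by_contra hc
      exact ht (by rw [if_neg hc, zero_smul])
    rw [if_pos hd] at ht
    obtain ⟨k, hk⟩ := exists_of_altBinom₂_ne_zero (fun h => ht (by rw [expandZ, h, zero_smul]) :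
      altBinom₂ e (t.2 - m) ≠ 0)
    refine ⟨k, Prod.ext ?_ ?_⟩
    · simp only
      rw [← hk, ← sub_eq_iff_eq_add.2 hd.symm]
      abel
    · simp only
      rw [← hk]
      abel

theorem mulPowOpp_eq_ev [CharZero K] {e : K × K} (he : IsStatistical e)
    (f : K × K → K × K → V) (n m : K × K) :
    mulPowOpp e f n m = ev (n + m) (expandW n) e f := by
  classical
  rw [mulPowOpp, ev, ← finsum_comp_injective
    (φ := fun k : ℕ × ℕ => ((n + natPair k, m + e - natPair k) : (K × K) × (K × K)))]
  · refine finsum_congr fun k => ?_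
    rw [if_pos (by dsimp only; abel), expandW, powCoeff_eq_altBinom₂, add_sub_cancel_left,
      intSign_of_isStatistical he]
  · intro k l hkl
    exact natPair_injective (add_left_cancel (Prod.ext_iff.1 hkl).1)
  · intro t ht
    rw [Function.mem_support] at ht
    have hd : t.1 + t.2 = n + m + e := by
      by_contra hc
      exact ht (by rw [if_neg hc, zero_smul])
    rw [if_pos hd] at ht
    obtain ⟨k, hk⟩ := exists_of_altBinom₂_ne_zero (fun h => ht (by
      rw [expandW, h, mul_zero, zero_smul]) : altBinom₂ e (t.1 - n) ≠ 0)
    refine ⟨k, Prod.ext ?_ ?_⟩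
    · simp only
      rw [← hk]
      abel
    · simp only
      rw [← hk, eq_sub_of_add_eq' hd]
      abel

theorem taylorDiag_apply [CharZero K] (c : Distr₂ K V) (hc : IsField₂ c) (e N p : K × K) (x : V) :
    taylorDiag c hc (-e - N) p x =
      ev (p + N - (1, 1)) (taylorFun N) e fun n m => c n m x := by
  classical
  rw [taylorDiag]
  split_ifs with h
  · have hs := h.choose_spec
    generalize h.choose = k at hs
    rw [diagDeriv, LinearMap.coe_mk, AddHom.coe_mk, ev, ← finsum_comp_injective
      (φ := fun m : K × K => ((m - natPair k, p - m - (1, 1)) : (K × K) × (K × K)))]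
    · refine finsum_congr fun m => ?_
      have e1 : m - natPair k - e - N = m := by
        rw [sub_sub, sub_sub, ← hs]; abel
      rw [if_pos (by dsimp only; rw [← hs]; abel), taylorFun, powCoeff_eq_altBinom₂, e1, hs]
    · intro m m' hm
      exact sub_left_injective (Prod.ext_iff.1 hm).1
    · intro t ht
      rw [Function.mem_support] at ht
      have hd : t.1 + t.2 = p + N - (1, 1) + e := by
        by_contra hc
        exact ht (by rw [if_neg hc, zero_smul])
      refine ⟨t.1 + natPair k, Prod.ext (by simp) ?_⟩
      simp only
      rw [← hs, eq_sub_of_add_eq' hd]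
      abel
  · have h0 : ∀ n m, taylorFun N n m e = 0 := fun n m => by
      by_contra hne
      exact h (exists_of_altBinom₂_ne_zero hne)
    simp [ev, h0]

theorem OPE.coeff_apply [CharZero K] {a : Distr₂ K V} (o : OPE a) (N p : K × K) (x : V) :
    o.coeff N p x = ∑ i, ev (p + N - (1, 1)) (taylorFun N) (-(o.order i))
      fun n m => o.num i n m x := by
  rw [OPE.coeff, Finset.sum_apply, LinearMap.sum_apply]
  refine Finset.sum_congr rfl fun i _ => ?_
  rw [← taylorDiag_apply, neg_neg]

theorem OPE.eq_ev [CharZero K] {a : Distr₂ K V} (o : OPE a) (n m : K × K) (x : V) :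
    a n m x = ∑ i, ev (n + m) (expandZ m) (-(o.order i)) fun n m => o.num i n m x := by
  rw [o.eq]
  exact Finset.sum_congr rfl fun i _ => mulPow_eq_ev _ _ _ _

/-- The coefficients of an OPE do not depend on the OPE. -/
theorem OPE.coeff_eq [CharZero K] {a : Distr₂ K V} (o o' : OPE a) : o.coeff = o'.coeff := by
  funext N p
  ext x
  rw [OPE.coeff_apply, OPE.coeff_apply]
  refine sum_ev_eq_of_expandZ (fun i => (o.isField i).degFinite x)
    (fun i => (o'.isField i).degFinite x) _ (fun m₀ => ?_) (invariant_taylorFun N)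
  have h := o.eq_ev (p + N - (1, 1) - m₀) m₀ x
  rw [o'.eq_ev, sub_add_cancel] at h
  exact h.symm

theorem nthProd_eq_coeff [CharZero K] {a b : Distr K V} (o : OPE (juxt a b)) (n : K × K) :
    nthProd a b n = o.coeff (n + (1, 1)) := by
  have h : OPEFinite a b := ⟨o⟩
  rw [nthProd, dif_pos h, OPE.coeff_eq]

end Evaluation

end OPEAlg

namespace SuperSpace

variable {K : Type u} {V : Type v} [Field K] [AddCommGroup V] [Module K V] [SuperSpace K V]

theorem sum_zmod_two {M : Type*} [AddCommMonoid M] (f : ZMod 2 → M) :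
    ∑ p : ZMod 2, f p = f 0 + f 1 := Fin.sum_univ_two f

theorem sum_add_right {M : Type*} [AddCommMonoid M] (q : ZMod 2) (f : ZMod 2 → M) :
    ∑ p, f (p + q) = ∑ p, f p := Fintype.sum_equiv (Equiv.addRight q) _ _ fun _ => rfl

theorem proj_mem (p : ZMod 2) (x : V) : proj K p x ∈ part K (V := V) p := by
  rw [proj, part]
  split_ifs <;> exact Submodule.projection_apply_mem _ _

theorem proj_of_mem {p : ZMod 2} {x : V} (hx : x ∈ part K (V := V) p) : proj K p x = x := by
  rw [part] at hx
  rw [proj]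
  split_ifs at hx ⊢ <;> exact Submodule.projection_apply_of_mem_left _ hx

theorem proj_of_mem_ne {p q : ZMod 2} (hqp : q ≠ p) {x : V} (hx : x ∈ part K (V := V) p) :
    proj K q x = 0 := by
  rw [part] at hx
  rw [proj]
  have h2 : ∀ p q : ZMod 2, q ≠ p → q ≠ 0 → p = 0 := by decide
  split_ifs at hx ⊢ with h0 h1 h1
  · exact absurd (h0.trans h1.symm) hqp
  · exact (Submodule.projection_apply_eq_zero_iff _).2 hx
  · exact (Submodule.projection_apply_eq_zero_iff _).2 hx
  · exact absurd (h2 _ _ hqp h0) h1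

theorem sum_proj (x : V) : ∑ p : ZMod 2, proj K p x = x := by
  rw [sum_zmod_two, proj, proj, if_pos rfl, if_neg (by decide)]
  exact Submodule.projection_add_projection_eq_self _ x

theorem proj_proj (p q : ZMod 2) (x : V) :
    proj K p (proj K q x) = if p = q then proj K q x else 0 := by
  split_ifs with h
  · rw [h, proj_of_mem (proj_mem q x)]
  · exact proj_of_mem_ne h (proj_mem q x)

theorem opPart_apply (p : ZMod 2) (f : Module.End K V) (x : V) :
    opPart K p f x = ∑ q : ZMod 2, proj K (p + q) (f (proj K q x)) := by
  simp [opPart, LinearMap.sum_apply]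

theorem sum_opPart (f : Module.End K V) : ∑ p : ZMod 2, opPart K p f = f := by
  ext x
  simp only [LinearMap.sum_apply, opPart_apply]
  rw [Finset.sum_comm]
  have h : ∀ q : ZMod 2, ∑ p : ZMod 2, proj K (p + q) (f (proj K q x)) = f (proj K q x) :=
    fun q => (sum_add_right q fun p => proj K p (f (proj K q x))).trans (sum_proj _)
  simp only [h]
  rw [← map_sum, sum_proj]

theorem opPart_apply_even (p : ZMod 2) (f : Module.End K V) {x : V}
    (hx : x ∈ part K (V := V) 0) : opPart K p f x = proj K p (f x) := by
  rw [opPart_apply, sum_zmod_two, proj_of_mem hx, proj_of_mem_ne (by decide) hx, map_zero,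
    map_zero, add_zero, add_zero]

theorem opPart_mul (p : ZMod 2) (f g : Module.End K V) :
    opPart K p (f * g) = ∑ q : ZMod 2, opPart K (p + q) f * opPart K q g := by
  ext x
  simp only [LinearMap.sum_apply, Module.End.mul_apply, opPart_apply, map_sum]
  have h : ∀ q r s : ZMod 2, proj K (p + q + s) (f (proj K s (proj K (q + r) (g (proj K r x))))) =
      if s = q + r then proj K (p + r) (f (proj K (q + r) (g (proj K r x)))) else 0 := by
    intro q r s
    rw [proj_proj]
    split_ifs with hs
    · have : p + q + s = p + r := by
        rw [hs]
        have : ∀ a b c : ZMod 2, a + b + (b + c) = a + c := by decide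
        exact this _ _ _
      rw [this]
    · simp
  simp only [h, Finset.sum_ite_eq', Finset.mem_univ, if_true]
  rw [Finset.sum_comm]
  refine Finset.sum_congr rfl fun r _ => ?_
  rw [sum_add_right r fun q => proj K (p + r) (f (proj K q (g (proj K r x)))), ← map_sum,
    ← map_sum, sum_proj]

end SuperSpace

namespace OPEAlg

open SuperSpace

section Directions

variable {K : Type u} {V : Type v} [Field K] [AddCommGroup V] [Module K V]

/-- One of the two components of `K × K`, together with the corresponding unit vector. -/
structure IsDirection (π : K × K →ₗ[K] K) (u : K × K) : Prop where
  succ_mul : ∀ e s : K × K, π (s + u) * altBinom₂ e (s + u) = -(π (e - s) * altBinom₂ e s)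
  add_self : ∀ n s : K × K,
    π (n + u) * altBinom₂ (n + u + s) s = π (n + u + s) * altBinom₂ (n + s) s

theorem isDirection_fst [CharZero K] : IsDirection (LinearMap.fst K K K) (1, 0) where
  succ_mul e s := by
    have := altBinom_succ_mul e.1 s.1
    simp only [LinearMap.fst_apply, Prod.fst_add, Prod.snd_add, Prod.fst_sub, altBinom₂, add_zero]
    linear_combination altBinom e.2 s.2 * this
  add_self n s := by
    have := altBinom_add_self n.1 s.1
    simp only [LinearMap.fst_apply, Prod.fst_add, Prod.snd_add, altBinom₂, add_zero]
    linear_combination altBinom (n.2 + s.2) s.2 * this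

theorem isDirection_snd [CharZero K] : IsDirection (LinearMap.snd K K K) (0, 1) where
  succ_mul e s := by
    have := altBinom_succ_mul e.2 s.2
    simp only [LinearMap.snd_apply, Prod.fst_add, Prod.snd_add, Prod.snd_sub, altBinom₂, add_zero]
    linear_combination altBinom e.1 s.1 * this
  add_self n s := by
    have := altBinom_add_self n.2 s.2
    simp only [LinearMap.snd_apply, Prod.fst_add, Prod.snd_add, altBinom₂, add_zero]
    linear_combination altBinom (n.1 + s.1) s.1 * this

/-- The modes of `(∂_z + ∂_w) f(z, w)`. -/
def totalDeriv (π : K × K →ₗ[K] K) (u : K × K) (f : K × K → K × K → V) : K × K → K × K → V :=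
  fun n m => (-π n) • f (n - u) (m - 0) + (-π m) • f (n - 0) (m - u)

theorem DegFinite.totalDeriv {f : K × K → K × K → V} (hf : DegFinite f) (π : K × K →ₗ[K] K)
    (u : K × K) : DegFinite (totalDeriv π u f) :=
  (hf.shift u 0 fun n _ => -π n).add (hf.shift 0 u fun _ m => -π m)

theorem ev_totalDeriv {π : K × K →ₗ[K] K} {u D e : K × K} (ψ : K × K → K × K → K × K → K)
    {f : K × K → K × K → V} (hf : DegFinite f) :
    ev D ψ e (totalDeriv π u f) = ev (D - u)
      (fun n m e => ψ (n + u) m e * (-π (n + u)) + ψ n (m + u) e * (-π (m + u))) e f := by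
  have h1 := ev_shift (D := D) (e := e) (a := u) (b := 0) ψ (fun n _ => -π n) (f := f)
  have h2 := ev_shift (D := D) (e := e) (a := 0) (b := u) ψ (fun _ m => -π m) (f := f)
  simp only [add_zero, sub_zero] at h1 h2
  have h3 := ev_add (D := D) (e := e) ψ (hf.shift u 0 fun n _ => -π n)
    (hf.shift 0 u fun _ m => -π m)
  simp only [sub_zero] at h3
  rw [ev_fun_add _ _ hf, ← h1, ← h2, ← h3]
  refine congrArg (ev D ψ e) ?_
  funext n m
  simp only [totalDeriv, sub_zero]

theorem ev_totalDeriv_expandZ {π : K × K →ₗ[K] K} {u : K × K} (h : IsDirection π u)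
    {n₀ m₀ e : K × K} {f : K × K → K × K → V} (hf : DegFinite f) :
    ev (n₀ + m₀) (expandZ m₀) e (totalDeriv π u f) =
      (-π n₀) • ev (n₀ + m₀ - u) (expandZ m₀) e f +
        (-π m₀) • ev (n₀ + m₀ - u) (expandZ (m₀ - u)) e f := by
  rw [ev_totalDeriv _ hf, ← ev_smul _ _ hf, ← ev_smul _ _ hf, ← ev_fun_add _ _ hf]
  refine ev_congr fun n m hnm => ?_
  have h1 := h.succ_mul e (m - m₀)
  have e1 : m + u - m₀ = m - m₀ + u := by abel
  have e2 : m - (m₀ - u) = m - m₀ + u := by abel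
  have e3 : n = n₀ + m₀ - u + e - m := eq_sub_of_add_eq hnm
  simp only [expandZ, e1, e2]
  rw [e3]
  simp only [map_add, map_sub] at h1 ⊢
  linear_combination -h1

theorem ev_totalDeriv_taylorFun {π : K × K →ₗ[K] K} {u : K × K} (h : IsDirection π u)
    (hπ : π u = 1) (hπ' : π (1, 1) = 1)
    {p N e : K × K} {f : K × K → K × K → V} (hf : DegFinite f) :
    ev (p + N - (1, 1)) (taylorFun N) e (totalDeriv π u f) =
      (-π p) • ev (p + N - (1, 1) - u) (taylorFun N) e f := by
  rw [ev_totalDeriv _ hf, ← ev_smul _ _ hf]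
  refine ev_congr fun n m hnm => ?_
  have h1 := h.add_self n (-e - N)
  have e1 : n + u - e - N = n + u + (-e - N) := by abel
  have e2 : n - e - N = n + (-e - N) := by abel
  have e3 : m = p + N - (1, 1) - u + e - n := eq_sub_of_add_eq' hnm
  simp only [taylorFun, e1, e2]
  rw [e3]
  simp only [map_add, map_sub, map_neg, hπ, hπ'] at h1 ⊢
  linear_combination -h1

end Directions

end OPEAlg

namespace OPEAlg

open SuperSpace

section LocalPairs

variable {K : Type u} {V : Type v} [Field K] [AddCommGroup V] [Module K V]

/-- Two distributions in two variables which are given by the same numerators and the opposite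
expansions of the powers of `z - w`. -/
def LocalPair (G G' : Distr₂ K V) : Prop :=
  ∃ o : OPE G, (∀ i, IsStatistical (o.order i)) ∧
    ∀ n m x, G' n m x = ∑ i, mulPowOpp (-(o.order i)) (fun n' m' => o.num i n' m' x) n m

theorem LocalPair.of_fintype [CharZero K] {G G' : Distr₂ K V} {ι : Type*} [Fintype ι]
    (num : ι → Distr₂ K V) (hnum : ∀ i, IsField₂ (num i)) (e : ι → K × K)
    (he : ∀ i, IsStatistical (e i))
    (hG : ∀ n m x, G n m x = ∑ i, ev (n + m) (expandZ m) (e i) fun n m => num i n m x)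
    (hG' : ∀ n m x, G' n m x = ∑ i, ev (n + m) (expandW n) (e i) fun n m => num i n m x) :
    LocalPair G G' := by
  have φ := (Fintype.equivFin ι).symm
  refine ⟨⟨Fintype.card ι, fun i => num (φ i), fun i => hnum _, fun i => -(e (φ i)),
    fun n m x => ?_⟩, fun i => (he _).neg, fun n m x => ?_⟩
  · rw [hG]
    simp only [mulPow_eq_ev, neg_neg]
    exact (Equiv.sum_comp φ fun i => ev (n + m) (expandZ m) (e i) fun n m => num i n m x).symm
  · rw [hG']
    simp only [mulPowOpp_eq_ev (he _), neg_neg]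
    exact (Equiv.sum_comp φ fun i => ev (n + m) (expandW n) (e i) fun n m => num i n m x).symm

theorem OPE.eq_ev_opp [CharZero K] {G G' : Distr₂ K V} (o : OPE G)
    (ho : ∀ i, IsStatistical (o.order i))
    (h : ∀ n m x, G' n m x = ∑ i, mulPowOpp (-(o.order i)) (fun n' m' => o.num i n' m' x) n m)
    (n m : K × K) (x : V) :
    G' n m x = ∑ i, ev (n + m) (expandW n) (-(o.order i)) fun n m => o.num i n m x := by
  rw [h]
  exact Finset.sum_congr rfl fun i _ => mulPowOpp_eq_ev (ho i).neg _ _ _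

/-- Local pairs with the same opposite product on a vector have the same product on it. -/
theorem eq_of_opp_eq [CharZero K] {G G' H H' : Distr₂ K V} (hG : LocalPair G G')
    (hH : LocalPair H H') (x : V) (h : ∀ n m, G' n m x = H' n m x) (n m : K × K) :
    G n m x = H n m x := by
  obtain ⟨o, ho, ho'⟩ := hG
  obtain ⟨q, hq, hq'⟩ := hH
  have hneg : ∀ (D : K × K) (ψ : K × K → K × K → K × K → K) (i),
      ev D ψ (-(q.order i)) (fun n m => -(q.num i n m x)) =
      - ev D ψ (-(q.order i)) (fun n m => q.num i n m x) := fun D ψ i =>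
    (map_ev ψ ((q.isField i).degFinite x) (-(LinearMap.id : V →ₗ[K] V))).symm
  have key := sum_ev_eq_zero_of_expandW (ι := Fin o.length ⊕ Fin q.length)
    (e := Sum.elim (fun i => -(o.order i)) fun i => -(q.order i))
    (f := Sum.elim (fun i n m => o.num i n m x) fun i n m => -(q.num i n m x))
    (by
      rintro (i | i)
      exacts [(o.isField i).degFinite x,
        ((q.isField i).degFinite x).map (-(LinearMap.id : V →ₗ[K] V))])
    (by rintro (i | i); exacts [(ho i).neg, (hq i).neg]) (n + m)
    (fun n₀ => by
      have h1 := o.eq_ev_opp ho ho' n₀ (n + m - n₀) x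
      have h2 := q.eq_ev_opp hq hq' n₀ (n + m - n₀) x
      rw [add_sub_cancel] at h1 h2
      simp only [Fintype.sum_sum_type, Sum.elim_inl, Sum.elim_inr, hneg, Finset.sum_neg_distrib]
      rw [← h1, ← h2, h, add_neg_cancel]) (invariant_expandZ m)
  simp only [Fintype.sum_sum_type, Sum.elim_inl, Sum.elim_inr, hneg, Finset.sum_neg_distrib] at key
  rw [← o.eq_ev, ← q.eq_ev] at key
  exact add_neg_eq_zero.1 key

end LocalPairs

section SuperSwap

variable {K : Type u} {V : Type v} [Field K] [AddCommGroup V] [Module K V] [SuperSpace K V]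

theorem superSwap_apply_even {a b : Distr K V} (n m : K × K) {x : V}
    (hx : x ∈ part K (V := V) 0) : superSwap a b n m x =
      ∑ p : ZMod 2, ∑ q : ZMod 2, superSign p q • opPart K q (b m) (proj K p (a n x)) := by
  simp only [superSwap, LinearMap.sum_apply, LinearMap.smul_apply, Module.End.mul_apply,
    opPart_apply_even _ _ hx]

theorem superSwap_apply_eq_zero {a b : Distr K V} {n : K × K} (m : K × K) {x : V}
    (hx : x ∈ part K (V := V) 0) (h : a n x = 0) : superSwap a b n m x = 0 := by
  simp only [superSwap_apply_even n m hx, h, map_zero, smul_zero, Finset.sum_const_zero]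

end SuperSwap

/-- A distribution whose action on the vector `e` is a power series `exp(z T) v` for
some `v`. -/
structure IsCreative {K : Type u} {V : Type v} [Field K] [AddCommGroup V] [Module K V]
    (T T' : Module.End K V) (e : V) (c : Distr K V) : Prop where
  eq_zero : ∀ n, ¬ NatLE n ((-1, -1) : K × K) → c n e = 0
  left : ∀ n, T (c n e) = (-n.1) • c (n - (1, 0)) e
  right : ∀ n, T' (c n e) = (-n.2) • c (n - (0, 1)) e

section Creative

variable {K : Type u} {V : Type v} [Field K] [CharZero K] [AddCommGroup V] [Module K V]
  {T T' : Module.End K V} {e : V}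

theorem IsCreative.eq {c c' : Distr K V} (hc : IsCreative T T' e c) (hc' : IsCreative T T' e c')
    (h : c (-1, -1) e = c' (-1, -1) e) (n : K × K) : c n e = c' n e := by
  by_cases hn : NatLE n (-1, -1)
  · obtain ⟨⟨k, l⟩, hk⟩ := hn
    have hn : n = (-1 - (k : K), -1 - (l : K)) := by
      rw [← sub_eq_iff_eq_add.2 hk]
      simp [natPair]
    rw [hn]
    clear hk hn n
    induction k with
    | zero =>
      induction l with
      | zero => simpa using h
      | succ l ih =>
        have h1 := hc.right (-1 - ((0 : ℕ) : K), -1 - (l : K))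
        have h2 := hc'.right (-1 - ((0 : ℕ) : K), -1 - (l : K))
        rw [ih, h2] at h1
        have hl : -(-1 - (l : K)) ≠ 0 := by
          have : -(-1 - (l : K)) = ((l + 1 : ℕ) : K) := by push_cast; ring
          rw [this]
          exact_mod_cast l.succ_ne_zero
        have h3 := smul_right_injective V hl h1.symm
        have e1 : ((-1 - ((0 : ℕ) : K), -1 - ((l + 1 : ℕ) : K)) : K × K) =
            (-1 - ((0 : ℕ) : K), -1 - (l : K)) - (0, 1) := by
          ext <;> simp; ring
        rw [e1]
        exact h3
    | succ k ih =>
      have h1 := hc.left (-1 - (k : K), -1 - (l : K))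
      have h2 := hc'.left (-1 - (k : K), -1 - (l : K))
      rw [ih, h2] at h1
      have hl : -(-1 - (k : K)) ≠ 0 := by
        have : -(-1 - (k : K)) = ((k + 1 : ℕ) : K) := by push_cast; ring
        rw [this]
        exact_mod_cast k.succ_ne_zero
      have h3 := smul_right_injective V hl h1.symm
      have e1 : ((-1 - ((k + 1 : ℕ) : K), -1 - (l : K)) : K × K) =
          (-1 - (k : K), -1 - (l : K)) - (1, 0) := by
        ext <;> simp; ring
      rw [e1]
      exact h3
  · rw [hc.eq_zero n hn, hc'.eq_zero n hn]

omit [CharZero K] in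
theorem isCreative_identityField (hT : T e = 0) (hT' : T' e = 0) :
    IsCreative T T' e identityField where
  eq_zero n hn := by
    rw [identityField, if_neg, LinearMap.zero_apply]
    rintro rfl
    exact hn (NatLE.refl _)
  left n := by
    have h1 : T (identityField n e) = 0 := by
      rw [identityField]
      split_ifs <;> simp [hT]
    rw [h1, identityField]
    split_ifs with h
    · have : n.1 = 0 := by
        have := congrArg Prod.fst h
        simpa using this
      simp [this]
    · simp
  right n := by
    have h1 : T' (identityField n e) = 0 := by
      rw [identityField]
      split_ifs <;> simp [hT']
    rw [h1, identityField]
    split_ifs with h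
    · have : n.2 = 0 := by
        have := congrArg Prod.snd h
        simpa using this
      simp [this]
    · simp

end Creative

section Products

variable {K : Type u} {V : Type v} [Field K] [CharZero K] [AddCommGroup V] [Module K V]
  [SuperSpace K V]

omit [SuperSpace K V] in
theorem OPE.map_coeff_of_direction {a b : Distr K V} (o : OPE (juxt a b))
    {π : K × K →ₗ[K] K} {u : K × K} (h : IsDirection π u) (hπ : π u = 1) (hπ' : π (1, 1) = 1)
    (S : Module.End K V) (x : V)
    (hS : ∀ n m, S (a n (b m x)) = (-π n) • a (n - u) (b m x) + (-π m) • a n (b (m - u) x))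
    (N p : K × K) : S (o.coeff N p x) = (-π p) • o.coeff N (p - u) x := by
  have hf := fun i => (o.isField i).degFinite x
  simp only [OPE.coeff_apply, map_sum, Finset.smul_sum, map_ev _ (hf _)]
  have e1 : p - u + N - (1, 1) = p + N - (1, 1) - u := by abel
  simp only [e1, ← ev_totalDeriv_taylorFun h hπ hπ' (hf _)]
  refine sum_ev_eq_of_expandZ (fun i => (hf i).map S) (fun i => (hf i).totalDeriv π u) _
    (fun m₀ => ?_) (invariant_taylorFun N)
  obtain ⟨n₀, hn₀⟩ : ∃ n₀, p + N - (1, 1) = n₀ + m₀ := ⟨p + N - (1, 1) - m₀, by abel⟩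
  simp only [hn₀, ev_totalDeriv_expandZ h (hf _), Finset.sum_add_distrib, ← Finset.smul_sum,
    ← map_ev _ (hf _), ← map_sum]
  have h1 := o.eq_ev n₀ m₀ x
  have h2 := o.eq_ev (n₀ - u) m₀ x
  have h3 := o.eq_ev n₀ (m₀ - u) x
  rw [sub_add_eq_add_sub] at h2
  rw [← add_sub_assoc] at h3
  rw [← h1, ← h2, ← h3]
  exact hS n₀ m₀

theorem altBinom₂_add_self_natPair {g : K × K} {α : ℕ × ℕ} (h : (-1, -1) = g + natPair α)
    (κ : ℕ × ℕ) : altBinom₂ (g + natPair κ) (natPair κ) =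
      (α.1.choose κ.1 : K) * (α.2.choose κ.2 : K) := by
  have h1 : -1 - g.1 = α.1 := by
    have := congrArg Prod.fst h
    simp only [natPair, Prod.fst_add] at this
    rw [this]; ring
  have h2 : -1 - g.2 = α.2 := by
    have := congrArg Prod.snd h
    simp only [natPair, Prod.snd_add] at this
    rw [this]; ring
  simp only [altBinom₂, natPair, Prod.fst_add, Prod.snd_add, altBinom_add_natCast, h1, h2,
    binom_natCast]

theorem normalForm_taylorFun_ne_zero {D N e₀ g : K × K} (hg : NatLE g (-1, -1))
    (hg' : NatLE (D + e₀ - g) (-1, -1)) (h : taylorFun N g (D + e₀ - g) e₀ ≠ 0) :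
    NatLE (D - N + (1, 1)) (-1, -1) := by
  obtain ⟨α, hα⟩ := hg
  obtain ⟨β, hβ⟩ := hg'
  rw [taylorFun] at h
  obtain ⟨κ, hκ⟩ := exists_of_altBinom₂_ne_zero h
  have e1 : g - e₀ - N = g + natPair κ := by rw [← hκ]; abel
  rw [hκ, e1, altBinom₂_add_self_natPair hα] at h
  have h1 : κ.1 ≤ α.1 := by
    by_contra hc
    exact h (by rw [Nat.choose_eq_zero_of_lt (not_le.1 hc)]; simp)
  have h2 : κ.2 ≤ α.2 := by
    by_contra hc
    exact h (by rw [Nat.choose_eq_zero_of_lt (not_le.1 hc)]; simp)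
  obtain ⟨γ, rfl⟩ : ∃ γ, α = κ + γ :=
    ⟨(α.1 - κ.1, α.2 - κ.2), Prod.ext (by simp; omega) (by simp; omega)⟩
  refine ⟨γ + β, ?_⟩
  rw [natPair_add] at hα ⊢
  have h11 : ((1, 1) : K × K) = -(-1, -1) := by simp
  have h3 : D = (-1, -1) - natPair β - e₀ + g := by
    rw [hβ]; abel
  have h4 : e₀ = - N - natPair κ := by rw [← hκ]; abel
  rw [h11, h3, h4]
  nth_rewrite 3 [hα]
  abel

theorem normalForm_taylorFun_eq {n e₀ g : K × K} (hg : NatLE g (-1, -1))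
    (hg' : NatLE (n + (-1, -1) + e₀ - g) (-1, -1)) :
    taylorFun (n + (1, 1)) g (n + (-1, -1) + e₀ - g) e₀ =
      expandZ (-1, -1) g (n + (-1, -1) + e₀ - g) e₀ := by
  obtain ⟨α, hα⟩ := hg
  obtain ⟨β, hβ⟩ := hg'
  have h11 : ((1, 1) : K × K) = -(-1, -1) := by simp
  have hm : n + (-1, -1) + e₀ - g - (-1, -1) = - natPair β := by
    nth_rewrite 2 [hβ]
    abel
  have hκ : - e₀ - (n + (1, 1)) = natPair (α + β) := by
    have h1 := eq_neg_of_add_eq_zero_left (a := n + (-1, -1) + e₀ - g - (-1, -1))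
      (b := natPair β) (by rw [hm]; abel)
    have h2 : natPair α = (-1, -1) - g := by rw [hα]; abel
    have h3 : natPair β = -(n + (-1, -1) + e₀ - g - (-1, -1)) := by rw [hm, neg_neg]
    rw [natPair_add, h2, h3, h11]
    abel
  have e1 : g - e₀ - (n + (1, 1)) = g + natPair (α + β) := by rw [← hκ]; abel
  rw [taylorFun, hκ, e1, altBinom₂_add_self_natPair hα, expandZ, hm]
  by_cases hβ0 : β = 0
  · subst hβ0
    rw [natPair_zero, neg_zero, altBinom₂_zero]
    simp
  · have h0 : altBinom₂ e₀ (-natPair β) = 0 := by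
      by_contra hne
      obtain ⟨k, hk⟩ := exists_of_altBinom₂_ne_zero hne
      have h4 : natPair (K := K) (β + k) = natPair 0 := by
        rw [natPair_add, ← hk, natPair_zero]; abel
      have h5 := natPair_injective h4
      have h6 := congrArg Prod.fst h5
      have h7 := congrArg Prod.snd h5
      simp only [Prod.fst_add, Prod.snd_add, Prod.fst_zero, Prod.snd_zero] at h6 h7
      exact hβ0 (Prod.ext (by simp; omega) (by simp; omega))
    rw [h0]
    have : α.1.choose (α + β).1 = 0 ∨ α.2.choose (α + β).2 = 0 := by
      by_contra hc
      simp only [Nat.choose_eq_zero_iff, not_or, not_lt, Prod.fst_add, Prod.snd_add] at hc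
      exact hβ0 (Prod.ext (by simp; omega) (by simp; omega))
    rcases this with h | h
    · rw [h, Nat.cast_zero, zero_mul]
    · rw [h, Nat.cast_zero, mul_zero]

theorem OPE.coeff_apply_vacuum {a b : Distr K V} (o : OPE (juxt a b))
    (ho : ∀ i, IsStatistical (o.order i))
    (ho' : ∀ n m x, superSwap a b n m x =
      ∑ i, mulPowOpp (-(o.order i)) (fun n' m' => o.num i n' m' x) n m)
    {x : V} (hx : x ∈ part K (V := V) 0) (ha : ∀ n, ¬ NatLE n ((-1, -1) : K × K) → a n x = 0)
    (hb : ∀ n, ¬ NatLE n ((-1, -1) : K × K) → b n x = 0) (n : K × K) :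
    (∀ p, ¬ NatLE p ((-1, -1) : K × K) → o.coeff (n + (1, 1)) p x = 0) ∧
      o.coeff (n + (1, 1)) (-1, -1) x = a n (b (-1, -1) x) := by
  have hform := fun D => exists_normalForm_ev (fun i => (o.isField i).degFinite x)
    (fun i => (ho i).neg) D
    (fun m₀ hm₀ => by
      have h1 := o.eq_ev (D - m₀) m₀ x
      rw [sub_add_cancel] at h1
      rw [← h1, juxt, Module.End.mul_apply, hb m₀ hm₀, map_zero])
    (fun n₀ hn₀ => by
      have h1 := o.eq_ev_opp ho ho' n₀ (D - n₀) x
      rw [add_sub_cancel] at h1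
      rw [← h1, superSwap_apply_eq_zero _ hx (ha n₀ hn₀)])
  constructor
  · intro p hp
    obtain ⟨e₀, w, hw, hev⟩ := hform (p + (n + (1, 1)) - (1, 1))
    rw [OPE.coeff_apply, hev _ (invariant_taylorFun _)]
    refine Finset.sum_eq_zero fun g hg => ?_
    have h0 : taylorFun (n + (1, 1)) g (p + (n + (1, 1)) - (1, 1) + e₀ - g) e₀ = 0 := by
      by_contra hne
      have := normalForm_taylorFun_ne_zero (hw g hg).1 (hw g hg).2 hne
      have e1 : p + (n + (1, 1)) - (1, 1) - (n + (1, 1)) + (1, 1) = p := by abel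
      rw [e1] at this
      exact hp this
    dsimp only
    rw [h0, zero_smul]
  · obtain ⟨e₀, w, hw, hev⟩ := hform (n + (-1, -1))
    have e1 : (-1, -1) + (n + (1, 1)) - (1, 1) = n + ((-1, -1) : K × K) := by abel
    have h1 := o.eq_ev n (-1, -1) x
    rw [hev _ (invariant_expandZ _)] at h1
    rw [OPE.coeff_apply, e1, hev _ (invariant_taylorFun _)]
    refine Eq.trans (Finset.sum_congr rfl fun g hg => ?_) h1.symm
    dsimp only
    rw [normalForm_taylorFun_eq (hw g hg).1 (hw g hg).2]

end Products

end OPEAlg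

namespace OPEAlg

open SuperSpace

namespace FoldAlgebra

variable {K : Type u} {V : Type v} [Field K] [CharZero K] [AddCommGroup V] [Module K V]
  [SuperSpace K V] {A : FoldAlgebra K V} {T T' : Module.End K V} {e : V}

namespace IsOPEAlgebraWith

omit [CharZero K] in
theorem isCreative (hA : A.IsOPEAlgebraWith T T' e) (a : V) : IsCreative T T' e (A.Y a) where
  eq_zero n hn := hA.isRightIdentity.apply_eq_zero a n hn
  left n := by
    rw [hA.isTranslationGenerator.comm, hA.invariant, map_zero, add_zero, neg_smul]
  right n := by
    rw [hA.isTranslationGenerator.comm', hA.invariant', map_zero, add_zero, neg_smul]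

theorem exists_nthProd_eq_coeff (hA : A.IsOPEAlgebraWith T T' e) (a b : V) :
    ∃ o : OPE (juxt (A.Y a) (A.Y b)), (∀ i, IsStatistical (o.order i)) ∧
      (∀ n m x, superSwap (A.Y a) (A.Y b) n m x =
        ∑ i, mulPowOpp (-(o.order i)) (fun n' m' => o.num i n' m' x) n m) ∧
      ∀ n, nthProd (A.Y a) (A.Y b) n = o.coeff (n + (1, 1)) := by
  obtain ⟨o, ho, ho'⟩ := hA.isLocal a b
  exact ⟨o, ho, ho', nthProd_eq_coeff o⟩

theorem isCreative_nthProd (hA : A.IsOPEAlgebraWith T T' e) (a b : V) (n : K × K) :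
    IsCreative T T' e (nthProd (A.Y a) (A.Y b) n) := by
  obtain ⟨o, ho, ho', hn⟩ := hA.exists_nthProd_eq_coeff a b
  rw [hn]
  have hT := hA.isTranslationGenerator
  refine ⟨(o.coeff_apply_vacuum ho ho' hA.isRightIdentity.even
    (hA.isRightIdentity.apply_eq_zero a) (hA.isRightIdentity.apply_eq_zero b) n).1,
    fun p => ?_, fun p => ?_⟩
  · refine o.map_coeff_of_direction isDirection_fst rfl rfl T e (fun n m => ?_) _ p
    rw [hT.comm, hT.comm, hA.invariant]
    simp
  · refine o.map_coeff_of_direction isDirection_snd rfl rfl T' e (fun n m => ?_) _ p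
    rw [hT.comm', hT.comm', hA.invariant']
    simp

theorem nthProd_apply_neg_one (hA : A.IsOPEAlgebraWith T T' e) (a b : V) (n : K × K) :
    nthProd (A.Y a) (A.Y b) n (-1, -1) e = A.Y a n b := by
  obtain ⟨o, ho, ho', hn⟩ := hA.exists_nthProd_eq_coeff a b
  rw [hn, (o.coeff_apply_vacuum ho ho' hA.isRightIdentity.even
    (hA.isRightIdentity.apply_eq_zero a) (hA.isRightIdentity.apply_eq_zero b) n).2,
    hA.isRightIdentity.apply_neg_one]

/-- Uniqueness: a creative distribution which is mutually local with all fields of an OPE-algebra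
is the field of a state. -/
theorem eq_Y (hA : A.IsOPEAlgebraWith T T' e) {c : Distr K V} (hc : IsCreative T T' e c)
    (hloc : ∀ d, MutuallyLocal c (A.Y d)) : c = A.Y (c (-1, -1) e) := by
  have h := hc.eq (hA.isCreative (c (-1, -1) e)) (hA.isRightIdentity.apply_neg_one _).symm
  funext n
  ext d
  have key := eq_of_opp_eq (hloc d) (hA.isLocal (c (-1, -1) e) d) e (fun n m => by
    rw [superSwap_apply_even n m hA.isRightIdentity.even,
      superSwap_apply_even n m hA.isRightIdentity.even, h n]) n (-1, -1)
  simpa only [juxt, Module.End.mul_apply, hA.isRightIdentity.apply_neg_one] using key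

theorem nthProd_eq_Y (hA : A.IsOPEAlgebraWith T T' e) (a b : V) (n : K × K)
    (h : ∀ d, MutuallyLocal (nthProd (A.Y a) (A.Y b) n) (A.Y d)) :
    nthProd (A.Y a) (A.Y b) n = A.Y (A.Y a n b) := by
  rw [hA.eq_Y (hA.isCreative_nthProd a b n) h, hA.nthProd_apply_neg_one]

theorem isField_Y (hA : A.IsOPEAlgebraWith T T' e) (a : V) : IsField (A.Y a) := by
  classical
  intro b
  obtain ⟨o, -, -⟩ := hA.isLocal a b
  choose S hS using fun i => o.isField i e
  have hfin := fun h : K × K => (finite_setOf_natLE (-1, -1) h).preimage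
    (f := fun k : ℕ × ℕ => ((-1, -1) : K × K) + natPair k)
    fun k _ l _ hkl => natPair_injective (add_left_cancel hkl)
  refine ⟨Finset.univ.biUnion fun i => (S i).biUnion fun h => (hfin h.2).toFinset.image
    fun k => h.1 + o.order i + natPair k, fun n hn => ?_⟩
  have h1 := o.eq n (-1, -1) e
  rw [juxt, Module.End.mul_apply, hA.isRightIdentity.apply_neg_one] at h1
  rw [h1] at hn
  obtain ⟨i, -, hi⟩ := Finset.exists_ne_zero_of_sum_ne_zero hn
  rw [mulPow] at hi
  obtain ⟨k, hk⟩ : ∃ k, powCoeff (-o.order i) k •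
      o.num i (n + -o.order i - natPair k) ((-1, -1) + natPair k) e ≠ 0 := by
    by_contra hc
    push Not at hc
    exact hi (by simp only [hc, finsum_zero])
  have hk' := right_ne_zero_of_smul hk
  obtain ⟨h, hh, ⟨l, hl⟩, hle⟩ := hS i _ _ hk'
  refine ⟨h.1 + o.order i + natPair k, ?_, ⟨l, ?_⟩⟩
  · simp only [Finset.mem_biUnion, Finset.mem_univ, true_and, Finset.mem_image,
      Set.Finite.mem_toFinset]
    exact ⟨i, h, hh, k, ⟨⟨k, rfl⟩, hle⟩, rfl⟩
  · rw [hl]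
    abel

end IsOPEAlgebraWith

end FoldAlgebra

section IdentityField

variable {K : Type u} {V : Type v} [Field K] [CharZero K] [AddCommGroup V] [Module K V]
  [SuperSpace K V]

omit [CharZero K] [SuperSpace K V] in
theorem isField₂_juxt_identityField {d : Distr K V} (hd : IsField d) :
    IsField₂ (juxt identityField d) := by
  classical
  intro x
  obtain ⟨S, hS⟩ := hd x
  refine ⟨S.image fun h => ((-1, -1), h), fun n m hnm => ?_⟩
  rw [juxt, Module.End.mul_apply, identityField] at hnm
  split_ifs at hnm with hn
  · obtain ⟨h, hh, hle⟩ := hS m hnm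
    exact ⟨_, Finset.mem_image_of_mem _ hh, hn ▸ NatLE.refl _, hle⟩
  · exact absurd rfl hnm

omit [CharZero K] in
theorem opPart_one (p : ZMod 2) :
    opPart K p (1 : Module.End K V) = if p = 0 then 1 else 0 := by
  ext x
  rw [opPart_apply]
  simp only [Module.End.one_apply, proj_proj, add_eq_right]
  split_ifs with h
  · exact sum_proj x
  · simp

omit [CharZero K] in
theorem superSwap_identityField (d : Distr K V) (n m : K × K) :
    superSwap identityField d n m = juxt identityField d n m := by
  have h : ∀ p q : ZMod 2, superSign p q •
      (opPart K q (d m) * opPart K p (identityField (K := K) (V := V) n)) =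
      if p = 0 then opPart K q (d m) * identityField n else 0 := by
    intro p q
    have h0 : opPart K p (0 : Module.End K V) = 0 := by ext x; simp [opPart_apply]
    rw [identityField]
    split_ifs with h1 h2 h2
    · rw [opPart_one, if_pos h2, superSign, if_neg (by rw [h2]; simp), one_smul]
    · rw [opPart_one, if_neg h2, mul_zero, smul_zero]
    · rw [h0, mul_zero, smul_zero]
    · rw [h0, mul_zero, smul_zero]
  simp only [superSwap, h]
  rw [Finset.sum_comm]
  simp only [Finset.sum_ite_eq', Finset.mem_univ, if_true, ← Finset.sum_mul, sum_opPart]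
  rw [juxt, identityField]
  split_ifs <;> simp

theorem mutuallyLocal_identityField {d : Distr K V} (hd : IsField d) :
    MutuallyLocal identityField d := by
  classical
  have hf := isField₂_juxt_identityField hd
  have h0 : ∀ s : K × K, altBinom₂ 0 s = if s = 0 then 1 else 0 := by
    intro s
    split_ifs with hs
    · rw [hs, altBinom₂_zero]
    · by_contra hne
      obtain ⟨⟨k, l⟩, rfl⟩ := exists_of_altBinom₂_ne_zero hne
      apply hne
      have hb : ∀ k : ℕ, k ≠ 0 → altBinom (0 : K) (k : K) = 0 := fun k hk => by
        rw [altBinom_natCast]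
        have := binom_natCast_eq_zero (K := K) 0 k (Nat.pos_of_ne_zero hk)
        rw [Nat.cast_zero] at this
        rw [this, mul_zero]
      rcases Nat.eq_zero_or_pos k with hk | hk
      · rcases Nat.eq_zero_or_pos l with hl | hl
        · exact absurd (by rw [hk, hl]; exact natPair_zero) hs
        · exact mul_eq_zero_of_right _ (hb l hl.ne')
      · exact mul_eq_zero_of_left (hb k hk.ne') _
  have hstat : IsStatistical (0 : K × K) := ⟨0, by simp⟩
  have hsgn : intSign (0 : K × K) = 1 := by
    rw [intSign_eq (d := 0) (by simp), zpow_zero]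
  refine LocalPair.of_fintype (ι := Unit) (fun _ => juxt identityField d) (fun _ => hf)
    (fun _ => 0) (fun _ => hstat) (fun n m x => ?_) (fun n m x => ?_)
  · rw [Finset.univ_unique, Finset.sum_singleton, ev, finsum_eq_single _ (n, m)]
    · simp [expandZ, h0]
    · rintro ⟨n', m'⟩ hne
      split_ifs with h
      · rw [expandZ, h0, if_neg, zero_smul]
        intro hm
        have hm' : m' = m := sub_eq_zero.1 hm
        subst hm'
        apply hne
        simp only [add_zero, add_left_inj] at h
        rw [h]
      · rw [zero_smul]
  · rw [superSwap_identityField, Finset.univ_unique, Finset.sum_singleton, ev,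
      finsum_eq_single _ (n, m)]
    · simp [expandW, h0, hsgn]
    · rintro ⟨n', m'⟩ hne
      split_ifs with h
      · rw [expandW, h0, if_neg, mul_zero, zero_smul]
        intro hm
        have hm' : n' = n := sub_eq_zero.1 hm
        subst hm'
        apply hne
        simp only [add_zero, add_right_inj] at h
        rw [h]
      · rw [zero_smul]

theorem FoldAlgebra.IsOPEAlgebraWith.Y_identity {A : FoldAlgebra K V} {T T' : Module.End K V}
    {e : V} (hA : A.IsOPEAlgebraWith T T' e) : A.Y e = identityField := by
  have h := hA.eq_Y (isCreative_identityField hA.invariant hA.invariant') fun d =>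
    mutuallyLocal_identityField (hA.isField_Y d)
  rw [h]
  simp [identityField]

theorem FoldAlgebra.IsOPEAlgebraWith.isIdentity {A : FoldAlgebra K V} {T T' : Module.End K V}
    {e : V} (hA : A.IsOPEAlgebraWith T T' e) : A.IsIdentity e where
  toIsRightIdentity := hA.isRightIdentity
  left_neg_one a := by simp [hA.Y_identity, identityField]
  left_eq_zero a n hn := by simp [hA.Y_identity, identityField, hn]

end IdentityField

end OPEAlg

namespace OPEAlg

open SuperSpace

section Transport

variable {K : Type u} {V : Type v} {W : Type w} [Field K] [AddCommGroup V] [Module K V]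
  [SuperSpace K V] [AddCommGroup W] [Module K W] [SuperSpace K W]

omit [SuperSpace K V] [SuperSpace K W] in
theorem map_mulPow (f : V ≃ₗ[K] W) (e : K × K) (g : K × K → K × K → V) (n m : K × K) :
    f (mulPow e g n m) = mulPow e (fun n m => f (g n m)) n m := by
  simp only [mulPow, AddEquivClass.map_finsum, map_smul]

omit [SuperSpace K V] [SuperSpace K W] in
theorem map_mulPowOpp (f : V ≃ₗ[K] W) (e : K × K) (g : K × K → K × K → V) (n m : K × K) :
    f (mulPowOpp e g n m) = mulPowOpp e (fun n m => f (g n m)) n m := by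
  simp only [mulPowOpp, AddEquivClass.map_finsum, map_smul]

variable {f : V ≃ₗ[K] W} (hf : ∀ p : ZMod 2, ∀ a ∈ part K (V := V) p, f a ∈ part K (V := W) p)

include hf

theorem map_proj (p : ZMod 2) (x : V) : f (proj K p x) = proj K p (f x) := by
  conv_rhs => rw [← sum_proj (K := K) x, map_sum, map_sum]
  rw [Finset.sum_eq_single_of_mem p (Finset.mem_univ _), proj_of_mem (hf p _ (proj_mem p x))]
  intro q _ hqp
  exact proj_of_mem_ne hqp.symm (hf q _ (proj_mem q x))

theorem opPart_conj (p : ZMod 2) (g : Module.End K V) :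
    opPart K p (f.conj g) = f.conj (opPart K p g) := by
  have hsymm : ∀ q x, f.symm (proj K q x) = proj K q (f.symm x) := fun q x => by
    apply f.injective
    rw [map_proj hf, f.apply_symm_apply, f.apply_symm_apply]
  ext x
  simp only [opPart_apply, LinearEquiv.conj_apply_apply, map_sum, map_proj hf, hsymm]

theorem superSwap_conj (a b : Distr K V) (n m : K × K) (y : W) :
    superSwap (fun n => f.conj (a n)) (fun n => f.conj (b n)) n m y =
      f (superSwap a b n m (f.symm y)) := by
  simp only [superSwap, opPart_conj hf, LinearMap.sum_apply, LinearMap.smul_apply,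
    Module.End.mul_apply, LinearEquiv.conj_apply_apply, LinearEquiv.symm_apply_apply, map_sum,
    map_zsmul]

theorem MutuallyLocal.conj {a b : Distr K V} (h : MutuallyLocal a b) :
    MutuallyLocal (fun n => f.conj (a n)) (fun n => f.conj (b n)) := by
  obtain ⟨o, ho, ho'⟩ := h
  refine ⟨⟨o.length, fun i n m => f.conj (o.num i n m), fun i y => ?_, o.order,
    fun n m y => ?_⟩, ho, fun n m y => ?_⟩
  · obtain ⟨S, hS⟩ := o.isField i (f.symm y)
    refine ⟨S, fun n m hnm => hS n m fun h0 => hnm ?_⟩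
    rw [LinearEquiv.conj_apply_apply, h0, map_zero]
  · have h1 := o.eq n m (f.symm y)
    simp only [juxt, Module.End.mul_apply, LinearEquiv.conj_apply_apply,
      LinearEquiv.symm_apply_apply] at h1 ⊢
    rw [h1, map_sum]
    simp only [map_mulPow]
  · rw [superSwap_conj hf, ho', map_sum]
    simp only [map_mulPowOpp, LinearEquiv.conj_apply_apply]

end Transport

namespace FoldAlgebra

variable {K : Type u} {V : Type v} {W : Type w} [Field K] [AddCommGroup V] [Module K V]
  [SuperSpace K V] [AddCommGroup W] [Module K W] [SuperSpace K W]

/-- The transport of a `K²`-fold algebra structure along an even linear isomorphism. -/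
noncomputable def transport (A : FoldAlgebra K V) (f : V ≃ₗ[K] W)
    (hf : ∀ p : ZMod 2, ∀ a ∈ part K (V := V) p, f a ∈ part K (V := W) p)
    (hf' : ∀ p : ZMod 2, ∀ a ∈ part K (V := W) p, f.symm a ∈ part K (V := V) p) :
    FoldAlgebra K W where
  Y :=
    { toFun := fun x n => f.conj (A.Y (f.symm x) n)
      map_add' := fun x y => by funext n; simp
      map_smul' := fun t x => by funext n; simp }
  parity p a ha n q x hx := hf _ _ (A.parity p _ (hf' p a ha) n q _ (hf' q x hx))

variable {A : FoldAlgebra K V} {f : V ≃ₗ[K] W}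
  (hf : ∀ p : ZMod 2, ∀ a ∈ part K (V := V) p, f a ∈ part K (V := W) p)
  (hf' : ∀ p : ZMod 2, ∀ a ∈ part K (V := W) p, f.symm a ∈ part K (V := V) p)

theorem transport_Y_apply (a b : W) (n : K × K) :
    (A.transport f hf hf').Y a n b = f (A.Y (f.symm a) n (f.symm b)) := rfl

theorem isRightIdentity_transport {e : V} (h : A.IsRightIdentity e) :
    (A.transport f hf hf').IsRightIdentity (f e) where
  even := hf 0 _ h.even
  apply_neg_one a := by
    rw [transport_Y_apply, f.symm_apply_apply, h.apply_neg_one, f.apply_symm_apply]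
  apply_eq_zero a n hn := by
    rw [transport_Y_apply, f.symm_apply_apply, h.apply_eq_zero _ _ hn, map_zero]

theorem isIdentity_transport {e : V} (h : A.IsIdentity e) :
    (A.transport f hf hf').IsIdentity (f e) where
  toIsRightIdentity := isRightIdentity_transport hf hf' h.toIsRightIdentity
  left_neg_one a := by
    rw [transport_Y_apply, f.symm_apply_apply, h.left_neg_one, f.apply_symm_apply]
  left_eq_zero a n hn := by
    rw [transport_Y_apply, f.symm_apply_apply, h.left_eq_zero _ _ hn, map_zero]

theorem isOPEAlgebraWith_transport {T T' : Module.End K V} {e : V}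
    (h : A.IsOPEAlgebraWith T T' e) :
    (A.transport f hf hf').IsOPEAlgebraWith (f.conj T) (f.conj T') (f e) where
  isLocal a b := (h.isLocal (f.symm a) (f.symm b)).conj hf
  isTranslationGenerator :=
    { even := fun p x hx => hf _ _ (h.isTranslationGenerator.even p _ (hf' p x hx))
      even' := fun p x hx => hf _ _ (h.isTranslationGenerator.even' p _ (hf' p x hx))
      comm := fun a b n => by
        simp only [transport_Y_apply, LinearEquiv.conj_apply_apply, LinearEquiv.symm_apply_apply,
          h.isTranslationGenerator.comm, map_add, map_neg, map_smul]
      comm' := fun a b n => by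
        simp only [transport_Y_apply, LinearEquiv.conj_apply_apply, LinearEquiv.symm_apply_apply,
          h.isTranslationGenerator.comm', map_add, map_neg, map_smul] }
  isRightIdentity := isRightIdentity_transport hf hf' h.isRightIdentity
  invariant := by
    rw [LinearEquiv.conj_apply_apply, f.symm_apply_apply, h.invariant, map_zero]
  invariant' := by
    rw [LinearEquiv.conj_apply_apply, f.symm_apply_apply, h.invariant', map_zero]

theorem isUnitalIso_transport {e : V} (h : A.IsIdentity e) :
    A.IsUnitalIso (A.transport f hf hf') f where
  even := hf
  map_prod a n b := by
    rw [transport_Y_apply, f.symm_apply_apply, f.symm_apply_apply]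
  map_identity := ⟨e, h, isIdentity_transport hf hf' h⟩

end FoldAlgebra

namespace FoldAlgebra.IsOPEAlgebraWith

variable {K : Type u} {V : Type v} [Field K] [CharZero K] [AddCommGroup V] [Module K V]
  [SuperSpace K V] {A : FoldAlgebra K V} {T T' : Module.End K V} {e : V}

omit [CharZero K] in
theorem Y_injective (hA : A.IsOPEAlgebraWith T T' e) : Function.Injective A.Y := fun a b h => by
  rw [← hA.isRightIdentity.apply_neg_one a, h, hA.isRightIdentity.apply_neg_one]

/-- The state-field correspondence as an isomorphism onto the space of fields. -/
noncomputable def fieldEquiv (hA : A.IsOPEAlgebraWith T T' e) : V ≃ₗ[K] A.fieldSpace :=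
  LinearEquiv.ofInjective A.Y hA.Y_injective

omit [CharZero K] in
theorem coe_fieldEquiv (hA : A.IsOPEAlgebraWith T T' e) (a : V) :
    (hA.fieldEquiv a : Distr K V) = A.Y a := rfl

omit [CharZero K] in
theorem mem_part_fieldSpace {p : ZMod 2} {x : A.fieldSpace} :
    x ∈ part K (V := A.fieldSpace) p ↔ ∀ n, HasParity K p (x.1 n) := by
  have h : ∀ p : ZMod 2, p ≠ 0 → p = 1 := by decide
  rw [part]
  split_ifs with hp
  · subst hp; rfl
  · have := h p hp
    subst this; rfl

omit [CharZero K] in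
theorem fieldEquiv_mem (hA : A.IsOPEAlgebraWith T T' e) (p : ZMod 2) (a : V)
    (ha : a ∈ part K (V := V) p) : hA.fieldEquiv a ∈ part K (V := A.fieldSpace) p :=
  mem_part_fieldSpace.2 (A.parity p a ha)

omit [CharZero K] in
theorem fieldEquiv_symm_mem (hA : A.IsOPEAlgebraWith T T' e) (p : ZMod 2) (x : A.fieldSpace)
    (hx : x ∈ part K (V := A.fieldSpace) p) : hA.fieldEquiv.symm x ∈ part K (V := V) p := by
  obtain ⟨a, rfl⟩ := hA.fieldEquiv.surjective x
  rw [LinearEquiv.symm_apply_apply, ← hA.isRightIdentity.apply_neg_one a]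
  have := mem_part_fieldSpace.1 hx (-1, -1) 0 e hA.isRightIdentity.even
  rwa [add_zero] at this

/-- If the products of fields are mutually local with all fields then the fields form an
OPE-algebra isomorphic to the given one. -/
theorem exists_isUnitalSubalgebra (hA : A.IsOPEAlgebraWith T T' e)
    (h : ∀ a b d n, MutuallyLocal (nthProd (A.Y a) (A.Y b) n) (A.Y d)) :
    ∃ B : FoldAlgebra K A.fieldSpace, IsUnitalSubalgebra A.fieldSpace B ∧ B.IsOPEAlgebra ∧
      ∃ f : V ≃ₗ[K] A.fieldSpace, (∀ a, (f a : Distr K V) = A.Y a) ∧ A.IsUnitalIso B f := by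
  have hprod := fun a b n => hA.nthProd_eq_Y a b n fun d => h a b d n
  have hid : identityField ∈ A.fieldSpace := ⟨e, hA.Y_identity⟩
  refine ⟨A.transport hA.fieldEquiv hA.fieldEquiv_mem hA.fieldEquiv_symm_mem, ?_,
    ⟨_, _, _, isOPEAlgebraWith_transport _ _ hA⟩, hA.fieldEquiv, hA.coe_fieldEquiv,
    isUnitalIso_transport _ _ hA.isIdentity⟩
  refine ⟨?_, ?_, ?_, ?_, hid, ?_⟩
  · rintro _ ⟨a, rfl⟩
    exact hA.isField_Y a
  · rintro _ ⟨a, rfl⟩ _ ⟨b, rfl⟩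
    obtain ⟨o, -⟩ := hA.isLocal a b
    exact ⟨o⟩
  · rintro _ ⟨a, rfl⟩ _ ⟨b, rfl⟩ n
    exact ⟨_, (hprod a b n).symm⟩
  · intro x y n
    obtain ⟨a, rfl⟩ := hA.fieldEquiv.surjective x
    obtain ⟨b, rfl⟩ := hA.fieldEquiv.surjective y
    rw [transport_Y_apply, LinearEquiv.symm_apply_apply, LinearEquiv.symm_apply_apply,
      coe_fieldEquiv, coe_fieldEquiv, coe_fieldEquiv, hprod]
  · have : (⟨identityField, hid⟩ : A.fieldSpace) = hA.fieldEquiv e :=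
      Subtype.ext hA.Y_identity.symm
    rw [this]
    exact isIdentity_transport _ _ hA.isIdentity

end FoldAlgebra.IsOPEAlgebraWith

end OPEAlg

namespace OPEAlg

open Finset.HasAntidiagonal

section Identities

variable {K : Type u} [Field K] [CharZero K]

theorem binom_mul_binom_comm (s : K) (j l : ℕ) :
    binom s j * binom (s - j) l = binom s l * binom (s - l) j := by
  rw [binom_mul_binom_sub, binom_mul_binom_sub, add_comm l j, Nat.choose_symm_add]

theorem sum_altBinom_expandZ (n s t : K) (κ L : ℕ) :
    ∑ q ∈ antidiagonal L, altBinom (n - s + (q.1 : K) + κ) (κ : K) *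
      (altBinom s (q.1 : K) * altBinom t (q.2 : K)) =
    ∑ q ∈ antidiagonal κ, binom s q.1 * altBinom (n + (q.2 : K)) (q.2 : K) *
      altBinom (s + t - (q.1 : K)) (L : K) := by
  have h1 : ∀ q ∈ antidiagonal L, altBinom (n - s + (q.1 : K) + κ) (κ : K) *
      (altBinom s (q.1 : K) * altBinom t (q.2 : K)) = ∑ r ∈ antidiagonal κ,
        (-1) ^ L * (binom s r.1 * binom (s - r.1) q.1) * binom (-1 - n) r.2 * binom t q.2 := by
    intro q hq
    have e : -1 - (n - s + (q.1 : K)) = (s - q.1) + (-1 - n) := by ring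
    have hL : (-1 : K) ^ L = (-1) ^ q.1 * (-1) ^ q.2 := by
      rw [← pow_add, mem_antidiagonal.1 hq]
    rw [altBinom_add_natCast, e, binom_add, altBinom_natCast, altBinom_natCast, Finset.sum_mul]
    refine Finset.sum_congr rfl fun r _ => ?_
    rw [binom_mul_binom_comm s r.1 q.1, hL]
    ring
  have h2 : ∀ r ∈ antidiagonal κ, binom s r.1 * altBinom (n + (r.2 : K)) (r.2 : K) *
      altBinom (s + t - (r.1 : K)) (L : K) = ∑ q ∈ antidiagonal L,
        (-1) ^ L * (binom s r.1 * binom (s - r.1) q.1) * binom (-1 - n) r.2 * binom t q.2 := by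
    intro r _
    have e : s + t - (r.1 : K) = (s - r.1) + t := by ring
    rw [altBinom_add_natCast, altBinom_natCast, e, binom_add, Finset.mul_sum, Finset.mul_sum]
    exact Finset.sum_congr rfl fun q _ => by ring
  rw [Finset.sum_congr rfl h1, Finset.sum_congr rfl h2, Finset.sum_comm]

theorem altBinom_sub_natCast (s t : K) (j J : ℕ) :
    (-1) ^ j * binom s j * altBinom (s + t - (j : K)) ((J : K) - j) =
      ∑ q ∈ antidiagonal J, (-1) ^ J * (binom s q.1 * (q.1.choose j : K)) * binom t q.2 := by
  rcases lt_or_ge J j with h | h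
  · have h0 : ¬ ∃ k : ℕ, (J : K) - j = k := by
      rintro ⟨k, hk⟩
      have : J = j + k := by exact_mod_cast (sub_eq_iff_eq_add'.1 hk)
      omega
    rw [altBinom_eq_zero h0, mul_zero, Finset.sum_eq_zero]
    intro q hq
    have := mem_antidiagonal.1 hq
    rw [Nat.choose_eq_zero_of_lt (by omega : q.1 < j)]
    simp
  · obtain ⟨M, rfl⟩ := Nat.exists_eq_add_of_le h
    have e1 : ((j + M : ℕ) : K) - j = M := by push_cast; ring
    have e2 : s + t - (j : K) = (s - j) + t := by ring
    rw [e1, e2, altBinom_natCast, binom_add, Finset.mul_sum, Finset.mul_sum]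
    refine Finset.sum_of_injOn (fun q => (j + q.1, q.2)) ?_ ?_ ?_ ?_
    · rintro ⟨a, b⟩ _ ⟨a', b'⟩ _ hq
      simpa using hq
    · intro q hq
      have := mem_antidiagonal.1 hq
      exact mem_antidiagonal.2 (by dsimp only; omega)
    · rintro ⟨a, b⟩ hq hn
      have hq' := mem_antidiagonal.1 hq
      have : a < j := by
        by_contra hc
        refine hn ⟨(a - j, b), mem_antidiagonal.2 ?_, Prod.ext ?_ rfl⟩
        · dsimp only at hq' ⊢; omega
        · dsimp only; omega
      dsimp only
      rw [Nat.choose_eq_zero_of_lt this]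
      simp
    · intro q _
      dsimp only
      rw [← binom_mul_binom_sub, pow_add]
      ring

theorem sum_altBinom_expandW (n s t : K) (κ J : ℕ) :
    ∑ q ∈ antidiagonal J, altBinom (n - (q.1 : K) + κ) (κ : K) *
      (altBinom s (q.1 : K) * altBinom t (q.2 : K)) =
    ∑ q ∈ antidiagonal κ, binom s q.1 * altBinom (n + (q.2 : K)) (q.2 : K) *
      ((-1) ^ q.1 * altBinom (s + t - (q.1 : K)) ((J : K) - q.1)) := by
  have h1 : ∀ q ∈ antidiagonal J, altBinom (n - (q.1 : K) + κ) (κ : K) *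
      (altBinom s (q.1 : K) * altBinom t (q.2 : K)) = ∑ r ∈ antidiagonal κ,
        (-1) ^ J * (binom s q.1 * (q.1.choose r.1 : K)) * binom t q.2 * binom (-1 - n) r.2 := by
    intro q hq
    have e : -1 - (n - (q.1 : K)) = q.1 + (-1 - n) := by ring
    have hL : (-1 : K) ^ J = (-1) ^ q.1 * (-1) ^ q.2 := by
      rw [← pow_add, mem_antidiagonal.1 hq]
    rw [altBinom_add_natCast, e, binom_add, altBinom_natCast, altBinom_natCast, Finset.sum_mul]
    refine Finset.sum_congr rfl fun r _ => ?_
    rw [binom_natCast, hL]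
    ring
  have h2 : ∀ r ∈ antidiagonal κ, binom s r.1 * altBinom (n + (r.2 : K)) (r.2 : K) *
      ((-1) ^ r.1 * altBinom (s + t - (r.1 : K)) ((J : K) - r.1)) = ∑ q ∈ antidiagonal J,
        (-1) ^ J * (binom s q.1 * (q.1.choose r.1 : K)) * binom t q.2 * binom (-1 - n) r.2 := by
    intro r _
    rw [← Finset.sum_mul, ← altBinom_sub_natCast, altBinom_add_natCast]
    ring
  rw [Finset.sum_congr rfl h1, Finset.sum_congr rfl h2, Finset.sum_comm]

/-- The pairs of elements of `ℕ × ℕ` with sum `κ`, componentwise. -/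
def antidiag₂ (κ : ℕ × ℕ) : Finset ((ℕ × ℕ) × (ℕ × ℕ)) :=
  antidiagonal κ.1 ×ˢ antidiagonal κ.2

omit [CharZero K] in
theorem sum_antidiag₂_mul {κ : ℕ × ℕ} (f g : ℕ × ℕ → K) :
    ∑ q ∈ antidiag₂ κ, f q.1 * g q.2 =
      (∑ q ∈ antidiagonal κ.1, f q) * ∑ q ∈ antidiagonal κ.2, g q := by
  rw [antidiag₂, Finset.sum_product, Finset.sum_mul_sum]

/-- The first components of a pair of decompositions. -/
def fstPair (q : (ℕ × ℕ) × (ℕ × ℕ)) : ℕ × ℕ := (q.1.1, q.2.1)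

/-- The second components of a pair of decompositions. -/
def sndPair (q : (ℕ × ℕ) × (ℕ × ℕ)) : ℕ × ℕ := (q.1.2, q.2.2)

theorem mem_antidiag₂ {κ : ℕ × ℕ} {q : (ℕ × ℕ) × (ℕ × ℕ)} :
    q ∈ antidiag₂ κ ↔ fstPair q + sndPair q = κ := by
  rw [antidiag₂, Finset.mem_product, mem_antidiagonal, mem_antidiagonal, Prod.ext_iff]
  rfl

/-- The product of the binomial coefficients of the components. -/
noncomputable def binom₂ (s : K × K) (j : ℕ × ℕ) : K := binom s.1 j.1 * binom s.2 j.2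

theorem sum_altBinom₂_expandZ (n s t : K × K) (κ L : ℕ × ℕ) :
    ∑ q ∈ antidiag₂ L, altBinom₂ (n - s + natPair (fstPair q) + natPair κ) (natPair κ) *
      (altBinom₂ s (natPair (fstPair q)) * altBinom₂ t (natPair (sndPair q))) =
    ∑ q ∈ antidiag₂ κ, binom₂ s (fstPair q) *
      altBinom₂ (n + natPair (sndPair q)) (natPair (sndPair q)) *
      altBinom₂ (s + t - natPair (fstPair q)) (natPair L) := by
  have h := congrArg₂ (· * ·) (sum_altBinom_expandZ n.1 s.1 t.1 κ.1 L.1)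
    (sum_altBinom_expandZ n.2 s.2 t.2 κ.2 L.2)
  simp only [← sum_antidiag₂_mul] at h
  refine Eq.trans (Finset.sum_congr rfl fun q _ => ?_)
    (h.trans (Finset.sum_congr rfl fun q _ => ?_))
  · simp only [altBinom₂, natPair, fstPair, sndPair, Prod.fst_add, Prod.snd_add, Prod.fst_sub,
      Prod.snd_sub]
    ring
  · simp only [altBinom₂, binom₂, natPair, fstPair, sndPair, Prod.fst_add, Prod.snd_add,
      Prod.fst_sub, Prod.snd_sub]
    ring

theorem sum_altBinom₂_expandW (n s t : K × K) (κ J : ℕ × ℕ) :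
    ∑ q ∈ antidiag₂ J, altBinom₂ (n - natPair (fstPair q) + natPair κ) (natPair κ) *
      (altBinom₂ s (natPair (fstPair q)) * altBinom₂ t (natPair (sndPair q))) =
    ∑ q ∈ antidiag₂ κ, binom₂ s (fstPair q) *
      altBinom₂ (n + natPair (sndPair q)) (natPair (sndPair q)) *
      ((-1) ^ ((fstPair q).1 + (fstPair q).2) *
        altBinom₂ (s + t - natPair (fstPair q)) (natPair J - natPair (fstPair q))) := by
  have h := congrArg₂ (· * ·) (sum_altBinom_expandW n.1 s.1 t.1 κ.1 J.1)
    (sum_altBinom_expandW n.2 s.2 t.2 κ.2 J.2)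
  simp only [← sum_antidiag₂_mul] at h
  refine Eq.trans (Finset.sum_congr rfl fun q _ => ?_)
    (h.trans (Finset.sum_congr rfl fun q _ => ?_))
  · simp only [altBinom₂, natPair, fstPair, sndPair, Prod.fst_add, Prod.snd_add, Prod.fst_sub,
      Prod.snd_sub]
    ring
  · simp only [altBinom₂, binom₂, natPair, fstPair, sndPair, Prod.fst_add, Prod.snd_add,
      Prod.fst_sub, Prod.snd_sub, pow_add]
    ring

end Identities

section ThreeVariables

variable {K : Type u} {V : Type v} [Field K] [CharZero K] [AddCommGroup V] [Module K V]

omit [CharZero K] in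
theorem ev_congr_right {D e : K × K} {ψ : K × K → K × K → K × K → K} {f g : K × K → K × K → V}
    (h : ∀ n m, n + m = D + e → f n m = g n m) : ev D ψ e f = ev D ψ e g := by
  refine finsum_congr fun t => ?_
  split_ifs with ht
  · rw [h _ _ ht]
  · rw [zero_smul, zero_smul]

omit [CharZero K] in
theorem DegFinite.sum_smul {τ : Type*} {S : Finset τ} {ρ : τ → K × K → K × K → K} {v : τ → V}
    (hρ : ∀ t ∈ S, DegFinite (ρ t)) : DegFinite fun n m => ∑ t ∈ S, ρ t n m • v t :=
  DegFinite.sum S fun t ht => (hρ t ht).map (LinearMap.toSpanSingleton K V (v t))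

omit [CharZero K] in
theorem ev_sum_smul {τ : Type*} {D e : K × K} (ψ : K × K → K × K → K × K → K) {S : Finset τ}
    {ρ : τ → K × K → K × K → K} {v : τ → V} (hρ : ∀ t ∈ S, DegFinite (ρ t)) :
    ev D ψ e (fun n m => ∑ t ∈ S, ρ t n m • v t) = ∑ t ∈ S, ev D ψ e (ρ t) • v t := by
  refine (ev_sum S ψ fun t ht =>
    (hρ t ht).map (LinearMap.toSpanSingleton K V (v t))).trans ?_
  exact Finset.sum_congr rfl fun t ht =>
    (map_ev ψ (hρ t ht) (LinearMap.toSpanSingleton K V (v t))).symm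

omit [CharZero K] [Module K V] in
theorem degFinite_of_eq {f : K × K → K × K → V}
    (h : ∀ d, ∃ g : K × K → K × K → V, DegFinite g ∧ ∀ n m, n + m = d → f n m = g n m) :
    DegFinite f := fun d => by
  obtain ⟨g, hg, hfg⟩ := h d
  exact (hg d).subset fun t ht => ⟨ht.1, fun h0 => ht.2 ((hfg _ _ ht.1).trans h0)⟩

omit [Module K V] in
theorem degFinite_of_natLE {f : K × K → K × K → V} (a b : K × K)
    (h : ∀ n k, f n k ≠ 0 → NatLE a n ∧ NatLE b k) : DegFinite f := by
  intro d
  refine ((finite_setOf_natLE a (d - b)).image fun n => (n, d - n)).subset ?_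
  rintro ⟨n, k⟩ ⟨rfl, hne⟩
  obtain ⟨h1, ⟨l, hl⟩⟩ := h n k hne
  exact ⟨n, ⟨h1, ⟨l, by dsimp only; rw [hl]; abel⟩⟩, by simp⟩

omit [Module K V] in
theorem degFinite_of_natLE' {f : K × K → K × K → V} (a b : K × K)
    (h : ∀ n k, f n k ≠ 0 → NatLE n a ∧ NatLE k b) : DegFinite f := by
  intro d
  refine ((finite_setOf_natLE (d - b) a).image fun n => (n, d - n)).subset ?_
  rintro ⟨n, k⟩ ⟨rfl, hne⟩
  obtain ⟨h1, ⟨l, hl⟩⟩ := h n k hne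
  exact ⟨n, ⟨⟨l, by dsimp only; rw [hl]; abel⟩, h1⟩, by simp⟩

omit [CharZero K] in
theorem finsum_antidiag₂ {β : Type*} {φ : (ℕ × ℕ) × (ℕ × ℕ) → β} (hφ : Function.Injective φ)
    (g : β → K) (L : ℕ × ℕ) (hg : ∀ b, g b ≠ 0 → ∃ l, φ l = b ∧ l.1 + l.2 = L) :
    ∑ᶠ b, g b = ∑ q ∈ antidiag₂ L, g (φ (fstPair q, sndPair q)) := by
  classical
  have hinj : Function.Injective fun q => φ (fstPair q, sndPair q) := by
    rintro ⟨⟨a, b⟩, ⟨c, d⟩⟩ ⟨⟨a', b'⟩, ⟨c', d'⟩⟩ h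
    have := hφ h
    simp only [fstPair, sndPair, Prod.mk.injEq] at this ⊢
    tauto
  rw [finsum_eq_sum_of_support_subset (s := (antidiag₂ L).image fun q => φ (fstPair q, sndPair q)),
    Finset.sum_image fun _ _ _ _ h => hinj h]
  intro b hb
  obtain ⟨⟨⟨a, b⟩, ⟨c, d⟩⟩, rfl, hl⟩ := hg b hb
  exact Finset.mem_coe.2 (Finset.mem_image.2 ⟨((a, c), (b, d)), mem_antidiag₂.2 hl, rfl⟩)

/-- A series in three variables is degreewise finite if it has finitely many coefficients in each
total degree. -/
def DegFinite₃ (F : K × K → K × K → K × K → V) : Prop :=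
  ∀ d, {t : (K × K) × (K × K) × (K × K) |
    t.1 + t.2.1 + t.2.2 = d ∧ F t.1 t.2.1 t.2.2 ≠ 0}.Finite

/-- The modes of `(z - x) ^ s (w - x) ^ t F(z, w, x)` at a fixed mode of `x`, expanded for
`z, w > x`. -/
noncomputable def sliceZ (s t : K × K) (F : K × K → K × K → K × K → V) (m n k : K × K) : V :=
  ∑ᶠ l : (ℕ × ℕ) × (ℕ × ℕ), (powCoeff s l.1 * powCoeff t l.2) •
    F (n + s - natPair l.1) (k + t - natPair l.2) (m + natPair l.1 + natPair l.2)

/-- The modes of `(z - x) ^ s (w - x) ^ t F(z, w, x)` at a fixed mode of `x`, expanded for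
`x > z, w`. -/
noncomputable def sliceW (s t : K × K) (F : K × K → K × K → K × K → V) (m n k : K × K) : V :=
  ∑ᶠ l : (ℕ × ℕ) × (ℕ × ℕ), ((statSign s * powCoeff s l.1) * (statSign t * powCoeff t l.2)) •
    F (n + natPair l.1) (k + natPair l.2) (m + (s - natPair l.1) + (t - natPair l.2))

/-- The modes of `∂_z^(i) F(z, w, x)` at `z = w`. -/
noncomputable def sliceDiag (i : ℕ × ℕ) (F : K × K → K × K → K × K → V) (p m : K × K) : V :=
  ∑ᶠ n : K × K, powCoeff n i • F (n - natPair i) (p - n - (1, 1)) m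

omit [CharZero K] in
theorem finsum_eq_sum_degree {F : K × K → K × K → K × K → V} (hF : DegFinite₃ F) {α : Type*}
    {d : K × K} {φ : α → (K × K) × (K × K) × (K × K)} (hφ : Function.Injective φ)
    (hdeg : ∀ a, (φ a).1 + (φ a).2.1 + (φ a).2.2 = d)
    (χ : (K × K) × (K × K) × (K × K) → K)
    (hχ : ∀ x, x.1 + x.2.1 + x.2.2 = d → χ x ≠ 0 → x ∈ Set.range φ) :
    ∑ᶠ a, χ (φ a) • F (φ a).1 (φ a).2.1 (φ a).2.2 =
      ∑ x ∈ (hF d).toFinset, χ x • F x.1 x.2.1 x.2.2 := by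
  classical
  let g : (K × K) × (K × K) × (K × K) → V := fun x =>
    if x.1 + x.2.1 + x.2.2 = d then χ x • F x.1 x.2.1 x.2.2 else 0
  have h1 : ∀ a, χ (φ a) • F (φ a).1 (φ a).2.1 (φ a).2.2 = g (φ a) := fun a =>
    (if_pos (hdeg a)).symm
  have h2 : ∀ x ∈ Function.support g, x.1 + x.2.1 + x.2.2 = d := fun x hx => by
    by_contra hc
    exact hx (if_neg hc)
  rw [finsum_congr h1, finsum_comp_injective hφ,
    finsum_eq_sum_of_support_subset (s := (hF d).toFinset)]
  · refine Finset.sum_congr rfl fun x hx => ?_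
    exact if_pos ((hF d).mem_toFinset.1 hx).1
  · intro x hx
    have hd := h2 x hx
    rw [Function.mem_support, show g x = _ from if_pos hd] at hx
    exact (hF d).mem_toFinset.2 ⟨hd, right_ne_zero_of_smul hx⟩
  · intro x hx
    have hd := h2 x hx
    rw [Function.mem_support, show g x = _ from if_pos hd] at hx
    exact hχ x hd (left_ne_zero_of_smul hx)

theorem sliceZ_eq_sum (s t : K × K) {F : K × K → K × K → K × K → V} (hF : DegFinite₃ F)
    (m n k : K × K) {d : K × K} (hd : n + k + m + s + t = d) :
    sliceZ s t F m n k = ∑ x ∈ (hF d).toFinset,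
      (altBinom₂ s (n - (x.1 - s)) * altBinom₂ t (k - (x.2.1 - t))) • F x.1 x.2.1 x.2.2 := by
  rw [← finsum_eq_sum_degree hF (φ := fun l : (ℕ × ℕ) × (ℕ × ℕ) => (n + s - natPair l.1,
    k + t - natPair l.2, m + natPair l.1 + natPair l.2)) (d := d)
    (χ := fun x => altBinom₂ s (n - (x.1 - s)) * altBinom₂ t (k - (x.2.1 - t)))]
  · refine finsum_congr fun l => ?_
    have e1 : n - (n + s - natPair l.1 - s) = natPair l.1 := by abel
    have e2 : k - (k + t - natPair l.2 - t) = natPair l.2 := by abel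
    dsimp only
    rw [e1, e2, powCoeff_eq_altBinom₂, powCoeff_eq_altBinom₂]
  · rintro ⟨a, b⟩ ⟨a', b'⟩ h
    simp only [Prod.mk.injEq, sub_right_inj] at h
    exact Prod.ext (natPair_injective h.1) (natPair_injective h.2.1)
  · intro l
    rw [← hd]
    dsimp only
    abel
  · rintro ⟨a, b, c⟩ hx hne
    obtain ⟨l, hl⟩ := exists_of_altBinom₂_ne_zero (left_ne_zero_of_mul hne)
    obtain ⟨l', hl'⟩ := exists_of_altBinom₂_ne_zero (right_ne_zero_of_mul hne)
    dsimp only at hl hl' hx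
    refine ⟨(l, l'), Prod.ext ?_ (Prod.ext ?_ ?_)⟩
    · dsimp only; rw [← hl]; abel
    · dsimp only; rw [← hl']; abel
    · dsimp only; rw [← hl, ← hl', eq_sub_of_add_eq' hx, ← hd]; abel

theorem sliceW_eq_sum {s t : K × K} (hs : IsStatistical s) (ht : IsStatistical t)
    {F : K × K → K × K → K × K → V} (hF : DegFinite₃ F)
    (m n k : K × K) {d : K × K} (hd : n + k + m + s + t = d) :
    sliceW s t F m n k = ∑ x ∈ (hF d).toFinset,
      ((intSign s * altBinom₂ s (x.1 - n)) * (intSign t * altBinom₂ t (x.2.1 - k))) •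
        F x.1 x.2.1 x.2.2 := by
  rw [← finsum_eq_sum_degree hF (φ := fun l : (ℕ × ℕ) × (ℕ × ℕ) => (n + natPair l.1,
    k + natPair l.2, m + (s - natPair l.1) + (t - natPair l.2))) (d := d) (χ := fun x =>
      (intSign s * altBinom₂ s (x.1 - n)) * (intSign t * altBinom₂ t (x.2.1 - k)))]
  · refine finsum_congr fun l => ?_
    dsimp only
    rw [add_sub_cancel_left, add_sub_cancel_left, powCoeff_eq_altBinom₂, powCoeff_eq_altBinom₂,
      intSign_of_isStatistical hs, intSign_of_isStatistical ht]
  · rintro ⟨a, b⟩ ⟨a', b'⟩ h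
    simp only [Prod.mk.injEq, add_right_inj] at h
    exact Prod.ext (natPair_injective h.1) (natPair_injective h.2.1)
  · intro l
    rw [← hd]
    dsimp only
    abel
  · rintro ⟨a, b, c⟩ hx hne
    obtain ⟨l, hl⟩ := exists_of_altBinom₂_ne_zero
      (right_ne_zero_of_mul (left_ne_zero_of_mul hne))
    obtain ⟨l', hl'⟩ := exists_of_altBinom₂_ne_zero
      (right_ne_zero_of_mul (right_ne_zero_of_mul hne))
    dsimp only at hl hl' hx
    refine ⟨(l, l'), Prod.ext ?_ (Prod.ext ?_ ?_)⟩
    · dsimp only; rw [← hl]; abel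
    · dsimp only; rw [← hl']; abel
    · dsimp only; rw [← hl, ← hl', eq_sub_of_add_eq' hx, ← hd]; abel

open Classical in
theorem sliceDiag_eq_sum (i : ℕ × ℕ) {F : K × K → K × K → K × K → V} (hF : DegFinite₃ F)
    (p m : K × K) {d : K × K} (hd : p + m - natPair i - (1, 1) = d) :
    sliceDiag i F p m = ∑ x ∈ (hF d).toFinset,
      (if x.2.2 = m then altBinom₂ (x.1 + natPair i) (natPair i) else 0) • F x.1 x.2.1 x.2.2 := by
  rw [← finsum_eq_sum_degree hF (φ := fun n : K × K => (n - natPair i, p - n - (1, 1), m)) (d := d)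
    (χ := fun x => if x.2.2 = m then altBinom₂ (x.1 + natPair i) (natPair i) else 0)]
  · refine finsum_congr fun n => ?_
    dsimp only
    rw [if_pos rfl, sub_add_cancel, powCoeff_eq_altBinom₂]
  · intro n n' h
    exact sub_left_injective (Prod.ext_iff.1 h).1
  · intro l
    rw [← hd]
    dsimp only
    abel
  · rintro ⟨a, b, c⟩ hx hne
    have hc : c = m := by
      by_contra hc
      exact hne (if_neg hc)
    dsimp only at hx
    refine ⟨a + natPair i, Prod.ext ?_ (Prod.ext ?_ hc.symm)⟩
    · dsimp only; rw [add_sub_cancel_right]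
    · have : b = d - a - c := by rw [← hx]; abel
      dsimp only
      rw [this, ← hd, hc]
      abel

theorem degFinite_coeffZ (s t : K × K) (x : (K × K) × (K × K) × (K × K)) : DegFinite fun n k =>
    altBinom₂ s (n - (x.1 - s)) * altBinom₂ t (k - (x.2.1 - t)) :=
  degFinite_of_natLE (x.1 - s) (x.2.1 - t) fun n k h => by
    obtain ⟨l, hl⟩ := exists_of_altBinom₂_ne_zero (left_ne_zero_of_mul h)
    obtain ⟨l', hl'⟩ := exists_of_altBinom₂_ne_zero (right_ne_zero_of_mul h)
    exact ⟨⟨l, by rw [← hl]; abel⟩, ⟨l', by rw [← hl']; abel⟩⟩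

theorem degFinite_coeffW (s t : K × K) (x : (K × K) × (K × K) × (K × K)) : DegFinite fun n k =>
    (intSign s * altBinom₂ s (x.1 - n)) * (intSign t * altBinom₂ t (x.2.1 - k)) :=
  degFinite_of_natLE' x.1 x.2.1 fun n k h => by
    obtain ⟨l, hl⟩ := exists_of_altBinom₂_ne_zero (right_ne_zero_of_mul (left_ne_zero_of_mul h))
    obtain ⟨l', hl'⟩ := exists_of_altBinom₂_ne_zero (right_ne_zero_of_mul (right_ne_zero_of_mul h))
    exact ⟨⟨l, by rw [← hl]; abel⟩, ⟨l', by rw [← hl']; abel⟩⟩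

theorem degFinite_sliceZ (s t : K × K) {F : K × K → K × K → K × K → V} (hF : DegFinite₃ F)
    (m : K × K) : DegFinite (sliceZ s t F m) :=
  degFinite_of_eq fun d => ⟨_, DegFinite.sum_smul (fun x _ => degFinite_coeffZ s t x),
    fun n k hnk => sliceZ_eq_sum s t hF m n k (d := d + m + s + t) (by rw [hnk])⟩

theorem degFinite_sliceW {s t : K × K} (hs : IsStatistical s) (ht : IsStatistical t)
    {F : K × K → K × K → K × K → V} (hF : DegFinite₃ F) (m : K × K) :
    DegFinite (sliceW s t F m) :=
  degFinite_of_eq fun d => ⟨_, DegFinite.sum_smul (fun x _ => degFinite_coeffW s t x),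
    fun n k hnk => sliceW_eq_sum hs ht hF m n k (d := d + m + s + t) (by rw [hnk])⟩

theorem ev_taylorFun_coeffZ (s t e N : K × K) (κ : ℕ × ℕ) (hκ : -e - N = natPair κ)
    (D m : K × K) (x : (K × K) × (K × K) × (K × K))
    (hx : x.1 + x.2.1 + x.2.2 = D + e + m + s + t) :
    (ev D (taylorFun N) e fun n k =>
      altBinom₂ s (n - (x.1 - s)) * altBinom₂ t (k - (x.2.1 - t))) =
    ∑ q ∈ antidiag₂ κ, binom₂ s (fstPair q) *
      altBinom₂ (x.1 + natPair (sndPair q)) (natPair (sndPair q)) *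
      altBinom₂ (s + t - natPair (fstPair q)) (x.2.2 - m) := by
  obtain ⟨a, b, c⟩ := x
  dsimp only at hx ⊢
  have hshift : ∀ n, n - e - N = n + natPair κ := fun n => by rw [← hκ]; abel
  by_cases hL : ∃ L : ℕ × ℕ, c - m = natPair L
  · obtain ⟨L, hL⟩ := hL
    rw [hL, ← sum_altBinom₂_expandZ, ev, finsum_antidiag₂
      (φ := fun l : (ℕ × ℕ) × (ℕ × ℕ) => (a - s + natPair l.1, b - t + natPair l.2)) _ _ L]
    · refine Finset.sum_congr rfl fun q hq => ?_
      have hq' := congrArg (natPair (K := K)) (mem_antidiag₂.1 hq)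
      rw [natPair_add] at hq'
      rw [if_pos, taylorFun, hκ, hshift, add_sub_cancel_left, add_sub_cancel_left, smul_eq_mul]
      dsimp only
      have h1 : D + e = a + b + c - m - s - t := by rw [hx]; abel
      have h2 : natPair (sndPair q) = c - m - natPair (fstPair q) := by rw [hL, ← hq']; abel
      rw [h1, h2]
      abel
    · rintro ⟨n, k⟩ hne
      have hd : n + k = D + e := by
        by_contra hc
        exact hne (by rw [if_neg hc, zero_smul])
      have hne' := right_ne_zero_of_smul hne
      obtain ⟨l, hl⟩ := exists_of_altBinom₂_ne_zero (left_ne_zero_of_mul hne')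
      obtain ⟨l', hl'⟩ := exists_of_altBinom₂_ne_zero (right_ne_zero_of_mul hne')
      refine ⟨(l, l'), Prod.ext ?_ ?_, natPair_injective (K := K) ?_⟩
      · dsimp only; rw [← hl]; abel
      · dsimp only; rw [← hl']; abel
      · dsimp only
        have h1 : k = D + e - n := eq_sub_of_add_eq' hd
        have h2 : D + e = a + b + c - m - s - t := by rw [hx]; abel
        rw [natPair_add, ← hl, ← hl', ← hL]
        dsimp only
        rw [h1, h2]
        abel
    · rintro ⟨l, l'⟩ ⟨r, r'⟩ h
      simp only [Prod.mk.injEq, add_right_inj] at h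
      exact Prod.ext (natPair_injective h.1) (natPair_injective h.2)
  · have h0 : ∀ h, altBinom₂ h (c - m) = 0 := fun h => by
      by_contra hne
      exact hL (exists_of_altBinom₂_ne_zero hne)
    simp only [h0, mul_zero, Finset.sum_const_zero]
    rw [ev, finsum_eq_zero_of_forall_eq_zero]
    rintro ⟨n, k⟩
    by_contra hne
    have hd : n + k = D + e := by
      by_contra hc
      exact hne (by rw [if_neg hc, zero_smul])
    have hne' := right_ne_zero_of_smul hne
    obtain ⟨l, hl⟩ := exists_of_altBinom₂_ne_zero (left_ne_zero_of_mul hne')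
    obtain ⟨l', hl'⟩ := exists_of_altBinom₂_ne_zero (right_ne_zero_of_mul hne')
    refine hL ⟨l + l', ?_⟩
    have h1 : k = D + e - n := eq_sub_of_add_eq' hd
    have h2 : D + e = a + b + c - m - s - t := by rw [hx]; abel
    rw [natPair_add, ← hl, ← hl']
    dsimp only
    rw [h1, h2]
    abel

theorem ev_taylorFun_coeffW {s t : K × K} (hs : IsStatistical s) (ht : IsStatistical t)
    (e N : K × K) (κ : ℕ × ℕ) (hκ : -e - N = natPair κ)
    (D m : K × K) (x : (K × K) × (K × K) × (K × K))
    (hx : x.1 + x.2.1 + x.2.2 = D + e + m + s + t) :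
    (ev D (taylorFun N) e fun n k =>
      (intSign s * altBinom₂ s (x.1 - n)) * (intSign t * altBinom₂ t (x.2.1 - k))) =
    ∑ q ∈ antidiag₂ κ, binom₂ s (fstPair q) *
      altBinom₂ (x.1 + natPair (sndPair q)) (natPair (sndPair q)) *
      (intSign (s + t - natPair (fstPair q)) *
        altBinom₂ (s + t - natPair (fstPair q)) (m + s + t - x.2.2 - natPair (fstPair q))) := by
  obtain ⟨a, b, c⟩ := x
  dsimp only at hx ⊢
  have hshift : ∀ n, n - e - N = n + natPair κ := fun n => by rw [← hκ]; abel
  have hsgn : ∀ j : ℕ × ℕ, intSign (s + t - natPair j) =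
      intSign s * intSign t * (-1) ^ (j.1 + j.2) := fun j => by
    have h1 := intSign_add_natPair (s + t - natPair j) j
    rw [sub_add_cancel, intSign_add hs ht] at h1
    rw [h1, mul_assoc, ← pow_add, Even.neg_one_pow ⟨_, rfl⟩, mul_one]
  by_cases hJ : ∃ J : ℕ × ℕ, m + s + t - c = natPair J
  · obtain ⟨J, hJ⟩ := hJ
    have hid := congrArg (intSign s * intSign t * ·) (sum_altBinom₂_expandW a s t κ J)
    simp only [Finset.mul_sum] at hid
    rw [hJ, ev, finsum_antidiag₂
      (φ := fun l : (ℕ × ℕ) × (ℕ × ℕ) => (a - natPair l.1, b - natPair l.2)) _ _ J]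
    · refine Eq.trans (Finset.sum_congr rfl fun q hq => ?_)
        (hid.trans (Finset.sum_congr rfl fun q _ => ?_))
      · have hq' := congrArg (natPair (K := K)) (mem_antidiag₂.1 hq)
        rw [natPair_add] at hq'
        rw [if_pos, taylorFun, hκ, hshift, sub_sub_cancel, sub_sub_cancel, smul_eq_mul]
        · ring
        · dsimp only
          have h1 : D + e = a + b + c - m - s - t := by rw [hx]; abel
          have h2 : natPair (sndPair q) = m + s + t - c - natPair (fstPair q) := by
            rw [hJ, ← hq']; abel
          rw [h1, h2]
          abel
      · rw [hsgn]
        ring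
    · rintro ⟨n, k⟩ hne
      have hd : n + k = D + e := by
        by_contra hc
        exact hne (by rw [if_neg hc, zero_smul])
      have hne' := right_ne_zero_of_smul hne
      obtain ⟨l, hl⟩ := exists_of_altBinom₂_ne_zero
        (right_ne_zero_of_mul (left_ne_zero_of_mul hne'))
      obtain ⟨l', hl'⟩ := exists_of_altBinom₂_ne_zero
        (right_ne_zero_of_mul (right_ne_zero_of_mul hne'))
      refine ⟨(l, l'), Prod.ext ?_ ?_, natPair_injective (K := K) ?_⟩
      · dsimp only; rw [← hl]; abel
      · dsimp only; rw [← hl']; abel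
      · dsimp only
        have h1 : k = D + e - n := eq_sub_of_add_eq' hd
        have h2 : D + e = a + b + c - m - s - t := by rw [hx]; abel
        rw [natPair_add, ← hl, ← hl', ← hJ]
        dsimp only
        rw [h1, h2]
        abel
    · rintro ⟨l, l'⟩ ⟨r, r'⟩ h
      simp only [Prod.mk.injEq, sub_right_inj] at h
      exact Prod.ext (natPair_injective h.1) (natPair_injective h.2)
  · have h0 : ∀ (h : K × K) (j : ℕ × ℕ), altBinom₂ h (m + s + t - c - natPair j) = 0 := fun h j => by
      by_contra hne
      obtain ⟨l, hl⟩ := exists_of_altBinom₂_ne_zero hne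
      exact hJ ⟨l + j, by rw [natPair_add, ← hl]; abel⟩
    simp only [h0, mul_zero, Finset.sum_const_zero]
    rw [ev, finsum_eq_zero_of_forall_eq_zero]
    rintro ⟨n, k⟩
    by_contra hne
    have hd : n + k = D + e := by
      by_contra hc
      exact hne (by rw [if_neg hc, zero_smul])
    have hne' := right_ne_zero_of_smul hne
    obtain ⟨l, hl⟩ := exists_of_altBinom₂_ne_zero
      (right_ne_zero_of_mul (left_ne_zero_of_mul hne'))
    obtain ⟨l', hl'⟩ := exists_of_altBinom₂_ne_zero
      (right_ne_zero_of_mul (right_ne_zero_of_mul hne'))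
    refine hJ ⟨l + l', ?_⟩
    have h1 : k = D + e - n := eq_sub_of_add_eq' hd
    have h2 : D + e = a + b + c - m - s - t := by rw [hx]; abel
    rw [natPair_add, ← hl, ← hl']
    dsimp only
    rw [h1, h2]
    abel

end ThreeVariables

end OPEAlg

namespace OPEAlg

open Finset.HasAntidiagonal

section Residues

variable {K : Type u} {V : Type v} [Field K] [CharZero K] [AddCommGroup V] [Module K V]

omit [CharZero K] in
theorem degFinite_single (c : K × K) (r : K) :
    DegFinite (open Classical in fun _ m : K × K => if c = m then r else 0) := by
  intro d
  refine (Set.finite_singleton (d - c, c)).subset ?_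
  rintro ⟨n, m⟩ ⟨hd, hne⟩
  have hc : c = m := by
    by_contra hc
    exact hne (if_neg hc)
  exact Prod.ext (by dsimp only; rw [hc]; exact eq_sub_of_add_eq hd) hc.symm

omit [CharZero K] in
theorem ev_single (D e c : K × K) (r : K) (ψ : K × K → K × K → K × K → K) :
    ev D ψ e (open Classical in fun _ m : K × K => if c = m then r else 0) =
      ψ (D + e - c) c e * r := by
  rw [ev, finsum_eq_single _ (D + e - c, c)]
  · rw [if_pos (by dsimp only; abel), if_pos rfl, smul_eq_mul]
  · rintro ⟨n, m⟩ hne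
    split_ifs with h1 h2
    · exact absurd (Prod.ext (by dsimp only at h1 ⊢; rw [← h1, h2]; abel) h2.symm) hne
    all_goals simp

theorem sum_ev_sliceDiag {F : K × K → K × K → K × K → V} (hF : DegFinite₃ F) (s u D d : K × K)
    (κ : ℕ × ℕ) (ψ : K × K → K × K → K × K → K) (hd : D + u - natPair κ - (1, 1) = d) :
    ∑ q ∈ antidiag₂ κ, ev D ψ (u - natPair (fstPair q))
      (fun p m => binom₂ s (fstPair q) • sliceDiag (sndPair q) F p m) =
    ∑ x ∈ (hF d).toFinset, (∑ q ∈ antidiag₂ κ, binom₂ s (fstPair q) *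
      altBinom₂ (x.1 + natPair (sndPair q)) (natPair (sndPair q)) *
      ψ (D + (u - natPair (fstPair q)) - x.2.2) x.2.2 (u - natPair (fstPair q))) •
        F x.1 x.2.1 x.2.2 := by
  classical
  simp only [Finset.sum_smul]
  rw [Finset.sum_comm]
  refine Finset.sum_congr rfl fun q hq => ?_
  have hq' := congrArg (natPair (K := K)) (mem_antidiag₂.1 hq)
  rw [natPair_add] at hq'
  rw [ev_congr_right (g := fun p m => ∑ x ∈ (hF d).toFinset,
    (if x.2.2 = m then binom₂ s (fstPair q) *
      altBinom₂ (x.1 + natPair (sndPair q)) (natPair (sndPair q)) else 0) • F x.1 x.2.1 x.2.2),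
    ev_sum_smul ψ fun x _ => degFinite_single _ _]
  · refine Finset.sum_congr rfl fun x _ => ?_
    rw [ev_single, mul_comm]
  · intro p m hpm
    refine (congrArg (binom₂ s (fstPair q) • ·) (sliceDiag_eq_sum (sndPair q) hF p m (d := d)
      (by rw [hpm, ← hd, ← hq']; abel))).trans (Finset.smul_sum.trans ?_)
    refine Finset.sum_congr rfl fun x _ => ?_
    rw [smul_smul, mul_ite, mul_zero]

/-- The coefficients of the OPE of `(z - w) ^ e (z - x) ^ s (w - x) ^ t F(z, w, x)` for `z, w > x`
are sums of powers of `w - x` times derivatives of `F` at `z = w`. -/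
theorem ev_taylorFun_sliceZ {F : K × K → K × K → K × K → V} (hF : DegFinite₃ F)
    (s t e N p m : K × K) (κ : ℕ × ℕ) (hκ : -e - N = natPair κ) :
    ev (p + N - (1, 1)) (taylorFun N) e (sliceZ s t F m) =
      ∑ q ∈ antidiag₂ κ, ev (p + m) (expandZ m) (s + t - natPair (fstPair q))
        (fun p m => binom₂ s (fstPair q) • sliceDiag (sndPair q) F p m) := by
  have hd : p + m + (s + t) - natPair κ - (1, 1) = p + N - (1, 1) + e + m + s + t := by
    rw [← hκ]; abel
  rw [sum_ev_sliceDiag hF s _ _ _ _ _ hd, ev_congr_right fun n k hnk =>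
    sliceZ_eq_sum s t hF m n k (d := p + N - (1, 1) + e + m + s + t) (by rw [hnk]),
    ev_sum_smul _ fun x _ => degFinite_coeffZ s t x]
  refine Finset.sum_congr rfl fun x hx => ?_
  rw [ev_taylorFun_coeffZ s t e N κ hκ _ m x ((hF _).mem_toFinset.1 hx).1]
  rfl

/-- The analogue of `ev_taylorFun_sliceZ` for `x > z, w`. -/
theorem ev_taylorFun_sliceW {F : K × K → K × K → K × K → V} (hF : DegFinite₃ F)
    {s t : K × K} (hs : IsStatistical s) (ht : IsStatistical t)
    (e N p m : K × K) (κ : ℕ × ℕ) (hκ : -e - N = natPair κ) :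
    ev (p + N - (1, 1)) (taylorFun N) e (sliceW s t F m) =
      ∑ q ∈ antidiag₂ κ, ev (p + m) (expandW p) (s + t - natPair (fstPair q))
        (fun p m => binom₂ s (fstPair q) • sliceDiag (sndPair q) F p m) := by
  have hd : p + m + (s + t) - natPair κ - (1, 1) = p + N - (1, 1) + e + m + s + t := by
    rw [← hκ]; abel
  rw [sum_ev_sliceDiag hF s _ _ _ _ _ hd, ev_congr_right fun n k hnk =>
    sliceW_eq_sum hs ht hF m n k (d := p + N - (1, 1) + e + m + s + t) (by rw [hnk]),
    ev_sum_smul _ fun x _ => degFinite_coeffW s t x]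
  refine Finset.sum_congr rfl fun x hx => ?_
  rw [ev_taylorFun_coeffW hs ht e N κ hκ _ m x ((hF _).mem_toFinset.1 hx).1]
  congr 1
  refine Finset.sum_congr rfl fun q _ => ?_
  rw [expandW]
  have : p + m + (s + t - natPair (fstPair q)) - x.2.2 - p =
    m + s + t - x.2.2 - natPair (fstPair q) := by abel
  rw [this]

open Classical in
/-- The decompositions of the pair of natural numbers `c`, if it is one. -/
noncomputable def decompositions (c : K × K) : Finset ((ℕ × ℕ) × (ℕ × ℕ)) :=
  if h : ∃ κ : ℕ × ℕ, c = natPair κ then antidiag₂ h.choose else ∅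

omit [CharZero K] in
theorem ev_taylorFun_eq_zero {e N : K × K} (h : ¬ ∃ κ : ℕ × ℕ, -e - N = natPair κ) (D : K × K)
    (f : K × K → K × K → V) : ev D (taylorFun N) e f = 0 := by
  have h0 : ∀ n m, taylorFun N n m e = 0 := fun n m => by
    by_contra hne
    exact h (exists_of_altBinom₂_ne_zero hne)
  simp [ev, h0]

theorem ev_taylorFun_sliceZ' {F : K × K → K × K → K × K → V} (hF : DegFinite₃ F)
    (s t e N p m : K × K) :
    ev (p + N - (1, 1)) (taylorFun N) e (sliceZ s t F m) =
      ∑ q ∈ decompositions (-e - N), ev (p + m) (expandZ m) (s + t - natPair (fstPair q))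
        (fun p m => binom₂ s (fstPair q) • sliceDiag (sndPair q) F p m) := by
  rw [decompositions]
  split_ifs with h
  · exact ev_taylorFun_sliceZ hF s t e N p m _ h.choose_spec
  · rw [ev_taylorFun_eq_zero h, Finset.sum_empty]

theorem ev_taylorFun_sliceW' {F : K × K → K × K → K × K → V} (hF : DegFinite₃ F)
    {s t : K × K} (hs : IsStatistical s) (ht : IsStatistical t) (e N p m : K × K) :
    ev (p + N - (1, 1)) (taylorFun N) e (sliceW s t F m) =
      ∑ q ∈ decompositions (-e - N), ev (p + m) (expandW p) (s + t - natPair (fstPair q))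
        (fun p m => binom₂ s (fstPair q) • sliceDiag (sndPair q) F p m) := by
  rw [decompositions]
  split_ifs with h
  · exact ev_taylorFun_sliceW hF hs ht e N p m _ h.choose_spec
  · rw [ev_taylorFun_eq_zero h, Finset.sum_empty]

end Residues

end OPEAlg

namespace OPEAlg

section TripleIndex

/-- The pair of the first and the second of three indices. -/
def pair₀₁ : IdxPair 3 := ⟨(0, 1), by decide⟩

/-- The pair of the first and the third of three indices. -/
def pair₀₂ : IdxPair 3 := ⟨(0, 2), by decide⟩

/-- The pair of the second and the third of three indices. -/
def pair₁₂ : IdxPair 3 := ⟨(1, 2), by decide⟩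

theorem univ_idxPair_three : (Finset.univ : Finset (IdxPair 3)) = {pair₀₁, pair₀₂, pair₁₂} := by
  decide

theorem prod_idxPair_three {M : Type*} [CommMonoid M] (f : IdxPair 3 → M) :
    ∏ p, f p = f pair₀₁ * (f pair₀₂ * f pair₁₂) := by
  rw [univ_idxPair_three, Finset.prod_insert (by decide), Finset.prod_insert (by decide),
    Finset.prod_singleton]

theorem sum_idxPair_three {M : Type*} [AddCommMonoid M] (f : IdxPair 3 → M) :
    ∑ p, f p = f pair₀₁ + (f pair₀₂ + f pair₁₂) := by
  rw [univ_idxPair_three, Finset.sum_insert (by decide), Finset.sum_insert (by decide),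
    Finset.sum_singleton]

/-- Families indexed by the pairs of three indices are triples. -/
def idxPairEquiv (X : Type*) : (IdxPair 3 → X) ≃ X × (X × X) where
  toFun k := (k pair₀₁, k pair₀₂, k pair₁₂)
  invFun t p := if p = pair₀₁ then t.1 else if p = pair₀₂ then t.2.1 else t.2.2
  left_inv k := by
    funext p
    have : ∀ p : IdxPair 3, p = pair₀₁ ∨ p = pair₀₂ ∨ p = pair₁₂ := by decide
    have h1 : pair₀₂ ≠ pair₀₁ := by decide
    have h2 : pair₁₂ ≠ pair₀₁ := by decide
    have h3 : pair₁₂ ≠ pair₀₂ := by decide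
    rcases this p with rfl | rfl | rfl <;> simp [h1, h2, h3]
  right_inv t := by
    have h1 : pair₀₂ ≠ pair₀₁ := by decide
    have h2 : pair₁₂ ≠ pair₀₁ := by decide
    have h3 : pair₁₂ ≠ pair₀₂ := by decide
    simp [h1, h2, h3]

/-- The permutation moving the third of three indices to the front. -/
def thirdFirst : Equiv.Perm (Fin 3) where
  toFun := ![2, 0, 1]
  invFun := ![1, 2, 0]
  left_inv := by decide
  right_inv := by decide

end TripleIndex

section TriplePowers

variable {K : Type u} {V : Type v} [Field K] [CharZero K] [AddCommGroup V] [Module K V]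

theorem IsFieldN.degFinite₃ {c : DistrN K V 3} (hc : IsFieldN c) (x : V) :
    DegFinite₃ fun n k m => c ![n, k, m] x := by
  intro d
  obtain ⟨S, hS⟩ := hc x
  refine (S.finite_toSet.biUnion fun h _ =>
    ((finite_setOf_natLE (d - h 1 - h 2) (h 0)).prod
      (finite_setOf_natLE (d - h 0 - h 2) (h 1))).image
        fun t => (t.1, t.2, d - t.1 - t.2)).subset ?_
  rintro ⟨n, k, m⟩ ⟨rfl, hne⟩
  obtain ⟨h, hh, hle⟩ := hS _ hne
  have h0 : NatLE n (h 0) := hle 0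
  have h1 : NatLE k (h 1) := hle 1
  have h2 : NatLE m (h 2) := hle 2
  simp only [Set.mem_iUnion, Set.mem_image]
  refine ⟨h, hh, (n, k), ⟨⟨?_, h0⟩, ⟨?_, h1⟩⟩, ?_⟩
  · obtain ⟨i, hi⟩ := h1
    obtain ⟨j, hj⟩ := h2
    exact ⟨i + j, by rw [natPair_add, hi, hj]; dsimp only; abel⟩
  · obtain ⟨i, hi⟩ := h0
    obtain ⟨j, hj⟩ := h2
    exact ⟨i + j, by rw [natPair_add, hi, hj]; dsimp only; abel⟩
  · refine Prod.ext rfl (Prod.ext rfl ?_)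
    dsimp only
    abel

omit [CharZero K] in
theorem finsum_triple {F : K × K → K × K → K × K → V} (hF : DegFinite₃ F) {d : K × K}
    (φ : (ℕ × ℕ) × ((ℕ × ℕ) × (ℕ × ℕ)) → (K × K) × (K × K) × (K × K))
    (hdeg : ∀ k, (φ k).1 + (φ k).2.1 + (φ k).2.2 = d)
    (hφ : ∀ k k', φ k = φ k' → k ≤ (k'.1 + k'.2.1 + k'.2.2, k'.2.1 + k'.2.2, k'.2.1 + k'.2.2))
    (r : ℕ × ℕ → K) (r' : (ℕ × ℕ) × (ℕ × ℕ) → K) :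
    ∑ᶠ k : (ℕ × ℕ) × ((ℕ × ℕ) × (ℕ × ℕ)),
      (r k.1 * r' k.2) • F (φ k).1 (φ k).2.1 (φ k).2.2 =
    ∑ᶠ i, r i • ∑ᶠ l, r' l • F (φ (i, l)).1 (φ (i, l)).2.1 (φ (i, l)).2.2 := by
  rw [finsum_curry]
  · simp only [mul_smul, smul_finsum]
  · refine ((hF d).preimage' fun b _ => ?_ : (φ ⁻¹' _).Finite).subset fun k hk =>
      ⟨hdeg k, right_ne_zero_of_smul hk⟩
    rcases (φ ⁻¹' {b}).eq_empty_or_nonempty with h | ⟨k', hk'⟩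
    · rw [h]
      exact Set.finite_empty
    · exact (Set.finite_Iic _).subset fun k hk => hφ k k' (hk.trans hk'.symm)

omit [CharZero K] in
theorem expShift_one {r : ℕ} (p : IdxPair r) (e : K × K) (k : ℕ × ℕ) :
    expShift 1 p e k = Pi.single p.1.1 (e - natPair k) + Pi.single p.1.2 (natPair k) :=
  if_pos p.2

theorem mulPows_one_eq_mulPow {f : (Fin 3 → K × K) → V}
    (hf : DegFinite₃ fun n k m => f ![n, k, m]) (e : IdxPair 3 → K × K) (n k m : K × K) :
    mulPows 1 e f ![n, k, m] =
      mulPow (e pair₀₁) (sliceZ (e pair₀₂) (e pair₁₂) (fun n k m => f ![n, k, m]) m) n k := by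
  have h := finsum_triple hf (d := n + k + m + e pair₀₁ + e pair₀₂ + e pair₁₂)
    (fun j => (n + e pair₀₁ - natPair j.1 + e pair₀₂ - natPair j.2.1,
      k + natPair j.1 + e pair₁₂ - natPair j.2.2, m + natPair j.2.1 + natPair j.2.2))
    (fun j => by dsimp only; abel) ?_ (powCoeff (e pair₀₁))
    (fun l => powCoeff (e pair₀₂) l.1 * powCoeff (e pair₁₂) l.2)
  · rw [mulPow]
    simp only [sliceZ]
    rw [← h, mulPows, ← finsum_comp_equiv (idxPairEquiv (ℕ × ℕ))]
    refine finsum_congr fun j => ?_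
    rw [prod_idxPair_three, sum_idxPair_three]
    congr 2
    funext i
    fin_cases i
    · simp [expShift_one, pair₀₁, pair₀₂, pair₁₂, idxPairEquiv]
      abel
    · simp [expShift_one, pair₀₁, pair₀₂, pair₁₂, idxPairEquiv]
      abel
    · simp [expShift_one, pair₀₁, pair₀₂, pair₁₂, idxPairEquiv]
      abel
  · rintro ⟨i, l, l'⟩ ⟨j, q, q'⟩ heq
    simp only [Prod.mk.injEq, add_assoc, add_right_inj, ← natPair_add] at heq
    obtain ⟨h1, -, h3⟩ := heq
    have h3' := natPair_injective h3
    have h1' : natPair (K := K) (i + l) = natPair (j + q) := by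
      rw [natPair_add, natPair_add]
      linear_combination (exp := 1) -h1
    have h1'' := natPair_injective h1'
    simp only [Prod.ext_iff, Prod.fst_add, Prod.snd_add] at h1'' h3'
    refine ⟨⟨?_, ?_⟩, ⟨?_, ?_⟩, ⟨?_, ?_⟩⟩ <;> simp <;> omega

theorem mulPows_thirdFirst_eq_mulPow {f : (Fin 3 → K × K) → V}
    (hf : DegFinite₃ fun n k m => f ![n, k, m]) (e : IdxPair 3 → K × K) (n k m : K × K) :
    mulPows thirdFirst e f ![n, k, m] =
      mulPow (e pair₀₁) (sliceW (e pair₀₂) (e pair₁₂) (fun n k m => f ![n, k, m]) m) n k := by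
  have h := finsum_triple hf (d := n + k + m + e pair₀₁ + e pair₀₂ + e pair₁₂)
    (fun j => (n + e pair₀₁ - natPair j.1 + natPair j.2.1,
      k + natPair j.1 + natPair j.2.2,
      m + (e pair₀₂ - natPair j.2.1) + (e pair₁₂ - natPair j.2.2)))
    (fun j => by dsimp only; abel) ?_ (powCoeff (e pair₀₁))
    (fun l => (statSign (e pair₀₂) * powCoeff (e pair₀₂) l.1) *
      (statSign (e pair₁₂) * powCoeff (e pair₁₂) l.2))
  · rw [mulPow]
    simp only [sliceW]
    rw [← h, mulPows, ← finsum_comp_equiv (idxPairEquiv (ℕ × ℕ))]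
    refine finsum_congr fun j => ?_
    rw [prod_idxPair_three, sum_idxPair_three]
    congr 2
    funext i
    fin_cases i
    · simp [expShift, pair₀₁, pair₀₂, pair₁₂, idxPairEquiv, thirdFirst]
      abel
    · simp [expShift, pair₀₁, pair₀₂, pair₁₂, idxPairEquiv, thirdFirst]
      abel
    · simp [expShift, pair₀₁, pair₀₂, pair₁₂, idxPairEquiv, thirdFirst]
      abel
  · rintro ⟨i, l, l'⟩ ⟨j, q, q'⟩ heq
    simp only [Prod.mk.injEq] at heq
    obtain ⟨-, h2, h3⟩ := heq
    have h3' : natPair (K := K) (l + l') = natPair (q + q') := by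
      rw [natPair_add, natPair_add]
      linear_combination (exp := 1) -h3
    have h2' : natPair (K := K) (i + l') = natPair (j + q') := by
      rw [natPair_add, natPair_add]
      linear_combination (exp := 1) h2
    have h3'' := natPair_injective h3'
    have h2'' := natPair_injective h2'
    simp only [Prod.ext_iff, Prod.fst_add, Prod.snd_add] at h2'' h3''
    refine ⟨⟨?_, ?_⟩, ⟨?_, ?_⟩, ⟨?_, ?_⟩⟩ <;> simp <;> omega

end TriplePowers

end OPEAlg

namespace OPEAlg

open SuperSpace

section TripleProducts

variable {K : Type u} {V : Type v} [Field K] [AddCommGroup V] [Module K V] [SuperSpace K V]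

theorem sum_fin_three {X M : Type*} [Fintype X] [AddCommMonoid M] (g : X → X → X → M) :
    ∑ p : Fin 3 → X, g (p 0) (p 1) (p 2) = ∑ i, ∑ j, ∑ k, g i j k := by
  rw [← Fintype.sum_prod_type' fun i j => ∑ k, g i j k]
  rw [← Fintype.sum_prod_type' fun (t : X × X) k => g t.1 t.2 k]
  refine Fintype.sum_equiv ⟨fun p => ((p 0, p 1), p 2), fun t => ![t.1.1, t.1.2, t.2],
    fun p => ?_, fun t => rfl⟩ _ _ fun _ => rfl
  funext i
  fin_cases i <;> rfl

theorem superProd_one_eq (a b d : Distr K V) (n k m : K × K) :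
    superProd 1 ![a, b, d] ![n, k, m] = a n * (b k * d m) := by
  have h : ∀ p : Fin 3 → ZMod 2, koszulSign 1 p = 1 := fun p =>
    Finset.prod_eq_one fun q _ => if_neg (not_lt.2 q.2.le)
  have h' : ∀ p : Fin 3 → ZMod 2, koszulSign 1 p • (List.ofFn fun i =>
      opPart K (p ((1 : Equiv.Perm (Fin 3)) i)) (![a, b, d] ((1 : Equiv.Perm (Fin 3)) i)
        (![n, k, m] ((1 : Equiv.Perm (Fin 3)) i)))).prod =
      opPart K (p 0) (a n) * (opPart K (p 1) (b k) * opPart K (p 2) (d m)) := fun p => by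
    rw [h, one_smul]
    simp [List.ofFn_succ]
  rw [superProd, Finset.sum_congr rfl fun p _ => h' p, sum_fin_three fun i j l =>
    opPart K i (a n) * (opPart K j (b k) * opPart K l (d m))]
  simp only [← Finset.mul_sum, ← Finset.sum_mul, sum_opPart]

/-- The linear map with `superSwap a b n m x = ∑ᵣ swapPart r (b m) (a n xᵣ)`. -/
noncomputable def swapPart (r : ZMod 2) (g : Module.End K V) : Module.End K V :=
  ∑ p : ZMod 2, ∑ q : ZMod 2, superSign p q • (opPart K q g * proj K (p + r))

theorem superSwap_eq_sum_swapPart (a b : Distr K V) (n m : K × K) (x : V) :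
    superSwap a b n m x = ∑ r, swapPart r (b m) (a n (proj K r x)) := by
  simp only [superSwap, swapPart, LinearMap.sum_apply, LinearMap.smul_apply, Module.End.mul_apply,
    opPart_apply (x := x), map_sum, Finset.smul_sum]
  rw [Finset.sum_comm]
  refine Eq.trans (Finset.sum_congr rfl fun q _ => Finset.sum_comm) ?_
  rw [Finset.sum_comm]
  exact Finset.sum_congr rfl fun r _ => Finset.sum_comm

theorem superProd_thirdFirst_eq (a b d : Distr K V) (n k m : K × K) (x : V) :
    superProd thirdFirst ![a, b, d] ![n, k, m] x =
      ∑ r, swapPart r (d m) (a n (b k (proj K r x))) := by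
  have h : ∀ p : Fin 3 → ZMod 2, koszulSign thirdFirst p =
      superSign (p 0 + p 1) (p 2) := fun p => by
    have hs : ∀ i j l : ZMod 2, superSign l i * (superSign l j * 1) = superSign (i + j) l := by
      decide
    rw [koszulSign, prod_idxPair_three, ← hs]
    rfl
  have h' : ∀ p : Fin 3 → ZMod 2, koszulSign thirdFirst p • (List.ofFn fun i =>
      opPart K (p (thirdFirst i)) (![a, b, d] (thirdFirst i)
        (![n, k, m] (thirdFirst i)))).prod =
      superSign (p 0 + p 1) (p 2) •
        (opPart K (p 2) (d m) * (opPart K (p 0) (a n) * opPart K (p 1) (b k))) := fun p => by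
    rw [h]
    simp [List.ofFn_succ, thirdFirst]
  have hswap := superSwap_eq_sum_swapPart (fun t : K × K => a n * b k) d 0 m x
  refine Eq.trans ?_ hswap
  rw [superProd, Finset.sum_congr rfl fun p _ => h' p, sum_fin_three fun i j l =>
    superSign (i + j) l • (opPart K l (d m) * (opPart K i (a n) * opPart K j (b k))), superSwap]
  congr 1
  simp only [opPart_mul, Finset.mul_sum, Finset.smul_sum]
  rw [Finset.sum_comm]
  refine Eq.symm (Eq.trans (Finset.sum_congr rfl fun p _ => Finset.sum_comm) ?_)
  rw [Finset.sum_comm]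
  refine Finset.sum_congr rfl fun j _ => ?_
  rw [← sum_add_right j]
  refine Finset.sum_congr rfl fun i _ => Finset.sum_congr rfl fun l _ => ?_
  have : i + j + j = i := by
    have : ∀ i j : ZMod 2, i + j + j = i := by decide
    exact this i j
  rw [this]

end TripleProducts

section Closure

variable {K : Type u} {V : Type v} [Field K] [CharZero K] [AddCommGroup V] [Module K V]

omit [CharZero K] in
theorem IsFieldN.isField₂_slice {c : DistrN K V 3} (hc : IsFieldN c) (m : K × K) :
    IsField₂ fun n k => c ![n, k, m] := by
  classical
  intro x
  obtain ⟨S, hS⟩ := hc x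
  refine ⟨S.image fun h => (h 0, h 1), fun n k hne => ?_⟩
  obtain ⟨h, hh, hle⟩ := hS _ hne
  exact ⟨_, Finset.mem_image_of_mem _ hh, hle 0, hle 1⟩

/-- The field `∂_z^(i) c(z, w, x)` at `z = w`. -/
noncomputable def diagSlice (c : DistrN K V 3) (hc : IsFieldN c) (i : ℕ × ℕ) : Distr₂ K V :=
  fun p m => diagDeriv (fun n k => c ![n, k, m]) (hc.isField₂_slice m) i p

theorem diagSlice_apply (c : DistrN K V 3) (hc : IsFieldN c) (i : ℕ × ℕ) (p m : K × K) (x : V) :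
    diagSlice c hc i p m x = sliceDiag i (fun n k m => c ![n, k, m] x) p m := rfl

theorem isField₂_diagSlice (c : DistrN K V 3) (hc : IsFieldN c) (i : ℕ × ℕ) :
    IsField₂ (diagSlice c hc i) := by
  classical
  intro x
  obtain ⟨S, hS⟩ := hc x
  refine ⟨S.image fun h => (h 0 + h 1 + natPair i + (1, 1), h 2), fun p m hne => ?_⟩
  rw [diagSlice_apply, sliceDiag] at hne
  obtain ⟨n, hn⟩ := not_forall.1 (mt finsum_eq_zero_of_forall_eq_zero hne)
  obtain ⟨h, hh, hle⟩ := hS _ (right_ne_zero_of_smul hn)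
  refine ⟨_, Finset.mem_image_of_mem _ hh, ?_, hle 2⟩
  obtain ⟨j, hj⟩ : NatLE (n - natPair i) (h 0) := hle 0
  obtain ⟨l, hl⟩ : NatLE (p - n - (1, 1)) (h 1) := hle 1
  exact ⟨j + l, by dsimp only; rw [natPair_add, hj, hl]; abel⟩

omit [CharZero K] in
theorem IsField₂.smul {c : Distr₂ K V} (hc : IsField₂ c) (r : K) :
    IsField₂ fun n m => r • c n m := fun x => by
  obtain ⟨S, hS⟩ := hc x
  exact ⟨S, fun n m hne => hS n m (right_ne_zero_of_smul hne)⟩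

/-- The OPE-coefficients of the first two of three multiply local distributions are mutually local
with the third. -/
theorem OPE.mutuallyLocal_coeff [SuperSpace K V] {a b d : Distr K V} (o : OPE (juxt a b))
    (h : MultiplyLocal ![a, b, d]) (N : K × K) : MutuallyLocal (o.coeff N) d := by
  obtain ⟨s, h, c, hh, hc, heq⟩ := h
  have hneg := fun p k => (hh p k).neg
  have hF := fun α x => (hc α).degFinite₃ x
  have hZ : ∀ p m x, o.coeff N p (d m x) = ∑ α, ev (p + N - (1, 1)) (taylorFun N)
      (-(h pair₀₁ (α pair₀₁))) (sliceZ (-(h pair₀₂ (α pair₀₂))) (-(h pair₁₂ (α pair₁₂)))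
        (fun n k m => c α ![n, k, m] x) m) := by
    intro p m x
    rw [OPE.coeff_apply]
    refine sum_ev_eq_of_expandZ (fun i => (o.isField i).degFinite _)
      (fun α => degFinite_sliceZ _ _ (hF α x) m) _ (fun m₀ => ?_) (invariant_taylorFun N)
    have h1 := o.eq_ev (p + N - (1, 1) - m₀) m₀ (d m x)
    rw [sub_add_cancel] at h1
    have h2 := heq 1 ![p + N - (1, 1) - m₀, m₀, m] x
    rw [superProd_one_eq] at h2
    rw [← h1]
    refine h2.trans (Finset.sum_congr rfl fun α _ => ?_)
    rw [mulPows_one_eq_mulPow (hF α x), mulPow_eq_ev, sub_add_cancel]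
  have hW : ∀ p m x, superSwap (o.coeff N) d p m x = ∑ α, ev (p + N - (1, 1)) (taylorFun N)
      (-(h pair₀₁ (α pair₀₁))) (sliceW (-(h pair₀₂ (α pair₀₂))) (-(h pair₁₂ (α pair₁₂)))
        (fun n k m => c α ![n, k, m] x) m) := by
    intro p m x
    have hf : ∀ i r, DegFinite fun n k => swapPart r (d m) (o.num i n k (proj K r x)) :=
      fun i r => ((o.isField i).degFinite _).map _
    have hev : ∀ (D : K × K) (ψ : K × K → K × K → K × K → K),
        ∑ r, swapPart r (d m) (∑ i, ev D ψ (-(o.order i)) fun n k => o.num i n k (proj K r x)) =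
        ∑ i, ev D ψ (-(o.order i)) fun n k =>
          ∑ r, swapPart r (d m) (o.num i n k (proj K r x)) := by
      intro D ψ
      simp only [map_sum, map_ev ψ ((o.isField _).degFinite _)]
      rw [Finset.sum_comm]
      exact Finset.sum_congr rfl fun i _ => (ev_sum _ ψ fun r _ => hf i r).symm
    simp only [superSwap_eq_sum_swapPart, OPE.coeff_apply]
    rw [hev]
    refine sum_ev_eq_of_expandZ (fun i => DegFinite.sum _ fun r _ => hf i r)
      (fun α => degFinite_sliceW (hneg _ _) (hneg _ _) (hF α x) m) _ (fun m₀ => ?_)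
      (invariant_taylorFun N)
    have h1 := fun r => o.eq_ev (p + N - (1, 1) - m₀) m₀ (proj K r x)
    simp only [sub_add_cancel] at h1
    have h2 := heq thirdFirst ![p + N - (1, 1) - m₀, m₀, m] x
    rw [superProd_thirdFirst_eq] at h2
    rw [← hev]
    simp only [← h1]
    refine h2.trans (Finset.sum_congr rfl fun α _ => ?_)
    rw [mulPows_thirdFirst_eq_mulPow (hF α x), mulPow_eq_ev, sub_add_cancel]
  refine LocalPair.of_fintype
    (ι := Σ α : (∀ p, Fin (s p)), decompositions (-(-(h pair₀₁ (α pair₀₁))) - N))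
    (fun j p m => binom₂ (-(h pair₀₂ (j.1 pair₀₂))) (fstPair j.2.1) •
      diagSlice (c j.1) (hc j.1) (sndPair j.2.1) p m)
    (fun j => (isField₂_diagSlice _ _ _).smul _)
    (fun j => -(h pair₀₂ (j.1 pair₀₂)) + -(h pair₁₂ (j.1 pair₁₂)) - natPair (fstPair j.2.1))
    (fun j => ?_) (fun p m x => ?_) (fun p m x => ?_)
  · rw [sub_eq_add_neg]
    exact ((hneg _ _).add (hneg _ _)).add (isStatistical_natPair _).neg
  · rw [Fintype.sum_sigma]
    refine (hZ p m x).trans (Finset.sum_congr rfl fun α _ => ?_)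
    rw [ev_taylorFun_sliceZ' (hF α x), ← Finset.sum_coe_sort]
    rfl
  · rw [Fintype.sum_sigma]
    refine (hW p m x).trans (Finset.sum_congr rfl fun α _ => ?_)
    rw [ev_taylorFun_sliceW' (hF α x) (hneg _ _) (hneg _ _), ← Finset.sum_coe_sort]
    rfl

theorem FoldAlgebra.IsMultiplyLocal.mutuallyLocal_nthProd [SuperSpace K V] {A : FoldAlgebra K V}
    (hm : A.IsMultiplyLocal) (hl : A.IsLocal) (a b d : V) (n : K × K) :
    MutuallyLocal (nthProd (A.Y a) (A.Y b) n) (A.Y d) := by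
  obtain ⟨o, -⟩ := hl a b
  rw [nthProd_eq_coeff o]
  refine o.mutuallyLocal_coeff ?_ _
  have h := hm 3 ![a, b, d]
  have e : (fun i => A.Y (![a, b, d] i)) = ![A.Y a, A.Y b, A.Y d] := by
    funext i
    fin_cases i <;> rfl
  rwa [e] at h

end Closure

end OPEAlg

theorem mainTheorem1 {K : Type u} {V : Type v} [Field K] [CharZero K] [AddCommGroup V]
    [Module K V] [SuperSpace K V] (A : OPEAlg.FoldAlgebra K V) (T T' : Module.End K V) (e : V)
    (hA : A.IsOPEAlgebraWith T T' e) :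
    (∀ (a b : V) (n : K × K),
      (∀ d ∈ A.fieldSpace, OPEAlg.MutuallyLocal (OPEAlg.nthProd (A.Y a) (A.Y b) n) d) →
        OPEAlg.nthProd (A.Y a) (A.Y b) n = A.Y (A.Y a n b)) ∧
    (A.IsMultiplyLocal →
      ∃ B : OPEAlg.FoldAlgebra K A.fieldSpace,
        OPEAlg.IsUnitalSubalgebra A.fieldSpace B ∧
        B.IsOPEAlgebra ∧
        ∃ f : V ≃ₗ[K] A.fieldSpace,
          (∀ a, (f a : OPEAlg.Distr K V) = A.Y a) ∧ A.IsUnitalIso B f) :=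
  ⟨fun a b n h => hA.nthProd_eq_Y a b n fun d => h _ ⟨d, rfl⟩,
    fun hm => hA.exists_isUnitalSubalgebra (hm.mutuallyLocal_nthProd hA.isLocal)⟩
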